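/- Let $M$ be a compact smooth manifold without boundary of dimension $n\ge 1$. Let $\mathcal M$ be the space of smooth Riemannian metrics on $M$, an open cone in $\Gamma(S^2T^*M)$, so that $T_g\mathcal M=\Gamma(S^2T^*M)$. For $g\in\mathcal M$ let $V_g=\int_M dV_g$ be the volume, and let $g_N$ be the generalized Calabi metric on $\mathcal M$, $$g_N(h,k)|_g=\frac1{V_g}\int_M \operatorname{tr}(g^{-1}hg^{-1}k)\,dV_g,\qquad h,k\in T_g\mathcal M .$$ Then $(\mathcal M,g_N)$ has a Levi-Civita connection, and with respect to it the following holds. For every $g\in\mathcal M$ and $v>0$, the set $$\mathcal Pg\cap\mathcal M_v=\{\rho g:\ \rho\in C^\infty(M),\ \rho>0,\ V_{\rho g}=v\}$$ of metrics of volume $v$ in the conformal class of $g$ is totally geodesic in $(\mathcal M,g_N)$: covariant derivatives of tangent fields along curves in the set are tangent to it, geodesics of $(\mathcal M,g_N)$ tangent to it at some time stay in it, and each of its tangent vectors is the velocity of a geodesic of $(\mathcal M,g_N)$ lying in it. It has constant curvature $\frac n{16}$: the sectional curvature of $g_N$ on every plane tangent to it is $\frac n{16}$, and with the induced metric it is isometric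 to an open portion of a sphere of radius $4/\sqrt n$ in the pre-Hilbert space $C^\infty(M)$ with the inner product of $L^2(M,dV_{g_0})$, for some $g_0\in\mathcal M$. In particular, let $M$ be a compact connected Riemann surface with complex structure $J$, let $g_0$ be a Kähler metric on $M$ with Kähler form $\omega=g_0(J\cdot,\cdot)$, and let $\mathcal H\subset\mathcal M$ be the space of Kähler metrics $g$ on $M$ whose Kähler form $g(J\cdot,\cdot)$ is cohomologous to $\omega$. Then $\mathcal H$ is a totally geodesic portion of a sphere in $(\mathcal M,g_N)$: in the same sense as above it is totally geodesic, has constant curvature $\frac18$, and with the induced metric is isometric to an open portion of a sphere of radius $2\sqrt2$. -/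

import Mathlib

open Set
open scoped Manifold ContDiff Bundle

noncomputable section

namespace RiemMetrics

section General

variable (E : Type*) [NormedAddCommGroup E] [NormedSpace ℝ E]
  (M : Type*) [TopologicalSpace M] [ChartedSpace E M] [IsManifold 𝓘(ℝ, E) ∞ M]

/-- `(0,2)`-tensor fields on `M`, without regularity. -/
def Tensor2 : Type _ :=
  ∀ x : M, TangentSpace 𝓘(ℝ, E) x →L[ℝ] TangentSpace 𝓘(ℝ, E) x →L[ℝ] ℝ

set_option synthInstance.maxHeartbeats 400000 in
instance : AddCommGroup (Tensor2 E M) :=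
  inferInstanceAs (AddCommGroup
    (∀ x : M, TangentSpace 𝓘(ℝ, E) x →L[ℝ] TangentSpace 𝓘(ℝ, E) x →L[ℝ] ℝ))

set_option synthInstance.maxHeartbeats 400000 in
instance : Module ℝ (Tensor2 E M) :=
  inferInstanceAs (Module ℝ
    (∀ x : M, TangentSpace 𝓘(ℝ, E) x →L[ℝ] TangentSpace 𝓘(ℝ, E) x →L[ℝ] ℝ))

variable {E M} in
/-- The section `x ↦ h_x` of the bundle of bilinear forms on the tangent spaces of `M`. -/
def Tensor2.toSection (h : Tensor2 E M) (x : M) :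
    Bundle.TotalSpace (E →L[ℝ] E →L[ℝ] ℝ)
      (fun x : M ↦ TangentSpace 𝓘(ℝ, E) x →L[ℝ] TangentSpace 𝓘(ℝ, E) x →L[ℝ] ℝ) :=
  ⟨x, h x⟩

/-- Smooth `1`-forms on `M`. -/
abbrev OneForm : Type _ :=
  Cₛ^∞⟮𝓘(ℝ, E); E →L[ℝ] ℝ, fun x : M ↦ TangentSpace 𝓘(ℝ, E) x →L[ℝ] ℝ⟯

set_option synthInstance.maxHeartbeats 400000 in
/-- The space `Γ(S²T*M)` of smooth symmetric `(0,2)`-tensor fields on `M`. It is the tangent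
space of the manifold of metrics at every point. -/
def symTensors : Submodule ℝ (Tensor2 E M) where
  carrier := {h | ContMDiff 𝓘(ℝ, E) (𝓘(ℝ, E).prod 𝓘(ℝ, E →L[ℝ] E →L[ℝ] ℝ)) ∞ h.toSection ∧
    ∀ x v w, h x v w = h x w v}
  zero_mem' := by
    refine ⟨?_, fun x v w ↦ rfl⟩
    exact Bundle.contMDiff_zeroSection ℝ
      (fun x : M ↦ TangentSpace 𝓘(ℝ, E) x →L[ℝ] TangentSpace 𝓘(ℝ, E) x →L[ℝ] ℝ)
  add_mem' := by
    intro a b ha hb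
    refine ⟨?_, fun x v w ↦ congrArg₂ (· + ·) (ha.2 x v w) (hb.2 x v w)⟩
    exact ContMDiff.add_section ha.1 hb.1
  smul_mem' := by
    intro c a ha
    refine ⟨?_, fun x v w ↦ congrArg (c * ·) (ha.2 x v w)⟩
    exact ContMDiff.const_smul_section ha.1

variable {M}

/-- The value `h_x(v, w)` of a symmetric tensor field. -/
def val (h : symTensors E M) (x : M) (v w : TangentSpace 𝓘(ℝ, E) x) : ℝ :=
  h.1 x v w

theorem val_add (h k : symTensors E M) (x : M) (v w : TangentSpace 𝓘(ℝ, E) x) :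
    val E (h + k) x v w = val E h x v w + val E k x v w := rfl

theorem val_smul (c : ℝ) (h : symTensors E M) (x : M) (v w : TangentSpace 𝓘(ℝ, E) x) :
    val E (c • h) x v w = c * val E h x v w := rfl

variable (M)

/-- The space `𝓜` of smooth Riemannian metrics on `M`, an open cone in `Γ(S²T*M)`. -/
def metrics : Set (symTensors E M) :=
  {g | ∀ (x : M) (v : TangentSpace 𝓘(ℝ, E) x), v ≠ 0 → 0 < val E g x v v}

variable {M}

/-! ### Curves of tensor fields and of functions

A curve in the Fréchet space `Γ(S²T*M)` (or `C^∞(M)`) is smooth if and only if it is jointly smooth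
in the time variable and in the point of `M`; its derivative is then computed pointwise. -/

/-- The curve `c` of tensor fields is smooth on the set of times `J`. -/
def SmoothCurveOn (c : ℝ → symTensors E M) (J : Set ℝ) : Prop :=
  ContMDiffOn (𝓘(ℝ, ℝ).prod 𝓘(ℝ, E)) (𝓘(ℝ, E).prod 𝓘(ℝ, E →L[ℝ] E →L[ℝ] ℝ)) ∞
    (fun p : ℝ × M ↦ (c p.1).1.toSection p.2)
    (J ×ˢ univ)

/-- The curve `c` of tensor fields has derivative `h` at time `t`. -/
def HasVelocityAt (c : ℝ → symTensors E M) (h : symTensors E M) (t : ℝ) : Prop :=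
  ∀ (x : M) (v w : TangentSpace 𝓘(ℝ, E) x),
    HasDerivAt (fun s ↦ val E (c s) x v w) (val E h x v w) t

/-- The curve `u` of smooth functions is smooth on the set of times `J`. -/
def SmoothFunCurveOn (u : ℝ → C^∞⟮𝓘(ℝ, E), M; 𝓘(ℝ), ℝ⟯) (J : Set ℝ) : Prop :=
  ContMDiffOn (𝓘(ℝ, ℝ).prod 𝓘(ℝ, E)) 𝓘(ℝ) ∞ (fun p : ℝ × M ↦ u p.1 p.2) (J ×ˢ univ)

/-- `h` is a tangent vector at `g` to the subset `N` of `Γ(S²T*M)`: it is the initial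
velocity of a smooth curve in `N` starting at `g`. -/
def IsTangentTo (N : Set (symTensors E M)) (g h : symTensors E M) : Prop :=
  ∃ (c : ℝ → symTensors E M) (J : Set ℝ), IsOpen J ∧ (0 : ℝ) ∈ J ∧ SmoothCurveOn E c J ∧
    (∀ t ∈ J, c t ∈ N) ∧ c 0 = g ∧ HasVelocityAt E c h 0

/-! ### Conformal classes -/

/-- The conformal class `𝓟g = {ρ g : ρ a positive smooth function}`. -/
def conformalClass (g : symTensors E M) : Set (symTensors E M) :=
  {h | ∃ ρ : C^∞⟮𝓘(ℝ, E), M; 𝓘(ℝ), ℝ⟯, (∀ x, 0 < ρ x) ∧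
    ∀ x v w, val E h x v w = ρ x * val E g x v w}

/-! ### Integration against the Riemannian volume -/

section Integral

variable [FiniteDimensional ℝ E]

/-- The parametrization of a neighbourhood of `c` by the coordinates of the preferred chart
at `c` (with respect to a fixed basis of the model space). -/
def param (c : M) (a : Fin (Module.finrank ℝ E) → ℝ) : M :=
  (chartAt E c).symm ((Module.finBasis ℝ E).equivFun.symm a)

/-- The coordinate domain of the preferred chart at `c`. -/
def coordDomain (c : M) : Set (Fin (Module.finrank ℝ E) → ℝ) :=
  {a | (Module.finBasis ℝ E).equivFun.symm a ∈ (chartAt E c).target}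

/-- The coordinate vector field `∂_i` of the preferred chart at `c`. -/
def coordVec (c : M) (a : Fin (Module.finrank ℝ E) → ℝ) (i : Fin (Module.finrank ℝ E)) :
    TangentSpace 𝓘(ℝ, E) (param E c a) :=
  mfderiv 𝓘(ℝ, E) 𝓘(ℝ, E) (chartAt E c).symm ((Module.finBasis ℝ E).equivFun.symm a)
    (Module.finBasis ℝ E i)

/-- The coefficients `g_ij = g(∂_i, ∂_j)` in the preferred chart at `c`. -/
def coordGram (g : symTensors E M) (c : M) (a : Fin (Module.finrank ℝ E) → ℝ) :
    Matrix (Fin (Module.finrank ℝ E)) (Fin (Module.finrank ℝ E)) ℝ :=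
  Matrix.of fun i j ↦ val E g (param E c a) (coordVec E c a i) (coordVec E c a j)

variable [T2Space M] [CompactSpace M]

variable (M) in
/-- A smooth partition of unity `(ρ_c)` subordinate to the chart domains. -/
def chartPartition : SmoothPartitionOfUnity M 𝓘(ℝ, E) M univ :=
  (SmoothPartitionOfUnity.exists_isSubordinate_chartAt_source 𝓘(ℝ, E) M).choose

variable (M) in
theorem chartPartition_isSubordinate :
    (chartPartition E M).IsSubordinate (fun c ↦ (chartAt E c).source) :=
  (SmoothPartitionOfUnity.exists_isSubordinate_chartAt_source 𝓘(ℝ, E) M).choose_spec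

/-- The integral `∫_M f dV_g` of a function against the Riemannian volume of the metric `g`,
`∑_c ∫ ρ_c f √(det g_ij) da`, the sum running over the finitely many nonzero members of a
partition of unity subordinate to the charts. (By the change of variables formula it does not depend
on the charts, the partition of unity or the basis of the model space.) -/
def integral (g : symTensors E M) (f : M → ℝ) : ℝ :=
  ∑ᶠ c : M, ∫ a in coordDomain E c,
    chartPartition E M c (param E c a) * f (param E c a) * Real.sqrt (coordGram E g c a).det

/-- The volume `V_g = ∫_M dV_g`. -/
def vol (g : symTensors E M) : ℝ := integral E g fun _ ↦ 1

variable (M) in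
/-- The set `𝓜_v` of metrics of volume `v`. -/
def metricsOfVol (v : ℝ) : Set (symTensors E M) := {g | g ∈ metrics E M ∧ vol E g = v}

/-! ### The Ebin metric and the generalized Calabi metric -/

/-- The matrix of the bilinear form `h_x` in a fixed basis of `T_xM`. -/
def gram (h : symTensors E M) (x : M) :
    Matrix (Fin (Module.finrank ℝ E)) (Fin (Module.finrank ℝ E)) ℝ :=
  Matrix.of fun i j ↦ val E h x (show E from Module.finBasis ℝ E i) (show E from Module.finBasis ℝ E j)

/-- The Ebin metric `g_E(h, k)|_g = ∫_M tr(g⁻¹ h g⁻¹ k) dV_g`. -/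
def gE (g h k : symTensors E M) : ℝ :=
  integral E g fun x ↦ ((gram E g x)⁻¹ * gram E h x * (gram E g x)⁻¹ * gram E k x).trace

/-- The generalized Calabi metric `g_N = g_E / V_g`. -/
def gN (g h k : symTensors E M) : ℝ := gE E g h k / vol E g

end Integral

/-! ### Riemannian geometry of the manifold of metrics

`G g h k` denotes a Riemannian metric on `𝓜`, the value at `g ∈ 𝓜` on `h, k ∈ T_g𝓜 = Γ(S²T*M)`.
Since `𝓜` is open in a vector space, a connection has the form `∇_h k = D_h k + Γ_g(h, k)`. -/

/-- A family of Christoffel symbols. -/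
abbrev Christoffel (E : Type*) [NormedAddCommGroup E] [NormedSpace ℝ E]
    (M : Type*) [TopologicalSpace M] [ChartedSpace E M] [IsManifold 𝓘(ℝ, E) ∞ M] : Type _ :=
  symTensors E M → symTensors E M →ₗ[ℝ] symTensors E M →ₗ[ℝ] symTensors E M

/-- `∇ = D + Γ` is the Levi-Civita connection of `(𝓜, G)`: torsion free and compatible with `G`,
`D_h (G(k, l)) = G(∇_h k, l) + G(k, ∇_h l)` for constant vector fields `h, k, l`. -/
structure IsLeviCivita (G : symTensors E M → symTensors E M → symTensors E M → ℝ)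
    (Γ : Christoffel E M) : Prop where
  symm : ∀ g ∈ metrics E M, ∀ h k, Γ g h k = Γ g k h
  metric : ∀ g ∈ metrics E M, ∀ h k l,
    HasDerivAt (fun t : ℝ ↦ G (g + t • h) k l) (G g (Γ g h k) l + G g k (Γ g h l)) 0

/-- `Z = ∇_{c'} Y` at time `t`, for a vector field `Y` along the curve `c`. -/
def IsCovDerivAt (Γ : Christoffel E M) (c Y : ℝ → symTensors E M) (Z : symTensors E M)
    (t : ℝ) : Prop :=
  ∃ c' Y', HasVelocityAt E c c' t ∧ HasVelocityAt E Y Y' t ∧ Z = Y' + Γ (c t) c' (Y t)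

/-- `c` is a geodesic of `(𝓜, ∇)` on the open interval `J`, with velocity `c'`:
a smooth curve in `𝓜` with `∇_{c'} c' = 0`. -/
structure IsGeodesicOn (Γ : Christoffel E M) (c c' : ℝ → symTensors E M) (J : Set ℝ) :
    Prop where
  isOpen : IsOpen J
  ordConnected : J.OrdConnected
  smooth : SmoothCurveOn E c J
  mem : ∀ t ∈ J, c t ∈ metrics E M
  velocity : ∀ t ∈ J, HasVelocityAt E c (c' t) t
  geodesic : ∀ t ∈ J, IsCovDerivAt E Γ c c' 0 t

/-- `N ⊆ 𝓜` is totally geodesic. For weak Riemannian metrics in infinite dimensions the usual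
descriptions of this notion are not equivalent in general, and all of them are required:
the second fundamental form vanishes, i.e. covariant derivatives of vector fields tangent to `N`
along curves in `N` are tangent to `N`; every geodesic of `𝓜` which is tangent to `N` at some
time stays in `N`; and every vector tangent to `N` is the velocity of a geodesic of `𝓜` lying
in `N`. -/
structure IsTotallyGeodesic (Γ : Christoffel E M) (N : Set (symTensors E M)) : Prop where
  subset : N ⊆ metrics E M
  covDeriv_tangent : ∀ (c Y : ℝ → symTensors E M) (J : Set ℝ), IsOpen J →
    SmoothCurveOn E c J → SmoothCurveOn E Y J → (∀ t ∈ J, c t ∈ N) →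
    (∀ t ∈ J, IsTangentTo E N (c t) (Y t)) →
    ∀ t ∈ J, ∃ Z, IsCovDerivAt E Γ c Y Z t ∧ IsTangentTo E N (c t) Z
  geodesic_mem : ∀ (c c' : ℝ → symTensors E M) (J : Set ℝ), IsGeodesicOn E Γ c c' J →
    ∀ t₀ ∈ J, c t₀ ∈ N → IsTangentTo E N (c t₀) (c' t₀) → ∀ t ∈ J, c t ∈ N
  exists_geodesic : ∀ g ∈ N, ∀ h, IsTangentTo E N g h →
    ∃ (c c' : ℝ → symTensors E M) (J : Set ℝ), IsGeodesicOn E Γ c c' J ∧ (0 : ℝ) ∈ J ∧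
      c 0 = g ∧ c' 0 = h ∧ ∀ t ∈ J, c t ∈ N

/-- `R = R(h, k) l` at `g`, where `R(h, k) = ∇_h ∇_k - ∇_k ∇_h - ∇_[h,k]` is the curvature of
`∇ = D + Γ`, computed on constant vector fields. -/
def IsCurvature (Γ : Christoffel E M) (g h k l R : symTensors E M) : Prop :=
  ∃ A B, HasVelocityAt E (fun t : ℝ ↦ Γ (g + t • h) k l) A 0 ∧
    HasVelocityAt E (fun t : ℝ ↦ Γ (g + t • k) h l) B 0 ∧
    R = A + Γ g h (Γ g k l) - (B + Γ g k (Γ g h l))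

/-- The sectional curvature `G(R(h, k) k, h) / (G(h, h) G(k, k) - G(h, k)²)` of `(𝓜, G)` is
equal to `κ` on all planes tangent to `N`. -/
def HasConstantCurvature (G : symTensors E M → symTensors E M → symTensors E M → ℝ)
    (Γ : Christoffel E M) (N : Set (symTensors E M)) (κ : ℝ) : Prop :=
  ∀ g ∈ N, ∀ h k, IsTangentTo E N g h → IsTangentTo E N g k →
    ∃ R, IsCurvature E Γ g h k k R ∧ G g R h = κ * (G g h h * G g k k - G g h k ^ 2)

/-- The sphere `{u : ∫_M u² dV_{g₀} = r²}` of squared radius `r²` in the pre-Hilbert space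
`C^∞(M)` with the inner product of `L²(M, dV_{g₀})`. -/
def sphere [FiniteDimensional ℝ E] [T2Space M] [CompactSpace M] (g₀ : symTensors E M) (rsq : ℝ) :
    Set C^∞⟮𝓘(ℝ, E), M; 𝓘(ℝ), ℝ⟯ :=
  {u | integral E g₀ (fun x ↦ u x ^ 2) = rsq}

/-- `N`, with the Riemannian metric induced by `G`, is isometric to a portion of a sphere of
squared radius `rsq`: for some metric `g₀` there is a bijection `Φ` of `N` onto an open subset of
the sphere of squared radius `rsq` of `C^∞(M)` with the inner product of `L²(M, dV_{g₀})`, which is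
smooth in both directions (`c` is a smooth curve in `N` iff `Φ ∘ c` is a smooth curve), and whose
differential preserves the inner product. -/
def IsPortionOfSphere [FiniteDimensional ℝ E] [T2Space M] [CompactSpace M]
    (G : symTensors E M → symTensors E M → symTensors E M → ℝ)
    (N : Set (symTensors E M)) (rsq : ℝ) : Prop :=
  ∃ g₀ ∈ metrics E M, ∃ Φ : symTensors E M → C^∞⟮𝓘(ℝ, E), M; 𝓘(ℝ), ℝ⟯,
    InjOn Φ N ∧ MapsTo Φ N (sphere E g₀ rsq) ∧
    (∀ u ∈ Φ '' N, ∃ ε > 0, ∀ w ∈ sphere E g₀ rsq, (∀ x, |w x - u x| < ε) → w ∈ Φ '' N) ∧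
    (∀ (c : ℝ → symTensors E M) (J : Set ℝ), IsOpen J → (∀ t ∈ J, c t ∈ N) →
      (SmoothCurveOn E c J ↔ SmoothFunCurveOn E (fun t ↦ Φ (c t)) J)) ∧
    (∀ (c : ℝ → symTensors E M) (J : Set ℝ), IsOpen J → (∀ t ∈ J, c t ∈ N) →
      SmoothCurveOn E c J → ∀ t ∈ J, ∀ c', HasVelocityAt E c c' t →
      ∃ u' : C^∞⟮𝓘(ℝ, E), M; 𝓘(ℝ), ℝ⟯,
        (∀ x, HasDerivAt (fun s ↦ Φ (c s) x) (u' x) t) ∧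
        integral E g₀ (fun x ↦ u' x ^ 2) = G (c t) c' c')

/-! ### Exterior derivative of a `1`-form -/

/-- The `1`-form `α` in the preferred chart at `c`. -/
def coordForm (α : OneForm E M) (c : M) (y : E) : E →L[ℝ] ℝ :=
  (α ((chartAt E c).symm y)).comp (mfderiv 𝓘(ℝ, E) 𝓘(ℝ, E) (chartAt E c).symm y)

/-- `dα = β`, i.e. `β(v, w) = (D_v α)(w) - (D_w α)(v)` in every preferred chart. -/
def IsExteriorDerivative (α : OneForm E M)
    (β : ∀ x : M, TangentSpace 𝓘(ℝ, E) x → TangentSpace 𝓘(ℝ, E) x → ℝ) : Prop :=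
  ∀ c : M, ∀ y ∈ (chartAt E c).target, ∀ v w : E,
    β ((chartAt E c).symm y) (mfderiv 𝓘(ℝ, E) 𝓘(ℝ, E) (chartAt E c).symm y v)
        (mfderiv 𝓘(ℝ, E) 𝓘(ℝ, E) (chartAt E c).symm y w) =
      fderiv ℝ (coordForm E α c) y v w - fderiv ℝ (coordForm E α c) y w v

end General

/-! ### Riemann surfaces -/

section RiemannSurface

/-- A complex manifold modelled on `ℂ` is a smooth real manifold. -/
instance isManifold_real (X : Type*) [TopologicalSpace X] [ChartedSpace ℂ X]
    [IsManifold 𝓘(ℂ) ω X] : IsManifold 𝓘(ℝ, ℂ) ∞ X := by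
  apply isManifold_of_contDiffOn
  intro e e' he he'
  have h := (contDiffGroupoid ω 𝓘(ℂ)).compatible he he'
  rw [contDiffGroupoid, mem_groupoid_of_pregroupoid] at h
  have h1 : ContDiffOn ℂ ω _ _ := h.1
  exact (h1.restrict_scalars ℝ).of_le le_top

variable (X : Type*) [TopologicalSpace X] [ChartedSpace ℂ X] [IsManifold 𝓘(ℂ) ω X]

variable {X} in
/-- The complex structure `J` of a Riemann surface: multiplication by `i` on tangent spaces
(the tangent space at `x` is identified with `ℂ` by a holomorphic chart). -/
def mulI (x : X) (v : TangentSpace 𝓘(ℝ, ℂ) x) : TangentSpace 𝓘(ℝ, ℂ) x :=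
  (Complex.I * (show ℂ from v) : ℂ)

/-- The metrics on `X` which are compatible with the complex structure,
`g(Jv, Jw) = g(v, w)`. Their Kähler forms are closed, since `X` has real dimension two: these are
the Kähler metrics on `X`. -/
def kahlerMetrics : Set (symTensors ℂ X) :=
  {g | g ∈ metrics ℂ X ∧ ∀ x v w, val ℂ g x (mulI x v) (mulI x w) = val ℂ g x v w}

variable {X}

/-- The Kähler form `ω_g(v, w) = g(Jv, w)`. -/
def kahlerForm (g : symTensors ℂ X) (x : X) (v w : TangentSpace 𝓘(ℝ, ℂ) x) : ℝ :=
  val ℂ g x (mulI x v) w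

/-- The space `𝓗` of Kähler metrics whose Kähler form is cohomologous to that of `g₀`. -/
def kahlerClass (g₀ : symTensors ℂ X) : Set (symTensors ℂ X) :=
  {g | g ∈ kahlerMetrics X ∧ ∃ α : OneForm ℂ X,
    IsExteriorDerivative ℂ α fun x v w ↦ kahlerForm g x v w - kahlerForm g₀ x v w}

end RiemannSurface

end RiemMetrics

end

open Set
open scoped Manifold ContDiff Bundle

noncomputable section

/-! Write n for the dimension. In the conformal class of g substitute f = ρ^{n/4}. Then V_{ρg} = ∫
f² dV_g, a velocity σg at ρg corresponds to f' = (n/4) σ ρ^{n/4-1}, and g_N(σg, σg) = (n/V) ∫ σ²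
ρ^{n/2-2} dV_g = (16/(nV)) ∫ f'² dV_g. So the metrics of volume v are the positive functions on the
sphere ∫ f² = v, with the L² metric scaled by 16/(nv). This is a portion of a sphere of squared
radius 16/n (`isPortionOfSphere_confVol`).

The extrinsic statements need the connection. The metric g_N is the Ebin metric g_E rescaled by the
function 1/V. The Christoffel symbol of g_E is a pointwise formula in g, h, k. The gradient of log V
for g_E is g/(2V), so the rescaling adds the nonlocal terms in `calabiChristoffel`. Although g_N is
only a weak metric, it is nondegenerate, so a Levi-Civita connection is unique on metrics
(`IsLeviCivita.eq`) and every admissible Γ is this formula. On conformal directions it reduces to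
the scalar expression `confChristoffel`.

Tangent vectors at ρg are the σg with ∫ σ ρ^{n/2-1} dV_g = 0. Differentiating this constraint shows
that covariant derivatives stay tangent (`covDeriv_isTangentTo`). Great circles in the variable f
give the geodesics inside the set (`exists_conformal_geodesic`). That every tangent geodesic stays
in the set is proved without a uniqueness theorem for geodesics, by conserved quantities
(`IsGeodesicOn.mem_confVol`): (∫ tr(c⁻¹c') dV)/V is constant, hence zero, so the volume is constant;
then the trace free part of c⁻¹c' times the volume density is constant, hence zero, so c moves by
conformal factors. The curvature is computed directly at ρ = 1 (`curvature_at`).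

On a Riemann surface the Kähler metrics form one conformal class, and n = 2 makes the volume of ρg₀
equal to ∫ ρ dV_{g₀}. The class of the Kähler form of ρg₀ equals that of g₀ exactly when (ρ - 1) ω
is exact, which on a compact connected surface means ∫ (ρ - 1) dV = 0. One direction is Stokes'
theorem (`integral_curl`). The other, `isExactMul_of_integral_eq_zero`, combines the compactly
supported Poincaré lemma in a box with a chain argument using connectedness. Hence `kahlerClass_eq`,
and the case n = 2 applies. -/

namespace RiemMetrics

/-! ### Smoothness of bilinear forms and 1-forms, tested in coordinate frames -/

section HomBundle

open ContinuousLinearMap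

/-- The bundle may be trivialized around any `c` whose chart contains the base point, not just
around the base point itself. This allows one fixed chart to serve all its points. -/
theorem contMDiffWithinAt_hom_bundle_of_mem {𝕜 B F₁ F₂ M : Type*} {n : WithTop ℕ∞}
    {E₁ : B → Type*} {E₂ : B → Type*} [NontriviallyNormedField 𝕜]
    [∀ x, AddCommGroup (E₁ x)] [∀ x, Module 𝕜 (E₁ x)] [NormedAddCommGroup F₁] [NormedSpace 𝕜 F₁]
    [TopologicalSpace (Bundle.TotalSpace F₁ E₁)] [∀ x, TopologicalSpace (E₁ x)]
    [∀ x, AddCommGroup (E₂ x)]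
    [∀ x, Module 𝕜 (E₂ x)] [NormedAddCommGroup F₂] [NormedSpace 𝕜 F₂]
    [TopologicalSpace (Bundle.TotalSpace F₂ E₂)] [∀ x, TopologicalSpace (E₂ x)]
    {EB : Type*} [NormedAddCommGroup EB] [NormedSpace 𝕜 EB] {HB : Type*} [TopologicalSpace HB]
    {IB : ModelWithCorners 𝕜 EB HB} [TopologicalSpace B] [ChartedSpace HB B] {EM : Type*}
    [NormedAddCommGroup EM] [NormedSpace 𝕜 EM] {HM : Type*} [TopologicalSpace HM]
    {IM : ModelWithCorners 𝕜 EM HM} [TopologicalSpace M] [ChartedSpace HM M]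
    [FiberBundle F₁ E₁] [VectorBundle 𝕜 F₁ E₁] [FiberBundle F₂ E₂] [VectorBundle 𝕜 F₂ E₂]
    [∀ x, IsTopologicalAddGroup (E₂ x)] [∀ x, ContinuousSMul 𝕜 (E₂ x)]
    [ContMDiffVectorBundle n F₁ E₁ IB] [ContMDiffVectorBundle n F₂ E₂ IB]
    (f : M → Bundle.TotalSpace (F₁ →L[𝕜] F₂) (fun b : B ↦ E₁ b →L[𝕜] E₂ b)) {s : Set M} {x₀ : M}
    {c : B} (h₁ : (f x₀).1 ∈ (trivializationAt F₁ E₁ c).baseSet)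
    (h₂ : (f x₀).1 ∈ (trivializationAt F₂ E₂ c).baseSet) :
    ContMDiffWithinAt IM (IB.prod 𝓘(𝕜, F₁ →L[𝕜] F₂)) n f s x₀ ↔
      ContMDiffWithinAt IM IB n (fun x ↦ (f x).1) s x₀ ∧
        ContMDiffWithinAt IM 𝓘(𝕜, F₁ →L[𝕜] F₂) n
          (fun x ↦ inCoordinates F₁ E₁ F₂ E₂ c (f x).1 c (f x).1 (f x).2) s x₀ :=
  (trivializationAt (F₁ →L[𝕜] F₂) (fun b : B ↦ E₁ b →L[𝕜] E₂ b) c).contMDiffWithinAt_iff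
    ((Bundle.Trivialization.mem_source _).2 ⟨h₁, h₂⟩)

end HomBundle

section Frames

variable {E : Type*} [NormedAddCommGroup E] [NormedSpace ℝ E]
  {M : Type*} [TopologicalSpace M] [ChartedSpace E M] [IsManifold 𝓘(ℝ, E) ∞ M]

/-- The coordinate frame of the preferred chart at `c`, at the point `x`. -/
def frame (c x : M) : E →L[ℝ] TangentSpace 𝓘(ℝ, E) x :=
  (trivializationAt E (TangentSpace 𝓘(ℝ, E)) c).symmL ℝ x

theorem frame_eq_mfderiv {c x : M} (hx : x ∈ (chartAt E c).source) :
    (frame c x : E →L[ℝ] TangentSpace 𝓘(ℝ, E) x) =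
      mfderiv 𝓘(ℝ, E) 𝓘(ℝ, E) (chartAt E c).symm (chartAt E c x) := by
  have h := TangentBundle.symmL_trivializationAt (I := 𝓘(ℝ, E)) (𝕜 := ℝ) hx
  simp only [mfld_simps, mfderivWithin_univ] at h
  exact h

theorem frame_injective {c x : M} (hx : x ∈ (chartAt E c).source) :
    Function.Injective (frame (E := E) c x) := by
  have hb : x ∈ (trivializationAt E (TangentSpace 𝓘(ℝ, E)) c).baseSet := by simpa using hx
  intro v w h
  have := congrArg ((trivializationAt E (TangentSpace 𝓘(ℝ, E)) c).continuousLinearMapAt ℝ x) h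
  rwa [frame, Bundle.Trivialization.continuousLinearMapAt_symmL _ hb,
    Bundle.Trivialization.continuousLinearMapAt_symmL _ hb] at this

section Smooth

variable {F : Type*} [NormedAddCommGroup F] [NormedSpace ℝ F] {H : Type*} [TopologicalSpace H]
  {I : ModelWithCorners ℝ F H} {N : Type*} [TopologicalSpace N] [ChartedSpace H N]

/-- In finite dimensions a linear map is a finite tuple of its values on a basis, so smoothness can
be checked one vector at a time. -/
theorem contMDiffWithinAt_of_clm_apply [FiniteDimensional ℝ E]
    {F' : Type*} [NormedAddCommGroup F'] [NormedSpace ℝ F'] {f : N → E →L[ℝ] F'} {S : Set N}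
    {p₀ : N} (h : ∀ v, ContMDiffWithinAt I 𝓘(ℝ, F') ∞ (fun p ↦ f p v) S p₀) :
    ContMDiffWithinAt I 𝓘(ℝ, E →L[ℝ] F') ∞ f S p₀ := by
  let d := Module.finrank ℝ E
  have hd : d = Module.finrank ℝ (Fin d → ℝ) := (Module.finrank_fin_fun ℝ).symm
  let e₁ := ContinuousLinearEquiv.ofFinrankEq hd
  let e₂ := (e₁.arrowCongr (1 : F' ≃L[ℝ] F')).trans (ContinuousLinearEquiv.piRing (Fin d))
  have h1 : f = e₂.symm ∘ (fun p ↦ e₂ (f p)) := by ext1 p; simp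
  rw [h1]
  refine e₂.symm.toContinuousLinearMap.contMDiff.contMDiffAt.comp_contMDiffWithinAt p₀ ?_
  rw [contMDiffWithinAt_pi_space]
  exact fun i ↦ h _

/-- The form lives over a map `φ` into M so that one criterion covers fields on M (`φ` the
identity), curves of fields (`φ` the projection from ℝ × M) and fields pulled back to a chart. -/
theorem contMDiffWithinAt_form_iff [FiniteDimensional ℝ E] {φ : N → M}
    (s : ∀ p : N, TangentSpace 𝓘(ℝ, E) (φ p) →L[ℝ] TangentSpace 𝓘(ℝ, E) (φ p) →L[ℝ] ℝ)
    {S : Set N} {p₀ : N} (hφ : ContMDiffWithinAt I 𝓘(ℝ, E) ∞ φ S p₀) (hp : p₀ ∈ S) {c : M}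
    (hc : φ p₀ ∈ (chartAt E c).source) :
    ContMDiffWithinAt I (𝓘(ℝ, E).prod 𝓘(ℝ, E →L[ℝ] E →L[ℝ] ℝ)) ∞
      (fun p ↦ (⟨φ p, s p⟩ : Bundle.TotalSpace (E →L[ℝ] E →L[ℝ] ℝ)
      (fun x : M ↦ TangentSpace 𝓘(ℝ, E) x →L[ℝ] TangentSpace 𝓘(ℝ, E) x →L[ℝ] ℝ))) S p₀ ↔
    ∀ v w : E, ContMDiffWithinAt I 𝓘(ℝ) ∞
      (fun p ↦ s p (frame c (φ p) v) (frame c (φ p) w)) S p₀ := by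
  have hb : φ p₀ ∈ (trivializationAt E (TangentSpace 𝓘(ℝ, E)) c).baseSet := by simpa using hc
  rw [contMDiffWithinAt_hom_bundle_of_mem _ (c := c) hb]
  swap
  · exact ⟨hb, mem_univ _⟩
  have hU : ∀ᶠ p in nhdsWithin p₀ S,
      φ p ∈ (trivializationAt E (TangentSpace 𝓘(ℝ, E)) c).baseSet := by
    apply hφ.continuousWithinAt
    exact (Bundle.Trivialization.open_baseSet _).mem_nhds hb
  have key : ∀ v w : E, (fun p ↦ ContinuousLinearMap.inCoordinates E
      (fun x : M ↦ TangentSpace 𝓘(ℝ, E) x) (E →L[ℝ] ℝ)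
      (fun x : M ↦ TangentSpace 𝓘(ℝ, E) x →L[ℝ] ℝ) c (φ p) c (φ p) (s p) v w)
      =ᶠ[nhdsWithin p₀ S] (fun p ↦ s p (frame c (φ p) v) (frame c (φ p) w)) := by
    intro v w
    filter_upwards [hU] with p hp
    rw [inCoordinates_apply_eq₂ (F₃ := ℝ) (E₃ := Bundle.Trivial M ℝ) hp hp (Set.mem_univ _)]
    simp only [frame, Bundle.Trivialization.symmL_apply _ hp]
    simp
  constructor
  · rintro ⟨-, h⟩ v w
    refine ContMDiffWithinAt.congr_of_eventuallyEq ?_ (key v w).symm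
      ((key v w).symm.self_of_nhdsWithin hp)
    exact (h.clm_apply contMDiffWithinAt_const).clm_apply contMDiffWithinAt_const
  · intro h
    refine ⟨hφ, contMDiffWithinAt_of_clm_apply fun v ↦ contMDiffWithinAt_of_clm_apply fun w ↦ ?_⟩
    exact (h v w).congr_of_eventuallyEq (key v w) ((key v w).self_of_nhdsWithin hp)

theorem contMDiffWithinAt_oneForm_iff [FiniteDimensional ℝ E] {φ : N → M}
    (s : ∀ p : N, TangentSpace 𝓘(ℝ, E) (φ p) →L[ℝ] ℝ)
    {S : Set N} {p₀ : N} (hφ : ContMDiffWithinAt I 𝓘(ℝ, E) ∞ φ S p₀) (hp : p₀ ∈ S) {c : M}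
    (hc : φ p₀ ∈ (chartAt E c).source) :
    ContMDiffWithinAt I (𝓘(ℝ, E).prod 𝓘(ℝ, E →L[ℝ] ℝ)) ∞
      (fun p ↦ (⟨φ p, s p⟩ : Bundle.TotalSpace (E →L[ℝ] ℝ)
      (fun x : M ↦ TangentSpace 𝓘(ℝ, E) x →L[ℝ] ℝ))) S p₀ ↔
    ∀ v : E, ContMDiffWithinAt I 𝓘(ℝ) ∞ (fun p ↦ s p (frame c (φ p) v)) S p₀ := by
  have hb : φ p₀ ∈ (trivializationAt E (TangentSpace 𝓘(ℝ, E)) c).baseSet := by simpa using hc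
  rw [contMDiffWithinAt_hom_bundle_of_mem _ (c := c) hb (mem_univ _)]
  have hU : ∀ᶠ p in nhdsWithin p₀ S,
      φ p ∈ (trivializationAt E (TangentSpace 𝓘(ℝ, E)) c).baseSet := by
    apply hφ.continuousWithinAt
    exact (Bundle.Trivialization.open_baseSet _).mem_nhds hb
  have key : ∀ v : E, (fun p ↦ ContinuousLinearMap.inCoordinates E
      (fun x : M ↦ TangentSpace 𝓘(ℝ, E) x) ℝ
      (Bundle.Trivial M ℝ) c (φ p) c (φ p) (s p) v)
      =ᶠ[nhdsWithin p₀ S] (fun p ↦ s p (frame c (φ p) v)) := by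
    intro v
    filter_upwards [hU] with p hp
    rw [ContinuousLinearMap.inCoordinates_eq hp (mem_univ _)]
    simp only [frame, Bundle.Trivialization.symmL_apply _ hp]
    simp
  constructor
  · rintro ⟨-, h⟩ v
    refine ContMDiffWithinAt.congr_of_eventuallyEq ?_ (key v).symm
      ((key v).symm.self_of_nhdsWithin hp)
    exact h.clm_apply contMDiffWithinAt_const
  · intro h
    refine ⟨hφ, contMDiffWithinAt_of_clm_apply fun v ↦ ?_⟩
    exact (h v).congr_of_eventuallyEq (key v) ((key v).self_of_nhdsWithin hp)

/-- The entries of the matrix-valued function `A` are smooth. -/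
def SmoothMatAt (I : ModelWithCorners ℝ F H) {ι κ : Type*} (A : N → Matrix ι κ ℝ) (S : Set N)
    (p₀ : N) : Prop :=
  ∀ i j, ContMDiffWithinAt I 𝓘(ℝ) ∞ (fun p ↦ A p i j) S p₀

namespace SmoothMatAt

variable {ι κ l : Type*} {A : N → Matrix ι κ ℝ} {S : Set N} {p₀ : N}

theorem mul [Fintype κ] {B : N → Matrix κ l ℝ} (hA : SmoothMatAt I A S p₀)
    (hB : SmoothMatAt I B S p₀) : SmoothMatAt I (fun p ↦ A p * B p) S p₀ := by
  intro i j
  simp only [Matrix.mul_apply]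
  exact ContMDiffWithinAt.sum fun k _ ↦ (hA i k).mul (hB k j)

theorem add {B : N → Matrix ι κ ℝ} (hA : SmoothMatAt I A S p₀)
    (hB : SmoothMatAt I B S p₀) : SmoothMatAt I (fun p ↦ A p + B p) S p₀ :=
  fun i j ↦ (hA i j).add (hB i j)

theorem smul {f : N → ℝ} (hf : ContMDiffWithinAt I 𝓘(ℝ) ∞ f S p₀) (hA : SmoothMatAt I A S p₀) :
    SmoothMatAt I (fun p ↦ f p • A p) S p₀ :=
  fun i j ↦ hf.mul (hA i j)

theorem trace [Fintype ι] {A : N → Matrix ι ι ℝ} (hA : SmoothMatAt I A S p₀) :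
    ContMDiffWithinAt I 𝓘(ℝ) ∞ (fun p ↦ (A p).trace) S p₀ := by
  simp only [Matrix.trace, Matrix.diag]
  exact ContMDiffWithinAt.sum fun k _ ↦ hA k k

theorem det [Fintype ι] [DecidableEq ι] {A : N → Matrix ι ι ℝ} (hA : SmoothMatAt I A S p₀) :
    ContMDiffWithinAt I 𝓘(ℝ) ∞ (fun p ↦ (A p).det) S p₀ := by
  simp only [Matrix.det_apply']
  exact ContMDiffWithinAt.sum fun σ _ ↦
    contMDiffWithinAt_const.mul (contMDiffWithinAt_finsetProd fun k _ ↦ hA _ k)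

theorem inv [Fintype ι] [DecidableEq ι] {A : N → Matrix ι ι ℝ} (hA : SmoothMatAt I A S p₀)
    (h0 : (A p₀).det ≠ 0) : SmoothMatAt I (fun p ↦ (A p)⁻¹) S p₀ := by
  intro i j
  simp only [Matrix.inv_def, Ring.inverse_eq_inv', Matrix.smul_apply, smul_eq_mul,
    Matrix.adjugate_apply]
  refine (hA.det.inv₀ h0).mul (SmoothMatAt.det fun k m ↦ ?_)
  simp only [Matrix.updateRow_apply]
  split_ifs with h
  · exact contMDiffWithinAt_const
  · exact hA k m

theorem congr {B : N → Matrix ι κ ℝ} (hA : SmoothMatAt I A S p₀)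
    (h : ∀ᶠ p in nhdsWithin p₀ S, B p = A p) (hp : p₀ ∈ S) : SmoothMatAt I B S p₀ :=
  fun i j ↦ (hA i j).congr_of_eventuallyEq (h.mono fun p hp ↦ by simp [hp])
    (by simp [h.self_of_nhdsWithin hp])

end SmoothMatAt

end Smooth

/-! ### Matrices of tensor fields and their behaviour under change of frame -/

section Gram

variable [FiniteDimensional ℝ E]

variable (E) in
/-- Square matrices of the size of the model space. -/
abbrev Mat : Type := Matrix (Fin (Module.finrank ℝ E)) (Fin (Module.finrank ℝ E)) ℝ

/-- The matrix of a bilinear form in the fixed basis of the model space. -/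
def formMat (B : E →L[ℝ] E →L[ℝ] ℝ) : Mat E :=
  Matrix.of fun i j ↦ B (Module.finBasis ℝ E i) (Module.finBasis ℝ E j)

/-- The matrix of a linear map in the fixed basis of the model space. -/
def mapMat (L : E →L[ℝ] E) : Mat E :=
  LinearMap.toMatrix (Module.finBasis ℝ E) (Module.finBasis ℝ E) L

theorem apply_finBasis (L : E →L[ℝ] E) (i : Fin (Module.finrank ℝ E)) :
    L (Module.finBasis ℝ E i) = ∑ k, mapMat L k i • Module.finBasis ℝ E k := by
  conv_lhs => rw [← (Module.finBasis ℝ E).sum_repr (L (Module.finBasis ℝ E i))]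
  simp [mapMat, LinearMap.toMatrix_apply]

theorem formMat_comp (B : E →L[ℝ] E →L[ℝ] ℝ) (L : E →L[ℝ] E) :
    Matrix.of (fun i j ↦ B (L (Module.finBasis ℝ E i)) (L (Module.finBasis ℝ E j))) =
      (mapMat L).transpose * formMat B * mapMat L := by
  ext i j
  simp only [Matrix.of_apply, Matrix.mul_apply, Matrix.transpose_apply, apply_finBasis, map_sum,
    map_smul, sum_apply, smul_apply, smul_eq_mul,
    formMat, Finset.sum_mul, Finset.mul_sum]
  refine Finset.sum_congr rfl fun k _ ↦ Finset.sum_congr rfl fun m _ ↦ ?_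
  ring

/-- The bilinear form with a given matrix in the fixed basis of the model space. -/
def matForm (A : Mat E) : E →L[ℝ] E →L[ℝ] ℝ :=
  ∑ i, ∑ j, A i j • ((LinearMap.toContinuousLinearMap ((Module.finBasis ℝ E).coord i)).smulRight
    (LinearMap.toContinuousLinearMap ((Module.finBasis ℝ E).coord j)))

theorem matForm_apply (A : Mat E) (v w : E) :
    matForm A v w =
      ∑ i, ∑ j, A i j * ((Module.finBasis ℝ E).repr v i * (Module.finBasis ℝ E).repr w j) := by
  simp [matForm]

theorem formMat_matForm (A : Mat E) : formMat (matForm A) = A := by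
  ext i j
  simp [formMat, matForm_apply, Finsupp.single_apply]

theorem matForm_formMat (B : E →L[ℝ] E →L[ℝ] ℝ) : matForm (formMat B) = B := by
  ext v w
  rw [matForm_apply]
  conv_rhs => rw [← (Module.finBasis ℝ E).sum_repr v, ← (Module.finBasis ℝ E).sum_repr w]
  simp only [map_sum, map_smul, sum_apply, smul_apply,
    smul_eq_mul, formMat, Matrix.of_apply, Finset.mul_sum]
  rw [Finset.sum_comm]
  refine Finset.sum_congr rfl fun k _ ↦ Finset.sum_congr rfl fun m _ ↦ ?_
  ring

variable (E) in
/-- The value of a tensor field at `x`, as a bilinear form on the model space. -/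
def form (h : symTensors E M) (x : M) : E →L[ℝ] E →L[ℝ] ℝ := h.1 x

theorem gram_eq_formMat (h : symTensors E M) (x : M) : gram E h x = formMat (form E h x) := rfl

theorem val_eq_matForm (h : symTensors E M) (x : M) (v w : TangentSpace 𝓘(ℝ, E) x) :
    val E h x v w = matForm (E := E) (gram E h x) v w := by
  rw [gram_eq_formMat, matForm_formMat]; rfl

theorem gram_ext {h k : symTensors E M} (H : ∀ x, gram E h x = gram E k x) : h = k := by
  apply Subtype.ext
  funext x
  have h2 := congrArg (matForm (E := E)) (H x)
  rw [gram_eq_formMat, gram_eq_formMat, matForm_formMat, matForm_formMat] at h2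
  exact h2

theorem gram_add (h k : symTensors E M) (x : M) : gram E (h + k) x = gram E h x + gram E k x := rfl

theorem gram_smul (c : ℝ) (h : symTensors E M) (x : M) : gram E (c • h) x = c • gram E h x := rfl

theorem gram_neg (h : symTensors E M) (x : M) : gram E (-h) x = -gram E h x := rfl

theorem gram_sub (h k : symTensors E M) (x : M) : gram E (h - k) x = gram E h x - gram E k x := rfl

theorem gram_zero (x : M) : gram E (0 : symTensors E M) x = 0 := rfl

theorem gram_transpose (h : symTensors E M) (x : M) : (gram E h x).transpose = gram E h x := by
  ext i j
  exact h.2.2 x _ _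

/-- The coordinate frame at `c`, as an endomorphism of the model space. -/
def frameL (c x : M) : E →L[ℝ] E := frame c x

/-- The matrix of the coordinate frame at `c`. -/
def frameMat (c x : M) : Mat E := mapMat (frameL (E := E) c x)

theorem frameMat_det_ne_zero {c x : M} (hx : x ∈ (chartAt E c).source) :
    (frameMat (E := E) c x).det ≠ 0 := by
  have h : LinearMap.ker (frameL (E := E) c x : E →ₗ[ℝ] E) = ⊥ :=
    LinearMap.ker_eq_bot.2 (frame_injective hx)
  rw [frameMat, mapMat, LinearMap.det_toMatrix]
  exact fun h0 ↦ (LinearMap.bot_lt_ker_of_det_eq_zero h0).ne' h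

/-- The derivative of the inverse of the preferred chart at `c`. -/
def chartSymmDeriv (c : M) (y : E) : E →L[ℝ] E :=
  mfderiv 𝓘(ℝ, E) 𝓘(ℝ, E) (chartAt E c).symm y

omit [FiniteDimensional ℝ E] in
theorem frameL_eq {c x : M} (hx : x ∈ (chartAt E c).source) :
    frameL c x = chartSymmDeriv c (chartAt E c x) := frame_eq_mfderiv hx

theorem coordGram_eq (g : symTensors E M) (c : M) (a : Fin (Module.finrank ℝ E) → ℝ) :
    coordGram E g c a =
      (mapMat (chartSymmDeriv c ((Module.finBasis ℝ E).equivFun.symm a))).transpose *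
        gram E g (param E c a) *
      mapMat (chartSymmDeriv c ((Module.finBasis ℝ E).equivFun.symm a)) :=
  formMat_comp (form E g (param E c a)) (chartSymmDeriv c ((Module.finBasis ℝ E).equivFun.symm a))

/-- The matrix of the tensor field in the coordinate frame at `c`, as a function of
its matrix in the fixed basis. -/
def inFrame (c x : M) (A : Mat E) : Mat E :=
  (frameMat (E := E) c x).transpose * A * frameMat (E := E) c x

/-- The basis behind `gram` comes from the chart preferred at x and may jump with x, so entries of
`gram` need not be smooth; only those of `inFrame` are. Products A G⁻¹ B again transform as
covariant tensors, so they can be formed before or after passing to the frame. -/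
theorem inFrame_mul_inv_mul {c x : M} (hx : x ∈ (chartAt E c).source) (A G B : Mat E) :
    inFrame c x (A * G⁻¹ * B) = inFrame c x A * (inFrame c x G)⁻¹ * inFrame c x B := by
  have h : IsUnit (frameMat (E := E) c x).det := (frameMat_det_ne_zero hx).isUnit
  have ht : IsUnit (frameMat (E := E) c x).transpose.det := by rwa [Matrix.det_transpose]
  simp only [inFrame, Matrix.mul_inv_rev, Matrix.mul_assoc]
  rw [Matrix.mul_nonsing_inv_cancel_left _ _ h, Matrix.nonsing_inv_mul_cancel_left _ _ ht]

theorem trace_inv_mul_inFrame {c x : M} (hx : x ∈ (chartAt E c).source) (G B : Mat E) :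
    ((inFrame c x G)⁻¹ * inFrame c x B).trace = (G⁻¹ * B).trace := by
  have h : IsUnit (frameMat (E := E) c x).det := (frameMat_det_ne_zero hx).isUnit
  have ht : IsUnit (frameMat (E := E) c x).transpose.det := by rwa [Matrix.det_transpose]
  simp only [inFrame, Matrix.mul_inv_rev, Matrix.mul_assoc]
  rw [Matrix.nonsing_inv_mul_cancel_left _ _ ht, Matrix.trace_mul_comm]
  simp only [Matrix.mul_assoc]
  rw [Matrix.mul_nonsing_inv _ h, Matrix.mul_one]

theorem det_inFrame (c x : M) (A : Mat E) :
    (inFrame c x A).det = (frameMat (E := E) c x).det ^ 2 * A.det := by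
  simp only [inFrame, Matrix.det_mul, Matrix.det_transpose]
  ring

theorem inFrame_add (c x : M) (A B : Mat E) :
    inFrame c x (A + B) = inFrame c x A + inFrame c x B := by
  simp [inFrame, Matrix.mul_add, Matrix.add_mul]

theorem inFrame_smul (c x : M) (r : ℝ) (A : Mat E) :
    inFrame c x (r • A) = r • inFrame c x A := by
  simp [inFrame]

omit [IsManifold 𝓘(ℝ, E) ∞ M] [FiniteDimensional ℝ E] in
theorem eventually_mem_source {F : Type*} [NormedAddCommGroup F] [NormedSpace ℝ F] {H : Type*}
    [TopologicalSpace H] {I : ModelWithCorners ℝ F H} {N : Type*} [TopologicalSpace N]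
    [ChartedSpace H N] {φ : N → M} {S : Set N} {p₀ : N}
    (hφ : ContMDiffWithinAt I 𝓘(ℝ, E) ∞ φ S p₀) :
    ∀ᶠ p in nhdsWithin p₀ S, φ p ∈ (chartAt E (φ p₀)).source :=
  hφ.continuousWithinAt ((chartAt E (φ p₀)).open_source.mem_nhds (mem_chart_source E _))

/-- Reduces smoothness of tensor fields to entries of matrices, where products, traces, determinants
and inverses are handled by `SmoothMatAt`. -/
theorem contMDiffWithinAt_form_iff_smoothMatAt {F : Type*} [NormedAddCommGroup F]
    [NormedSpace ℝ F] {H : Type*} [TopologicalSpace H] {I : ModelWithCorners ℝ F H} {N : Type*}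
    [TopologicalSpace N] [ChartedSpace H N] {φ : N → M} (s : N → E →L[ℝ] E →L[ℝ] ℝ)
    {S : Set N} {p₀ : N} (hφ : ContMDiffWithinAt I 𝓘(ℝ, E) ∞ φ S p₀) (hp : p₀ ∈ S) {c : M}
    (hc : φ p₀ ∈ (chartAt E c).source) :
    ContMDiffWithinAt I (𝓘(ℝ, E).prod 𝓘(ℝ, E →L[ℝ] E →L[ℝ] ℝ)) ∞
      (fun p ↦ (⟨φ p, s p⟩ : Bundle.TotalSpace (E →L[ℝ] E →L[ℝ] ℝ)
      (fun x : M ↦ TangentSpace 𝓘(ℝ, E) x →L[ℝ] TangentSpace 𝓘(ℝ, E) x →L[ℝ] ℝ))) S p₀ ↔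
    SmoothMatAt I (fun p ↦ inFrame c (φ p) (formMat (s p))) S p₀ := by
  have h1 := contMDiffWithinAt_form_iff (I := I) (E := E) (φ := φ) s hφ hp hc
  rw [h1]
  have h2 : ∀ p i j, inFrame c (φ p) (formMat (s p)) i j =
      s p (frameL c (φ p) (Module.finBasis ℝ E i))
        (frameL c (φ p) (Module.finBasis ℝ E j)) := by
    intro p i j
    have := congrFun (congrFun (formMat_comp (s p) (frameL c (φ p))) i) j
    exact this.symm
  constructor
  · intro h i j
    simp only [h2]
    exact h _ _
  · intro h v w
    have h3 : ∀ p, s p (frameL c (φ p) v) (frameL c (φ p) w) =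
        ∑ i, ∑ j, (Module.finBasis ℝ E).repr v i * (Module.finBasis ℝ E).repr w j *
          inFrame c (φ p) (formMat (s p)) i j := by
      intro p
      conv_lhs => rw [← (Module.finBasis ℝ E).sum_repr v, ← (Module.finBasis ℝ E).sum_repr w]
      simp only [h2, map_sum, map_smul, sum_apply, smul_apply, smul_eq_mul, Finset.mul_sum]
      rw [Finset.sum_comm]
      refine Finset.sum_congr rfl fun k _ ↦ Finset.sum_congr rfl fun m _ ↦ ?_
      ring
    have h4 : ContMDiffWithinAt I 𝓘(ℝ) ∞
        (fun p ↦ s p (frameL c (φ p) v) (frameL c (φ p) w)) S p₀ := by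
      simp only [h3]
      exact ContMDiffWithinAt.sum fun i _ ↦ ContMDiffWithinAt.sum fun j _ ↦
        contMDiffWithinAt_const.mul (h i j)
    exact h4

theorem smoothCurveOn_iff {c : ℝ → symTensors E M} {J : Set ℝ} :
    SmoothCurveOn E c J ↔ ∀ p₀ ∈ J ×ˢ (univ : Set M), SmoothMatAt (𝓘(ℝ, ℝ).prod 𝓘(ℝ, E))
      (fun p : ℝ × M ↦ inFrame p₀.2 p.2 (gram E (c p.1) p.2)) (J ×ˢ univ) p₀ := by
  refine forall₂_congr fun p₀ hp ↦ ?_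
  exact contMDiffWithinAt_form_iff_smoothMatAt (E := E) (φ := fun p : ℝ × M ↦ p.2)
    (fun p ↦ form E (c p.1) p.2) contMDiffWithinAt_snd hp (mem_chart_source E _)

theorem smoothMatAt_gram_of_mem (h : symTensors E M) {c x₀ : M}
    (hc : x₀ ∈ (chartAt E c).source) :
    SmoothMatAt 𝓘(ℝ, E) (fun x ↦ inFrame c x (gram E h x)) univ x₀ :=
  (contMDiffWithinAt_form_iff_smoothMatAt (E := E) (φ := fun x : M ↦ x) (fun x ↦ form E h x)
    contMDiffWithinAt_id (mem_univ x₀) hc).1 (h.2.1 x₀).contMDiffWithinAt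

theorem smoothMatAt_gram (h : symTensors E M) (x₀ : M) :
    SmoothMatAt 𝓘(ℝ, E) (fun x ↦ inFrame x₀ x (gram E h x)) univ x₀ :=
  smoothMatAt_gram_of_mem h (mem_chart_source E x₀)

/-- The smooth symmetric tensor field with given matrices. -/
def mkTensor (A : M → Mat E) (hA : ∀ x, (A x).transpose = A x)
    (hs : ∀ x₀, SmoothMatAt 𝓘(ℝ, E) (fun x ↦ inFrame x₀ x (A x)) univ x₀) : symTensors E M :=
  ⟨fun x ↦ matForm (E := E) (A x), by
    intro x₀
    have := (contMDiffWithinAt_form_iff_smoothMatAt (E := E) (φ := fun x : M ↦ x)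
      (fun x ↦ matForm (A x)) contMDiffWithinAt_id (mem_univ x₀) (mem_chart_source E x₀)).2
      (by simpa only [formMat_matForm] using hs x₀)
    exact this.contMDiffAt Filter.univ_mem, by
    intro x v w
    have h1 : ∀ i j, A x i j = A x j i := fun i j ↦ congrFun (congrFun (hA x) j) i
    have h2 : ∀ v w : E, matForm (A x) v w = matForm (A x) w v := by
      intro v w
      rw [matForm_apply, matForm_apply, Finset.sum_comm]
      refine Finset.sum_congr rfl fun k _ ↦ Finset.sum_congr rfl fun m _ ↦ ?_
      rw [h1 m k]; ring
    exact h2 v w⟩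

theorem gram_mkTensor (A : M → Mat E) (hA : ∀ x, (A x).transpose = A x)
    (hs : ∀ x₀, SmoothMatAt 𝓘(ℝ, E) (fun x ↦ inFrame x₀ x (A x)) univ x₀) (x : M) :
    gram E (mkTensor A hA hs) x = A x :=
  formMat_matForm (E := E) (A x)

end Gram
end Frames

/-! ### Derivatives of matrix curves; positivity of the trace form -/

section MatrixCalculus

variable {ι : Type*} [Fintype ι]

theorem hasDerivAt_matrix_mul {κ μ : Type*} {A : ℝ → Matrix κ ι ℝ} {B : ℝ → Matrix ι μ ℝ}
    {A' : Matrix κ ι ℝ} {B' : Matrix ι μ ℝ} {t : ℝ}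
    (hA : ∀ i j, HasDerivAt (fun s ↦ A s i j) (A' i j) t)
    (hB : ∀ i j, HasDerivAt (fun s ↦ B s i j) (B' i j) t) (i : κ) (j : μ) :
    HasDerivAt (fun s ↦ (A s * B s) i j) ((A' * B t + A t * B') i j) t := by
  simp only [Matrix.mul_apply, Matrix.add_apply, ← Finset.sum_add_distrib]
  exact HasDerivAt.fun_sum fun k _ ↦ (hA i k).mul (hB k j)

theorem hasDerivAt_matrix_trace {A : ℝ → Matrix ι ι ℝ} {A' : Matrix ι ι ℝ} {t : ℝ}
    (hA : ∀ i j, HasDerivAt (fun s ↦ A s i j) (A' i j) t) :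
    HasDerivAt (fun s ↦ (A s).trace) A'.trace t := by
  simp only [Matrix.trace, Matrix.diag]
  exact HasDerivAt.fun_sum fun k _ ↦ hA k k

variable [DecidableEq ι]

theorem hasDerivAt_matrix_inv {A : ℝ → Matrix ι ι ℝ} {A' : Matrix ι ι ℝ} {t : ℝ}
    (hA : ∀ i j, HasDerivAt (fun s ↦ A s i j) (A' i j) t) (h0 : (A t).det ≠ 0) (i j : ι) :
    HasDerivAt (fun s ↦ (A s)⁻¹ i j) ((-((A t)⁻¹ * A' * (A t)⁻¹)) i j) t := by
  -- Any Banach algebra norm will do: it is only used to quote the derivative of inversion, and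
  -- hypothesis and conclusion are entrywise.
  let _ : NormedRing (Matrix ι ι ℝ) := Matrix.linftyOpNormedRing
  let _ : NormedAlgebra ℝ (Matrix ι ι ℝ) := Matrix.linftyOpNormedAlgebra
  have h : HasDerivAt A A' t := by
    exact hasDerivAt_pi.2 fun i ↦ hasDerivAt_pi.2 fun j ↦ hA i j
  obtain ⟨u, hu⟩ := (Matrix.isUnit_iff_isUnit_det _).2 h0.isUnit
  have h1 := hasFDerivAt_ringInverse (𝕜 := ℝ) u
  rw [hu] at h1
  have h2 := h1.comp_hasDerivAt t h
  have h3 := hasDerivAt_pi.1 (hasDerivAt_pi.1 h2 i) j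
  have h4 : (↑u⁻¹ : Matrix ι ι ℝ) = (A t)⁻¹ := by
    rw [← hu, Matrix.coe_units_inv]
  simpa [Function.comp_def, ← Matrix.nonsing_inv_eq_ringInverse, h4] using h3

/-- Jacobi's formula. By Cramer's rule the i-th diagonal entry of `adjugate * A'` is the determinant
with column i replaced by that of A'. Expanding these over permutations gives the product rule
applied to the determinant. -/
theorem hasDerivAt_matrix_det {A : ℝ → Matrix ι ι ℝ} {A' : Matrix ι ι ℝ} {t : ℝ}
    (hA : ∀ i j, HasDerivAt (fun s ↦ A s i j) (A' i j) t) (h0 : (A t).det ≠ 0) :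
    HasDerivAt (fun s ↦ (A s).det) ((A t).det * ((A t)⁻¹ * A').trace) t := by
  have key : (A t).det * ((A t)⁻¹ * A').trace =
      ∑ σ : Equiv.Perm ι, (Equiv.Perm.sign σ : ℝ) *
        ∑ i, (∏ k ∈ Finset.univ.erase i, A t (σ k) k) • A' (σ i) i := by
    have h1 : (A t).det * ((A t)⁻¹ * A').trace = ((A t).adjugate * A').trace := by
      rw [Matrix.inv_def, Matrix.smul_mul, Matrix.trace_smul, Ring.inverse_eq_inv', smul_eq_mul,
        mul_inv_cancel_left₀ h0]
    have h2 : ∀ i, ((A t).adjugate * A') i i =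
        ((A t).updateCol i (fun k ↦ A' k i)).det := by
      intro i
      rw [← Matrix.cramer_apply, Matrix.cramer_eq_adjugate_mulVec]
      rfl
    rw [h1]
    simp only [Matrix.trace, Matrix.diag, h2, Matrix.det_apply', Finset.mul_sum]
    rw [Finset.sum_comm]
    refine Finset.sum_congr rfl fun σ _ ↦ Finset.sum_congr rfl fun i _ ↦ ?_
    rw [← Finset.mul_prod_erase Finset.univ _ (Finset.mem_univ i)]
    simp only [Matrix.updateCol_self, smul_eq_mul]
    rw [mul_comm (A' (σ i) i)]
    congr 2
    refine Finset.prod_congr rfl fun k hk ↦ ?_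
    rw [Matrix.updateCol_ne (Finset.ne_of_mem_erase hk)]
  rw [key]
  simp only [Matrix.det_apply']
  exact HasDerivAt.fun_sum fun σ _ ↦ (HasDerivAt.fun_finsetProd fun k _ ↦ hA _ k).const_mul _

end MatrixCalculus

section PosDef

variable {ι : Type*} [Fintype ι] [DecidableEq ι]

open scoped MatrixOrder Matrix.Norms.L2Operator in
-- With G = SᵀS and K = S⁻ᵀHS⁻¹, which is symmetric, the trace is the squared Frobenius norm of K.
-- This is the definiteness of g_E at a point.
theorem trace_inv_mul_sq_nonneg {G H : Matrix ι ι ℝ} (hG : G.PosDef) (hH : H.transpose = H) :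
    0 ≤ (G⁻¹ * H * G⁻¹ * H).trace ∧ ((G⁻¹ * H * G⁻¹ * H).trace = 0 → H = 0) := by
  obtain ⟨S, hS⟩ : ∃ S : Matrix ι ι ℝ, G = S.transpose * S := by
    obtain ⟨S, hS⟩ := CStarAlgebra.nonneg_iff_eq_star_mul_self.1 hG.posSemidef.nonneg
    refine ⟨S, ?_⟩
    rwa [Matrix.star_eq_conjTranspose, Matrix.conjTranspose_eq_transpose_of_trivial] at hS
  have hd : IsUnit S.det := by
    have := hG.det_pos
    rw [hS, Matrix.det_mul, Matrix.det_transpose] at this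
    exact (left_ne_zero_of_mul this.ne').isUnit
  have hdt : IsUnit S.transpose.det := by rwa [Matrix.det_transpose]
  set K := S.transpose⁻¹ * H * S⁻¹ with hK
  have hKt : K.transpose = K := by
    simp only [hK, Matrix.transpose_mul, Matrix.transpose_nonsing_inv, Matrix.transpose_transpose,
      hH, Matrix.mul_assoc]
  have h1 : (G⁻¹ * H * G⁻¹ * H).trace = (K.transpose * K).trace := by
    rw [hKt, hK, hS, Matrix.mul_inv_rev]
    simp only [Matrix.mul_assoc]
    rw [Matrix.trace_mul_comm]
    simp only [Matrix.mul_assoc]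
  have h2 : (K.transpose * K).trace = ∑ i, ∑ j, K j i ^ 2 := by
    simp [Matrix.trace, Matrix.mul_apply, sq]
  rw [h1, h2]
  refine ⟨by positivity, fun h ↦ ?_⟩
  have hK0 : K = 0 := by
    ext i j
    have h3 := (Finset.sum_eq_zero_iff_of_nonneg (fun i _ ↦ by positivity)).1 h j (Finset.mem_univ _)
    have h4 := (Finset.sum_eq_zero_iff_of_nonneg (fun i _ ↦ by positivity)).1 h3 i
      (Finset.mem_univ _)
    simpa using h4
  have h5 : H = S.transpose * K * S := by
    rw [hK]
    simp only [Matrix.mul_assoc]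
    rw [Matrix.nonsing_inv_mul _ hd, Matrix.mul_one, Matrix.mul_nonsing_inv_cancel_left _ _ hdt]
  rw [h5, hK0]; simp

end PosDef

/-! ### Metrics as positive definite matrices; smooth invariants of tensor fields -/

section Metrics

variable {E : Type*} [NormedAddCommGroup E] [NormedSpace ℝ E] [FiniteDimensional ℝ E]
  {M : Type*} [TopologicalSpace M] [ChartedSpace E M] [IsManifold 𝓘(ℝ, E) ∞ M]

theorem val_eq_dotProduct (h : symTensors E M) (x : M) (v : E) :
    val E h x v v = (Module.finBasis ℝ E).repr v ⬝ᵥ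
      (gram E h x).mulVec ((Module.finBasis ℝ E).repr v) := by
  have h1 : val E h x v v = _ := val_eq_matForm h x v v
  rw [h1, matForm_apply]
  simp only [dotProduct, Matrix.mulVec, Finset.mul_sum]
  refine Finset.sum_congr rfl fun k _ ↦ Finset.sum_congr rfl fun m _ ↦ ?_
  ring

theorem mem_metrics_iff {g : symTensors E M} :
    g ∈ metrics E M ↔ ∀ x, (gram E g x).PosDef := by
  constructor
  · intro hg x
    refine Matrix.PosDef.of_dotProduct_mulVec_pos ?_ ?_
    · rw [Matrix.IsHermitian, Matrix.conjTranspose_eq_transpose_of_trivial, gram_transpose]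
    · intro v hv
      have h2 := val_eq_dotProduct g x ((Module.finBasis ℝ E).equivFun.symm v)
      have h3 : ((Module.finBasis ℝ E).repr ((Module.finBasis ℝ E).equivFun.symm v) : _ → ℝ) = v :=
        (Module.finBasis ℝ E).equivFun.apply_symm_apply v
      rw [h3] at h2
      have h4 := hg x ((Module.finBasis ℝ E).equivFun.symm v)
        (fun h0 ↦ hv ((Module.finBasis ℝ E).equivFun.symm.map_eq_zero_iff.1 h0))
      simpa [← h2] using h4
  · intro h x v hv
    have h1 : val E g x v v = _ := val_eq_dotProduct g x v
    rw [h1]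
    have := (h x).dotProduct_mulVec_pos (x := (Module.finBasis ℝ E).equivFun v)
      (fun h0 ↦ hv ((Module.finBasis ℝ E).equivFun.map_eq_zero_iff.1 h0))
    exact this

theorem det_gram_pos {g : symTensors E M} (hg : g ∈ metrics E M) (x : M) :
    0 < (gram E g x).det := (mem_metrics_iff.1 hg x).det_pos

theorem hasVelocityAt_iff {c : ℝ → symTensors E M} {h : symTensors E M} {t : ℝ} :
    HasVelocityAt E c h t ↔
      ∀ x i j, HasDerivAt (fun s ↦ gram E (c s) x i j) (gram E h x i j) t := by
  constructor
  · exact fun H x i j ↦ H x _ _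
  · intro H x v w
    have : ∀ k : symTensors E M, val E k x v w = _ := fun k ↦ val_eq_matForm k x v w
    simp only [this]
    have h2 : ∀ A : Mat E, matForm A (show E from v) (show E from w) = _ :=
      fun A ↦ matForm_apply A _ _
    simp only [h2]
    exact HasDerivAt.fun_sum fun i _ ↦ HasDerivAt.fun_sum fun j _ ↦ (H x i j).mul_const _

end Metrics

section Invariants

variable {E : Type*} [NormedAddCommGroup E] [NormedSpace ℝ E] [FiniteDimensional ℝ E]
  {M : Type*} [TopologicalSpace M] [ChartedSpace E M] [IsManifold 𝓘(ℝ, E) ∞ M]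

variable (E) in
/-- A real function on `ℝ × M` is smooth over the set of times `J`. -/
def SmoothOver (F : ℝ × M → ℝ) (J : Set ℝ) : Prop :=
  ContMDiffOn (𝓘(ℝ, ℝ).prod 𝓘(ℝ, E)) 𝓘(ℝ) ∞ F (J ×ˢ univ)

/-- The trace `tr(g⁻¹ h)`. -/
def tr₁ (g h : symTensors E M) (x : M) : ℝ := ((gram E g x)⁻¹ * gram E h x).trace

/-- The trace `tr(g⁻¹ h g⁻¹ k)`. -/
def tr₂ (g h k : symTensors E M) (x : M) : ℝ :=
  ((gram E g x)⁻¹ * gram E h x * (gram E g x)⁻¹ * gram E k x).trace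

/-- The ratio of the determinants of two tensor fields. -/
def detRatio (g k : symTensors E M) (x : M) : ℝ := (gram E k x).det / (gram E g x).det

omit [FiniteDimensional ℝ E] [IsManifold 𝓘(ℝ, E) ∞ M] in
theorem eventually_snd_mem_source {J : Set ℝ} (p₀ : ℝ × M) :
    ∀ᶠ p in nhdsWithin p₀ (J ×ˢ univ), p.2 ∈ (chartAt E p₀.2).source :=
  eventually_mem_source (I := 𝓘(ℝ, ℝ).prod 𝓘(ℝ, E)) (φ := fun p : ℝ × M ↦ p.2)
    contMDiffWithinAt_snd

/-- The trace of G⁻¹B does not depend on the frame, so it may be computed in the frame around the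
base point, where the entries are smooth. -/
theorem smoothOver_trace {J : Set ℝ} {G B : ℝ × M → Mat E}
    (hG : ∀ p₀ ∈ J ×ˢ (univ : Set M), SmoothMatAt (𝓘(ℝ, ℝ).prod 𝓘(ℝ, E))
      (fun p : ℝ × M ↦ inFrame p₀.2 p.2 (G p)) (J ×ˢ univ) p₀)
    (hB : ∀ p₀ ∈ J ×ˢ (univ : Set M), SmoothMatAt (𝓘(ℝ, ℝ).prod 𝓘(ℝ, E))
      (fun p : ℝ × M ↦ inFrame p₀.2 p.2 (B p)) (J ×ˢ univ) p₀)
    (hd : ∀ p ∈ J ×ˢ (univ : Set M), (G p).det ≠ 0) :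
    SmoothOver E (fun p ↦ ((G p)⁻¹ * B p).trace) J := by
  intro p₀ hp
  have hd0 : (inFrame p₀.2 p₀.2 (G p₀)).det ≠ 0 := by
    rw [det_inFrame]
    exact mul_ne_zero (pow_ne_zero _ (frameMat_det_ne_zero (mem_chart_source E _))) (hd p₀ hp)
  have h1 := (((hG p₀ hp).inv hd0).mul (hB p₀ hp)).trace
  refine h1.congr_of_eventuallyEq ?_ ?_
  · filter_upwards [eventually_snd_mem_source (E := E) p₀] with p hp
    exact (trace_inv_mul_inFrame hp _ _).symm
  · exact (trace_inv_mul_inFrame (mem_chart_source E _) _ _).symm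

theorem smoothMatAt_mul_inv_mul {J : Set ℝ} {A G B : ℝ × M → Mat E} {p₀ : ℝ × M}
    (hp : p₀ ∈ J ×ˢ (univ : Set M))
    (hA : SmoothMatAt (𝓘(ℝ, ℝ).prod 𝓘(ℝ, E))
      (fun p : ℝ × M ↦ inFrame p₀.2 p.2 (A p)) (J ×ˢ univ) p₀)
    (hG : SmoothMatAt (𝓘(ℝ, ℝ).prod 𝓘(ℝ, E))
      (fun p : ℝ × M ↦ inFrame p₀.2 p.2 (G p)) (J ×ˢ univ) p₀)
    (hB : SmoothMatAt (𝓘(ℝ, ℝ).prod 𝓘(ℝ, E))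
      (fun p : ℝ × M ↦ inFrame p₀.2 p.2 (B p)) (J ×ˢ univ) p₀)
    (hd : (G p₀).det ≠ 0) :
    SmoothMatAt (𝓘(ℝ, ℝ).prod 𝓘(ℝ, E))
      (fun p : ℝ × M ↦ inFrame p₀.2 p.2 (A p * (G p)⁻¹ * B p)) (J ×ˢ univ) p₀ := by
  have hd0 : (inFrame p₀.2 p₀.2 (G p₀)).det ≠ 0 := by
    rw [det_inFrame]
    exact mul_ne_zero (pow_ne_zero _ (frameMat_det_ne_zero (mem_chart_source E _))) hd
  refine ((hA.mul (hG.inv hd0)).mul hB).congr ?_ hp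
  filter_upwards [eventually_snd_mem_source (E := E) p₀] with p hp
  exact inFrame_mul_inv_mul hp _ _ _

theorem SmoothCurveOn.tr₁ {c h : ℝ → symTensors E M} {J : Set ℝ} (hc : SmoothCurveOn E c J)
    (hh : SmoothCurveOn E h J) (hd : ∀ t ∈ J, ∀ x, (gram E (c t) x).det ≠ 0) :
    SmoothOver E (fun p ↦ tr₁ (c p.1) (h p.1) p.2) J :=
  smoothOver_trace (smoothCurveOn_iff.1 hc) (smoothCurveOn_iff.1 hh) fun p hp ↦ hd p.1 hp.1 p.2

theorem SmoothCurveOn.tr₂ {c h k : ℝ → symTensors E M} {J : Set ℝ} (hc : SmoothCurveOn E c J)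
    (hh : SmoothCurveOn E h J) (hk : SmoothCurveOn E k J)
    (hd : ∀ t ∈ J, ∀ x, (gram E (c t) x).det ≠ 0) :
    SmoothOver E (fun p ↦ tr₂ (c p.1) (h p.1) (k p.1) p.2) J := by
  have h1 := smoothOver_trace (smoothCurveOn_iff.1 hc) (fun p₀ hp ↦
    smoothMatAt_mul_inv_mul hp (smoothCurveOn_iff.1 hh p₀ hp) (smoothCurveOn_iff.1 hc p₀ hp)
      (smoothCurveOn_iff.1 hk p₀ hp) (hd p₀.1 hp.1 p₀.2)) fun p hp ↦ hd p.1 hp.1 p.2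
  simpa only [RiemMetrics.tr₂, Matrix.mul_assoc] using h1

/-- A single determinant scales by the squared determinant of the frame; the ratio does not, so it
is a function on M. -/
theorem SmoothCurveOn.detRatio {c k : ℝ → symTensors E M} {J : Set ℝ} (hc : SmoothCurveOn E c J)
    (hk : SmoothCurveOn E k J) (hd : ∀ t ∈ J, ∀ x, (gram E (c t) x).det ≠ 0) :
    SmoothOver E (fun p ↦ detRatio (c p.1) (k p.1) p.2) J := by
  intro p₀ hp
  have hf : ∀ x ∈ (chartAt E p₀.2).source, (frameMat (E := E) p₀.2 x).det ^ 2 ≠ 0 :=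
    fun x hx ↦ pow_ne_zero _ (frameMat_det_ne_zero hx)
  have hd0 : (inFrame p₀.2 p₀.2 (gram E (c p₀.1) p₀.2)).det ≠ 0 := by
    rw [det_inFrame]
    exact mul_ne_zero (hf _ (mem_chart_source E _)) (hd _ hp.1 _)
  have h1 := (smoothCurveOn_iff.1 hk p₀ hp).det.div₀ (smoothCurveOn_iff.1 hc p₀ hp).det hd0
  refine h1.congr_of_eventuallyEq ?_ ?_
  · filter_upwards [eventually_snd_mem_source (E := E) p₀] with p hp
    simp only [Pi.div_apply]
    rw [det_inFrame, det_inFrame, mul_div_mul_left _ _ (hf _ hp)]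
    rfl
  · simp only [Pi.div_apply]
    rw [det_inFrame, det_inFrame, mul_div_mul_left _ _ (hf _ (mem_chart_source E _))]
    rfl

theorem smoothCurveOn_const (h : symTensors E M) (J : Set ℝ) :
    SmoothCurveOn E (fun _ ↦ h) J := by
  refine smoothCurveOn_iff.2 fun p₀ _ i j ↦ ?_
  exact (smoothMatAt_gram h p₀.2 i j).comp (t := univ) p₀
    (contMDiffWithinAt_snd (I := 𝓘(ℝ, ℝ)) (J := 𝓘(ℝ, E))) (mapsTo_univ _ _)

theorem SmoothCurveOn.add {c k : ℝ → symTensors E M} {J : Set ℝ} (hc : SmoothCurveOn E c J)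
    (hk : SmoothCurveOn E k J) : SmoothCurveOn E (fun t ↦ c t + k t) J := by
  refine smoothCurveOn_iff.2 fun p₀ hp ↦ ?_
  simp only [gram_add, inFrame_add]
  exact (smoothCurveOn_iff.1 hc p₀ hp).add (smoothCurveOn_iff.1 hk p₀ hp)

theorem SmoothCurveOn.smul {c : ℝ → symTensors E M} {f : ℝ → ℝ} {J : Set ℝ}
    (hf : ContDiffOn ℝ ∞ f J) (hc : SmoothCurveOn E c J) :
    SmoothCurveOn E (fun t ↦ f t • c t) J := by
  refine smoothCurveOn_iff.2 fun p₀ hp ↦ ?_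
  simp only [gram_smul, inFrame_smul]
  refine SmoothMatAt.smul ?_ (smoothCurveOn_iff.1 hc p₀ hp)
  exact (hf.contMDiffOn p₀.1 hp.1).comp p₀
    (contMDiffWithinAt_fst (I := 𝓘(ℝ, ℝ)) (J := 𝓘(ℝ, E))) fun q hq ↦ hq.1

theorem smoothCurveOn_line (g h : symTensors E M) (J : Set ℝ) :
    SmoothCurveOn E (fun t ↦ g + t • h) J :=
  (smoothCurveOn_const g J).add ((smoothCurveOn_const h J).smul contDiffOn_id)

/-- The product of a tensor field and a smooth function. -/
def fmul (f : C^∞⟮𝓘(ℝ, E), M; 𝓘(ℝ), ℝ⟯) (h : symTensors E M) : symTensors E M :=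
  mkTensor (fun x ↦ f x • gram E h x) (fun x ↦ by rw [Matrix.transpose_smul, gram_transpose])
    fun x₀ ↦ by
      simp only [inFrame_smul]
      exact SmoothMatAt.smul (f.contMDiff x₀).contMDiffWithinAt (smoothMatAt_gram h x₀)

theorem gram_fmul (f : C^∞⟮𝓘(ℝ, E), M; 𝓘(ℝ), ℝ⟯) (h : symTensors E M) (x : M) :
    gram E (fmul f h) x = f x • gram E h x := gram_mkTensor _ _ _ _

theorem val_fmul (f : C^∞⟮𝓘(ℝ, E), M; 𝓘(ℝ), ℝ⟯) (h : symTensors E M) (x : M)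
    (v w : TangentSpace 𝓘(ℝ, E) x) : val E (fmul f h) x v w = f x * val E h x v w := by
  have H : ∀ k : symTensors E M, val E k x v w =
      matForm (gram E k x) (show E from v) (show E from w) := fun k ↦ val_eq_matForm k x v w
  rw [H, H, gram_fmul, matForm_apply, matForm_apply]
  simp only [Matrix.smul_apply, smul_eq_mul, Finset.mul_sum, mul_assoc]

theorem SmoothCurveOn.fmul {u : ℝ → C^∞⟮𝓘(ℝ, E), M; 𝓘(ℝ), ℝ⟯} {c : ℝ → symTensors E M}
    {J : Set ℝ} (hu : SmoothFunCurveOn E u J) (hc : SmoothCurveOn E c J) :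
    SmoothCurveOn E (fun t ↦ fmul (u t) (c t)) J := by
  refine smoothCurveOn_iff.2 fun p₀ hp ↦ ?_
  simp only [gram_fmul, inFrame_smul]
  exact SmoothMatAt.smul (hu p₀ hp) (smoothCurveOn_iff.1 hc p₀ hp)

omit [FiniteDimensional ℝ E] [IsManifold 𝓘(ℝ, E) ∞ M] in
theorem SmoothOver.slice {F : ℝ × M → ℝ} {J : Set ℝ} (hF : SmoothOver E F J) {t : ℝ}
    (ht : t ∈ J) : ContMDiff 𝓘(ℝ, E) 𝓘(ℝ) ∞ (fun x ↦ F (t, x)) := by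
  rw [← contMDiffOn_univ]
  refine ContMDiffOn.comp (t := J ×ˢ univ) hF
    (contMDiff_const.prodMk contMDiff_id).contMDiffOn fun x _ ↦ ⟨ht, mem_univ x⟩

/-- The slice of a smooth function on `ℝ × M`. -/
def SmoothOver.fn {F : ℝ × M → ℝ} {J : Set ℝ} (hF : SmoothOver E F J) {t : ℝ} (ht : t ∈ J) :
    C^∞⟮𝓘(ℝ, E), M; 𝓘(ℝ), ℝ⟯ := ⟨fun x ↦ F (t, x), hF.slice ht⟩

theorem contMDiff_tr₁ {g : symTensors E M} (hg : g ∈ metrics E M) (h : symTensors E M) :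
    ContMDiff 𝓘(ℝ, E) 𝓘(ℝ) ∞ (tr₁ g h) :=
  ((smoothCurveOn_const g univ).tr₁ (smoothCurveOn_const h univ)
    fun _ _ x ↦ (det_gram_pos hg x).ne').slice (mem_univ (0 : ℝ))

theorem contMDiff_tr₂ {g : symTensors E M} (hg : g ∈ metrics E M) (h k : symTensors E M) :
    ContMDiff 𝓘(ℝ, E) 𝓘(ℝ) ∞ (tr₂ g h k) :=
  ((smoothCurveOn_const g univ).tr₂ (smoothCurveOn_const h univ) (smoothCurveOn_const k univ)
    fun _ _ x ↦ (det_gram_pos hg x).ne').slice (mem_univ (0 : ℝ))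

/-- The symmetrized product `(h g⁻¹ k + k g⁻¹ h) / 2`. -/
def symProd {g : symTensors E M} (hg : g ∈ metrics E M) (h k : symTensors E M) : symTensors E M :=
  mkTensor (fun x ↦ (2⁻¹ : ℝ) • (gram E h x * (gram E g x)⁻¹ * gram E k x +
      gram E k x * (gram E g x)⁻¹ * gram E h x)) (fun x ↦ by
    simp only [Matrix.transpose_smul, Matrix.transpose_add, Matrix.transpose_mul, gram_transpose,
      Matrix.transpose_nonsing_inv, Matrix.mul_assoc]
    rw [add_comm]) fun x₀ ↦ by
    have hd0 : (inFrame x₀ x₀ (gram E g x₀)).det ≠ 0 := by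
      rw [det_inFrame]
      exact mul_ne_zero (pow_ne_zero _ (frameMat_det_ne_zero (mem_chart_source E _)))
        (det_gram_pos hg x₀).ne'
    have H := smoothMatAt_gram (E := E) (M := M)
    refine (SmoothMatAt.smul (f := fun _ ↦ (2⁻¹ : ℝ)) contMDiffWithinAt_const
      ((((H h x₀).mul ((H g x₀).inv hd0)).mul (H k x₀)).add
      (((H k x₀).mul ((H g x₀).inv hd0)).mul (H h x₀)))).congr ?_ (mem_univ _)
    filter_upwards [eventually_mem_source (I := 𝓘(ℝ, E)) (φ := fun x : M ↦ x) (p₀ := x₀)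
      (S := univ) contMDiffWithinAt_id] with x hx
    rw [inFrame_smul, inFrame_add, inFrame_mul_inv_mul hx, inFrame_mul_inv_mul hx]

theorem gram_symProd {g : symTensors E M} (hg : g ∈ metrics E M) (h k : symTensors E M) (x : M) :
    gram E (symProd hg h k) x = (2⁻¹ : ℝ) • (gram E h x * (gram E g x)⁻¹ * gram E k x +
      gram E k x * (gram E g x)⁻¹ * gram E h x) := gram_mkTensor _ _ _ _

end Invariants

/-! ### Time derivatives of jointly smooth functions -/

section TimeDerivative

variable {E : Type*} [NormedAddCommGroup E] [NormedSpace ℝ E]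
  {M : Type*} [TopologicalSpace M] [ChartedSpace E M] [IsManifold 𝓘(ℝ, E) ∞ M]

omit [IsManifold 𝓘(ℝ, E) ∞ M] in
theorem SmoothOver.contMDiffAt {F : ℝ × M → ℝ} {J : Set ℝ} (hF : SmoothOver E F J)
    (hJ : IsOpen J) {p : ℝ × M} (hp : p.1 ∈ J) :
    ContMDiffAt (𝓘(ℝ, ℝ).prod 𝓘(ℝ, E)) 𝓘(ℝ) ∞ F p :=
  ContMDiffOn.contMDiffAt hF ((hJ.prod isOpen_univ).mem_nhds ⟨hp, mem_univ _⟩)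

omit [IsManifold 𝓘(ℝ, E) ∞ M] in
theorem SmoothOver.contDiffOn {F : ℝ × M → ℝ} {J : Set ℝ} (hF : SmoothOver E F J) (x : M) :
    ContDiffOn ℝ ∞ (fun s ↦ F (s, x)) J := by
  rw [← contMDiffOn_iff_contDiffOn]
  exact ContMDiffOn.comp (t := J ×ˢ univ) hF
    (contMDiff_id.prodMk contMDiff_const).contMDiffOn fun s hs ↦ ⟨hs, mem_univ _⟩

omit [IsManifold 𝓘(ℝ, E) ∞ M] in
theorem SmoothOver.hasDerivAt {F : ℝ × M → ℝ} {J : Set ℝ} (hF : SmoothOver E F J)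
    (hJ : IsOpen J) {t : ℝ} (ht : t ∈ J) (x : M) :
    HasDerivAt (fun s ↦ F (s, x)) (deriv (fun s ↦ F (s, x)) t) t :=
  (((hF.contDiffOn x).contDiffAt (hJ.mem_nhds ht)).differentiableAt (by simp)).hasDerivAt

/-- The time derivative is a partial `mfderiv` of a smooth family, evaluated at the vector 1.
Velocities are only given pointwise by `HasVelocityAt`, so this supplies their joint smoothness. -/
theorem SmoothOver.deriv {F : ℝ × M → ℝ} {J : Set ℝ} (hF : SmoothOver E F J)
    (hJ : IsOpen J) : SmoothOver E (fun p ↦ deriv (fun s ↦ F (s, p.2)) p.1) J := by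
  intro p hp
  have h1 : ContMDiffAt ((𝓘(ℝ, ℝ).prod 𝓘(ℝ, E)).prod 𝓘(ℝ, ℝ)) 𝓘(ℝ) ∞
      (Function.uncurry fun (q : ℝ × M) (s : ℝ) ↦ F (s, q.2)) (p, p.1) := by
    refine ContMDiffAt.comp (p, p.1) (I' := 𝓘(ℝ, ℝ).prod 𝓘(ℝ, E)) (g := F)
      (f := fun q : (ℝ × M) × ℝ ↦ (q.2, q.1.2)) (hF.contMDiffAt hJ hp.1) ?_
    exact contMDiffAt_snd.prodMk (contMDiffAt_snd.comp _ contMDiffAt_fst)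
  have h2 := ContMDiffAt.mfderiv (m := ∞) (fun (q : ℝ × M) (s : ℝ) ↦ F (s, q.2)) (fun q ↦ q.1) h1
    contMDiffAt_fst (by simp)
  have h3 := h2.clm_apply (contMDiffAt_const (c := (1 : ℝ)))
  refine ContMDiffAt.contMDiffWithinAt (h3.congr_of_eventuallyEq ?_)
  refine Filter.Eventually.of_forall fun q ↦ ?_
  simp [inTangentCoordinates_model_space, mfderiv_eq_fderiv]

end TimeDerivative

/-! ### The Riemannian integral: linearity, definiteness, differentiation in time -/

section Integral

variable {E : Type*} [NormedAddCommGroup E] [NormedSpace ℝ E] [FiniteDimensional ℝ E]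
  {M : Type*} [TopologicalSpace M] [ChartedSpace E M]

theorem continuous_equivFun_symm : Continuous (Module.finBasis ℝ E).equivFun.symm :=
  (Module.finBasis ℝ E).equivFunL.symm.continuous

theorem isOpen_coordDomain (c : M) : IsOpen (coordDomain E c) :=
  (chartAt E c).open_target.preimage continuous_equivFun_symm

theorem continuousOn_param (c : M) : ContinuousOn (param E c) (coordDomain E c) :=
  (chartAt E c).continuousOn_symm.comp continuous_equivFun_symm.continuousOn fun _ h ↦ h

theorem param_mem_source {c : M} {a : Fin (Module.finrank ℝ E) → ℝ} (ha : a ∈ coordDomain E c) :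
    param E c a ∈ (chartAt E c).source := (chartAt E c).map_target ha

theorem chartAt_param {c : M} {a : Fin (Module.finrank ℝ E) → ℝ} (ha : a ∈ coordDomain E c) :
    chartAt E c (param E c a) = (Module.finBasis ℝ E).equivFun.symm a :=
  (chartAt E c).right_inv ha

theorem param_equivFun {c x : M} (hx : x ∈ (chartAt E c).source) :
    param E c ((Module.finBasis ℝ E).equivFun (chartAt E c x)) = x := by
  simp [param, (chartAt E c).left_inv hx]

theorem equivFun_mem_coordDomain {c x : M} (hx : x ∈ (chartAt E c).source) :
    (Module.finBasis ℝ E).equivFun (chartAt E c x) ∈ coordDomain E c := by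
  simp [coordDomain, (chartAt E c).map_source hx]

variable [IsManifold 𝓘(ℝ, E) ∞ M]

theorem coordGram_eq_inFrame (g : symTensors E M) {c : M} {a : Fin (Module.finrank ℝ E) → ℝ}
    (ha : a ∈ coordDomain E c) :
    coordGram E g c a = inFrame c (param E c a) (gram E g (param E c a)) := by
  rw [coordGram_eq, inFrame, frameMat, frameL_eq (param_mem_source ha), chartAt_param ha]

/-- The factor r does not depend on g. Hence two metrics have volume densities that differ by a
function on M, whatever the chart. -/
theorem det_coordGram (c : M) (a : Fin (Module.finrank ℝ E) → ℝ) :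
    ∃ r : ℝ, 0 ≤ r ∧ ∀ g : symTensors E M,
      (coordGram E g c a).det = r * (gram E g (param E c a)).det := by
  refine ⟨(mapMat (chartSymmDeriv c ((Module.finBasis ℝ E).equivFun.symm a))).det ^ 2, sq_nonneg _, fun g ↦ ?_⟩
  rw [coordGram_eq, Matrix.det_mul, Matrix.det_mul, Matrix.det_transpose]
  ring

theorem continuousOn_coordGram_det (g : symTensors E M) (c : M) :
    ContinuousOn (fun a ↦ (coordGram E g c a).det) (coordDomain E c) := by
  have h1 : ContinuousOn (fun x ↦ (inFrame c x (gram E g x)).det) (chartAt E c).source :=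
    fun x hx ↦ ((smoothMatAt_gram_of_mem g hx).det.contMDiffAt
      Filter.univ_mem).continuousAt.continuousWithinAt
  exact (h1.comp (continuousOn_param c) fun a ha ↦ param_mem_source ha).congr
    fun a ha ↦ by rw [coordGram_eq_inFrame g ha]; rfl

variable [T2Space M] [CompactSpace M]

/-- The density of the Riemannian volume in a chart, weighted by the partition of unity. -/
def weight (g : symTensors E M) (c : M) (a : Fin (Module.finrank ℝ E) → ℝ) : ℝ :=
  chartPartition E M c (param E c a) * Real.sqrt (coordGram E g c a).det

theorem weight_nonneg (g : symTensors E M) (c : M) (a : Fin (Module.finrank ℝ E) → ℝ) :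
    0 ≤ weight g c a := mul_nonneg ((chartPartition E M).nonneg _ _) (Real.sqrt_nonneg _)

theorem continuousOn_weight (g : symTensors E M) (c : M) :
    ContinuousOn (weight g c) (coordDomain E c) :=
  (((chartPartition E M c).contMDiff.continuous.comp_continuousOn (continuousOn_param c))).mul
    (continuousOn_coordGram_det g c).sqrt

theorem finite_chartPartition : {c : M | (Function.support (chartPartition E M c)).Nonempty}.Finite :=
  (chartPartition E M).locallyFinite.finite_nonempty_of_compact

/-- The chart domain is not compact, but the integrand vanishes off the image of the closed support
of the partition function, which is compact inside the chart. -/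
theorem integrableOn_weight (g : symTensors E M) (c : M) {f : M → ℝ}
    (hf : ContinuousOn f (chartAt E c).source) :
    MeasureTheory.IntegrableOn (fun a ↦ f (param E c a) * weight g c a) (coordDomain E c) := by
  set T := tsupport (chartPartition E M c)
  have hT : T ⊆ (chartAt E c).source := chartPartition_isSubordinate E M c
  have hTc : IsCompact T := (isClosed_tsupport _).isCompact
  set K := (fun x ↦ (Module.finBasis ℝ E).equivFun (chartAt E c x)) '' T
  have hcont : Continuous (Module.finBasis ℝ E).equivFun :=
    (Module.finBasis ℝ E).equivFunL.continuous
  have hK : IsCompact K := hTc.image_of_continuousOn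
    (hcont.comp_continuousOn ((chartAt E c).continuousOn.mono hT))
  have hKD : K ⊆ coordDomain E c := by
    rintro _ ⟨x, hx, rfl⟩
    exact equivFun_mem_coordDomain (hT hx)
  have hc : ContinuousOn (fun a ↦ f (param E c a) * weight g c a) (coordDomain E c) :=
    (hf.comp (continuousOn_param c) fun a ha ↦ param_mem_source ha).mul (continuousOn_weight g c)
  have h1 : MeasureTheory.IntegrableOn (fun a ↦ f (param E c a) * weight g c a) K :=
    (hc.mono hKD).integrableOn_compact hK
  have h2 : MeasureTheory.IntegrableOn (fun a ↦ f (param E c a) * weight g c a)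
      (coordDomain E c \ K) := by
    refine MeasureTheory.integrableOn_zero.congr_fun (fun a ha ↦ ?_)
      ((isOpen_coordDomain c).measurableSet.diff hK.measurableSet)
    have h3 : param E c a ∉ T := fun h ↦ ha.2 ⟨_, h, by
      beta_reduce; rw [chartAt_param ha.1, LinearEquiv.apply_symm_apply]⟩
    simp [weight, image_eq_zero_of_notMem_tsupport h3]
  exact (h1.union h2).mono_set fun a ha ↦ by by_cases h : a ∈ K <;> simp [h, ha]

/-- The finite index set depends neither on the metric nor on the integrand, so linearity and limits
can be taken term by term. -/
theorem integral_eq_sum (g : symTensors E M) (f : M → ℝ) :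
    integral E g f = ∑ c ∈ (finite_chartPartition (E := E) (M := M)).toFinset,
      ∫ a in coordDomain E c, f (param E c a) * weight g c a := by
  rw [integral, finsum_eq_sum_of_support_subset _ 
    (s := (finite_chartPartition (E := E) (M := M)).toFinset)]
  · refine Finset.sum_congr rfl fun c _ ↦ ?_
    congr 1; funext a; rw [weight]; ring
  · intro c hc
    simp only [Finite.coe_toFinset, mem_ofPred_eq]
    by_contra h
    rw [Function.support_nonempty_iff, not_not] at h
    apply hc
    simp [h]

theorem integral_add (g : symTensors E M) {f k : M → ℝ} (hf : Continuous f) (hk : Continuous k) :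
    integral E g (fun x ↦ f x + k x) = integral E g f + integral E g k := by
  simp only [integral_eq_sum, ← Finset.sum_add_distrib]
  refine Finset.sum_congr rfl fun c _ ↦ ?_
  rw [← MeasureTheory.integral_add (integrableOn_weight g c hf.continuousOn)
    (integrableOn_weight g c hk.continuousOn)]
  simp only [add_mul]

theorem integral_const_mul (g : symTensors E M) (r : ℝ) (f : M → ℝ) :
    integral E g (fun x ↦ r * f x) = r * integral E g f := by
  simp only [integral_eq_sum, Finset.mul_sum]
  refine Finset.sum_congr rfl fun c _ ↦ ?_
  rw [← MeasureTheory.integral_const_mul]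
  simp only [mul_assoc]

theorem integral_sub (g : symTensors E M) {f k : M → ℝ} (hf : Continuous f) (hk : Continuous k) :
    integral E g (fun x ↦ f x - k x) = integral E g f - integral E g k := by
  have := integral_add g hf (k := fun x ↦ (-1) * k x) (continuous_const.mul hk)
  rw [integral_const_mul] at this
  simpa [sub_eq_add_neg] using this

theorem integral_zero (g : symTensors E M) : integral E g (fun _ ↦ 0) = 0 := by
  simpa using integral_const_mul g 0 (fun _ ↦ 0)

theorem integral_nonneg (g : symTensors E M) {f : M → ℝ} (hf : ∀ x, 0 ≤ f x) :
    0 ≤ integral E g f := by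
  rw [integral_eq_sum]
  exact Finset.sum_nonneg fun c _ ↦ MeasureTheory.integral_nonneg fun a ↦
    mul_nonneg (hf _) (weight_nonneg _ _ _)

/-- Some partition function is positive at x. In its chart the integrand is continuous and
nonnegative with zero integral, hence vanishes, and at x its weight is positive. -/
theorem eq_zero_of_integral_eq_zero {g : symTensors E M} (hg : g ∈ metrics E M) {f : M → ℝ}
    (hf : Continuous f) (h0 : ∀ x, 0 ≤ f x) (hi : integral E g f = 0) (x : M) : f x = 0 := by
  by_contra hx
  obtain ⟨c, hc⟩ : ∃ c, 0 < chartPartition E M c x := by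
    by_contra! h
    have h1 := (chartPartition E M).sum_eq_one (mem_univ x)
    rw [finsum_eq_zero_of_forall_eq_zero fun c ↦
      le_antisymm (h c) ((chartPartition E M).nonneg c x)] at h1
    exact zero_ne_one h1
  have hxs : x ∈ (chartAt E c).source :=
    chartPartition_isSubordinate E M c (subset_tsupport _ hc.ne')
  rw [integral_eq_sum, Finset.sum_eq_zero_iff_of_nonneg (fun c _ ↦
    MeasureTheory.integral_nonneg fun a ↦ mul_nonneg (h0 _) (weight_nonneg _ _ _))] at hi
  have h1 := hi c (by
    rw [Finite.mem_toFinset]; exact ⟨x, hc.ne'⟩)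
  set a := (Module.finBasis ℝ E).equivFun (chartAt E c x)
  have ha : a ∈ coordDomain E c := equivFun_mem_coordDomain hxs
  have hpa : param E c a = x := param_equivFun hxs
  have hcont : ContinuousOn (fun a ↦ f (param E c a) * weight g c a) (coordDomain E c) :=
    (hf.comp_continuousOn (continuousOn_param c)).mul (continuousOn_weight g c)
  rw [MeasureTheory.setIntegral_eq_zero_iff_of_nonneg_ae (Filter.Eventually.of_forall fun a ↦
    mul_nonneg (h0 _) (weight_nonneg _ _ _)) (integrableOn_weight g c hf.continuousOn)] at h1
  have h2 := MeasureTheory.Measure.eqOn_open_of_ae_eq (f := fun a ↦ f (param E c a) * weight g c a)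
    (g := fun _ ↦ (0 : ℝ)) h1 (isOpen_coordDomain c) hcont continuousOn_const
  have h3 : f x * weight g c a = 0 := by have := h2 ha; simpa only [hpa] using this
  rcases mul_eq_zero.1 h3 with h4 | h4
  · exact hx h4
  · have h5 : 0 < (coordGram E g c a).det := by
      rw [coordGram_eq_inFrame g ha, det_inFrame, hpa]
      have := frameMat_det_ne_zero hxs
      have := det_gram_pos hg x
      positivity
    rw [weight, hpa] at h4
    exact (mul_pos hc (Real.sqrt_pos.2 h5)).ne' h4

/-- All integrals are moved to one reference metric, so that a varying volume form becomes a varying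
integrand. -/
theorem integral_eq_of_detRatio {g : symTensors E M} (hg : g ∈ metrics E M) (k : symTensors E M)
    (f : M → ℝ) : integral E k f = integral E g (fun x ↦ f x * Real.sqrt (detRatio g k x)) := by
  simp only [integral]
  congr 1; funext c; congr 1; funext a
  obtain ⟨r, hr, H⟩ := det_coordGram (M := M) c a
  have hp := det_gram_pos hg (param E c a)
  have h1 : (coordGram E k c a).det =
      (coordGram E g c a).det * detRatio g k (param E c a) := by
    rw [H, H, detRatio, mul_assoc, mul_div_cancel₀ _ hp.ne']
  rw [h1, Real.sqrt_mul (by rw [H]; exact mul_nonneg hr hp.le)]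
  ring

/-- Differentiation under the integral sign. By compactness of M the time derivative is bounded by a
constant C on a closed ball of times, and C times the weight is integrable. -/
theorem hasDerivAt_integral (g : symTensors E M) {F : ℝ × M → ℝ} {J : Set ℝ}
    (hF : SmoothOver E F J) (hJ : IsOpen J) {t : ℝ} (ht : t ∈ J) {F' : M → ℝ}
    (hF' : ∀ x, HasDerivAt (fun s ↦ F (s, x)) (F' x) t) :
    HasDerivAt (fun s ↦ integral E g (fun x ↦ F (s, x))) (integral E g F') t := by
  have hF'eq : F' = fun x ↦ deriv (fun s ↦ F (s, x)) t := funext fun x ↦ (hF' x).deriv.symm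
  obtain ⟨ε, hε, hεJ⟩ := Metric.isOpen_iff.1 hJ t ht
  have hball : Metric.closedBall t (ε / 2) ⊆ J :=
    (Metric.closedBall_subset_ball (half_lt_self hε)).trans hεJ
  obtain ⟨C, hC⟩ := ((isCompact_closedBall t (ε / 2)).prod (isCompact_univ (X := M))).exists_bound_of_continuousOn
    ((hF.deriv hJ).continuousOn.mono (prod_mono hball subset_rfl))
  simp only [integral_eq_sum]
  refine HasDerivAt.fun_sum fun c _ ↦ ?_
  have hcont : ∀ s ∈ J, Continuous fun x ↦ F (s, x) := fun s hs ↦ (hF.slice hs).continuous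
  have hcont' : Continuous F' := by rw [hF'eq]; exact ((hF.deriv hJ).slice ht).continuous
  have hint := integrableOn_weight g c (f := fun _ ↦ (1 : ℝ)) continuousOn_const
  simp only [one_mul] at hint
  refine (hasDerivAt_integral_of_dominated_loc_of_deriv_le (F := fun s a ↦
    F (s, param E c a) * weight g c a) (F' := fun s a ↦
      deriv (fun s ↦ F (s, param E c a)) s * weight g c a) (bound := fun a ↦ C * weight g c a)
    (s := Metric.ball t (ε / 2)) (Metric.ball_mem_nhds _ (half_pos hε)) ?_ ?_ ?_ ?_ ?_ ?_).2.congr_deriv ?_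
  · filter_upwards [hJ.mem_nhds ht] with s hs
    exact (integrableOn_weight g c (hcont s hs).continuousOn).aestronglyMeasurable
  · exact integrableOn_weight g c (hcont t ht).continuousOn
  · have := (integrableOn_weight g c hcont'.continuousOn).aestronglyMeasurable
    rwa [hF'eq] at this
  · refine Filter.Eventually.of_forall fun a s hs ↦ ?_
    rw [norm_mul, Real.norm_of_nonneg (weight_nonneg g c a)]
    exact mul_le_mul_of_nonneg_right (hC (s, param E c a)
      ⟨Metric.ball_subset_closedBall hs, mem_univ _⟩) (weight_nonneg g c a)
  · exact hint.const_mul C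
  · refine Filter.Eventually.of_forall fun a s hs ↦ ?_
    exact (hF.hasDerivAt hJ (hball (Metric.ball_subset_closedBall hs)) _).mul_const _
  · rw [hF'eq]

end Integral

/-! ### The Levi-Civita connection of the generalized Calabi metric: existence and uniqueness -/

section LeviCivita

variable {E : Type*} [NormedAddCommGroup E] [NormedSpace ℝ E] [FiniteDimensional ℝ E]
  {M : Type*} [TopologicalSpace M] [ChartedSpace E M] [IsManifold 𝓘(ℝ, E) ∞ M]

theorem tr₁_add (g h k : symTensors E M) (x : M) : tr₁ g (h + k) x = tr₁ g h x + tr₁ g k x := by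
  simp [tr₁, gram_add, Matrix.mul_add]

theorem tr₁_smul (g : symTensors E M) (r : ℝ) (h : symTensors E M) (x : M) :
    tr₁ g (r • h) x = r * tr₁ g h x := by
  simp [tr₁, gram_smul]

theorem tr₂_comm (g h k : symTensors E M) (x : M) : tr₂ g h k x = tr₂ g k h x := by
  simp only [tr₂]
  rw [Matrix.mul_assoc, Matrix.trace_mul_comm, ← Matrix.mul_assoc]

theorem tr₂_add_left (g h k l : symTensors E M) (x : M) :
    tr₂ g (h + k) l x = tr₂ g h l x + tr₂ g k l x := by
  simp [tr₂, gram_add, Matrix.mul_add, Matrix.add_mul]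

theorem tr₂_smul_left (g : symTensors E M) (r : ℝ) (h l : symTensors E M) (x : M) :
    tr₂ g (r • h) l x = r * tr₂ g h l x := by
  simp [tr₂, gram_smul]

theorem inv_mul_gram {g : symTensors E M} (hg : g ∈ metrics E M) (x : M) :
    (gram E g x)⁻¹ * gram E g x = 1 :=
  Matrix.nonsing_inv_mul _ (det_gram_pos hg x).ne'.isUnit

theorem tr₂_self_left {g : symTensors E M} (hg : g ∈ metrics E M) (h : symTensors E M) (x : M) :
    tr₂ g g h x = tr₁ g h x := by
  simp only [tr₂, tr₁, inv_mul_gram hg, Matrix.one_mul]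

theorem detRatio_self {g : symTensors E M} (hg : g ∈ metrics E M) (x : M) :
    detRatio g g x = 1 := div_self (det_gram_pos hg x).ne'

theorem detRatio_pos {g k : symTensors E M} (hg : g ∈ metrics E M) (hk : k ∈ metrics E M) (x : M) :
    0 < detRatio g k x := div_pos (det_gram_pos hk x) (det_gram_pos hg x)

/-- Jacobi's formula for the volume density: its logarithmic derivative is half of tr(c⁻¹c'). -/
theorem hasDerivAt_sqrt_detRatio {g : symTensors E M} (hg : g ∈ metrics E M)
    {c : ℝ → symTensors E M} {h : symTensors E M} {t : ℝ} (hc : HasVelocityAt E c h t) {x : M}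
    (hd : 0 < (gram E (c t) x).det) :
    HasDerivAt (fun s ↦ Real.sqrt (detRatio g (c s) x))
      (1 / 2 * tr₁ (c t) h x * Real.sqrt (detRatio g (c t) x)) t := by
  have h1 := (hasDerivAt_matrix_det (fun i j ↦ hasVelocityAt_iff.1 hc x i j) hd.ne').div_const
    (gram E g x).det
  have hp : 0 < detRatio g (c t) x := div_pos hd (det_gram_pos hg x)
  refine (HasDerivAt.sqrt h1 hp.ne').congr_deriv ?_
  have hs := Real.sq_sqrt hp.le
  have hs0 := (Real.sqrt_pos.2 hp).ne'
  have e1 : (gram E (c t) x).det * ((gram E (c t) x)⁻¹ * gram E h x).trace / (gram E g x).det =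
      tr₁ (c t) h x * Real.sqrt (detRatio g (c t) x) ^ 2 := by
    rw [hs, detRatio, tr₁]; ring
  rw [e1]
  change _ / (2 * Real.sqrt (detRatio g (c t) x)) = _
  field_simp

/-- The trace `tr(g⁻¹ h g⁻¹ k g⁻¹ l)`. -/
def tr₃ (g h k l : symTensors E M) (x : M) : ℝ :=
  ((gram E g x)⁻¹ * gram E h x * (gram E g x)⁻¹ * gram E k x * (gram E g x)⁻¹ *
    gram E l x).trace

theorem hasDerivAt_tr₂ {c : ℝ → symTensors E M} {h : symTensors E M} {t : ℝ}
    (hc : HasVelocityAt E c h t) (k l : symTensors E M) {x : M}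
    (hd : (gram E (c t) x).det ≠ 0) :
    HasDerivAt (fun s ↦ tr₂ (c s) k l x) (-tr₃ (c t) h k l x - tr₃ (c t) k h l x) t := by
  have h1 := hasDerivAt_matrix_inv (A := fun s ↦ gram E (c s) x) (A' := gram E h x)
    (fun i j ↦ hasVelocityAt_iff.1 hc x i j) hd
  have hk : ∀ k : symTensors E M, ∀ i j, HasDerivAt (fun _ : ℝ ↦ gram E k x i j)
    ((0 : Mat E) i j) t := fun k i j ↦ hasDerivAt_const _ _
  have h2 := hasDerivAt_matrix_trace (hasDerivAt_matrix_mul (hasDerivAt_matrix_mul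
    (hasDerivAt_matrix_mul h1 (hk k)) h1) (hk l))
  refine h2.congr_deriv ?_
  simp only [tr₃, Matrix.mul_zero, add_zero, Matrix.add_mul, Matrix.mul_neg, Matrix.neg_mul,
    Matrix.trace_add, Matrix.trace_neg, Matrix.mul_assoc]
  ring

/-- The trace functions as smooth functions. -/
def trFn₁ {g : symTensors E M} (hg : g ∈ metrics E M) (h : symTensors E M) :
    C^∞⟮𝓘(ℝ, E), M; 𝓘(ℝ), ℝ⟯ := ⟨tr₁ g h, contMDiff_tr₁ hg h⟩

/-- The trace functions as smooth functions. -/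
def trFn₂ {g : symTensors E M} (hg : g ∈ metrics E M) (h k : symTensors E M) :
    C^∞⟮𝓘(ℝ, E), M; 𝓘(ℝ), ℝ⟯ := ⟨tr₂ g h k, contMDiff_tr₂ hg h k⟩

theorem trFn₁_apply {g : symTensors E M} (hg : g ∈ metrics E M) (h : symTensors E M) (x : M) :
    trFn₁ hg h x = tr₁ g h x := rfl

theorem trFn₂_apply {g : symTensors E M} (hg : g ∈ metrics E M) (h k : symTensors E M) (x : M) :
    trFn₂ hg h k x = tr₂ g h k x := rfl

/-- The Christoffel symbol of the Ebin metric. -/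
def ebinChristoffel {g : symTensors E M} (hg : g ∈ metrics E M) (h k : symTensors E M) :
    symTensors E M :=
  -symProd hg h k + (1 / 4 : ℝ) • (fmul (trFn₁ hg h) k + fmul (trFn₁ hg k) h -
    fmul (trFn₂ hg h k) g)

theorem gram_ebinChristoffel {g : symTensors E M} (hg : g ∈ metrics E M) (h k : symTensors E M)
    (x : M) : gram E (ebinChristoffel hg h k) x =
      -((2⁻¹ : ℝ) • (gram E h x * (gram E g x)⁻¹ * gram E k x +
      gram E k x * (gram E g x)⁻¹ * gram E h x)) + (1 / 4 : ℝ) • (tr₁ g h x • gram E k x +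
      tr₁ g k x • gram E h x - tr₂ g h k x • gram E g x) := by
  simp only [ebinChristoffel, gram_add, gram_neg, gram_smul, gram_sub, gram_symProd, gram_fmul,
    trFn₁_apply, trFn₂_apply]

theorem ebinChristoffel_comm {g : symTensors E M} (hg : g ∈ metrics E M) (h k : symTensors E M) :
    ebinChristoffel hg h k = ebinChristoffel hg k h := by
  refine gram_ext fun x ↦ ?_
  rw [gram_ebinChristoffel, gram_ebinChristoffel, tr₂_comm g h k]
  congr 2
  · rw [add_comm]
  · rw [add_comm (tr₁ g h x • _)]

theorem ebinChristoffel_add_left {g : symTensors E M} (hg : g ∈ metrics E M)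
    (h h' k : symTensors E M) :
    ebinChristoffel hg (h + h') k = ebinChristoffel hg h k + ebinChristoffel hg h' k := by
  refine gram_ext fun x ↦ ?_
  rw [gram_add, gram_ebinChristoffel, gram_ebinChristoffel, gram_ebinChristoffel, tr₁_add,
    tr₂_add_left, gram_add, Matrix.add_mul, Matrix.add_mul, Matrix.mul_add]
  module

theorem ebinChristoffel_smul_left {g : symTensors E M} (hg : g ∈ metrics E M) (r : ℝ)
    (h k : symTensors E M) :
    ebinChristoffel hg (r • h) k = r • ebinChristoffel hg h k := by
  refine gram_ext fun x ↦ ?_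
  rw [gram_smul, gram_ebinChristoffel, gram_ebinChristoffel, tr₁_smul,
    tr₂_smul_left, gram_smul, Matrix.smul_mul, Matrix.smul_mul, Matrix.mul_smul]
  module

theorem tr₂_ebinChristoffel {g : symTensors E M} (hg : g ∈ metrics E M) (h k l : symTensors E M)
    (x : M) : tr₂ g (ebinChristoffel hg h k) l x =
      -(1 / 2) * (tr₃ g h k l x + tr₃ g k h l x) + 1 / 4 * (tr₁ g h x * tr₂ g k l x +
        tr₁ g k x * tr₂ g h l x - tr₂ g h k x * tr₁ g l x) := by
  have h1 : tr₂ g (ebinChristoffel hg h k) l x = ((gram E g x)⁻¹ *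
    gram E (ebinChristoffel hg h k) x * (gram E g x)⁻¹ * gram E l x).trace := rfl
  rw [h1, gram_ebinChristoffel, ← tr₂_self_left hg l]
  simp only [tr₃, tr₂, Matrix.mul_add, Matrix.add_mul, Matrix.mul_sub, Matrix.sub_mul,
    Matrix.mul_neg, Matrix.neg_mul, Matrix.mul_smul, Matrix.smul_mul, Matrix.trace_add,
    Matrix.trace_neg, Matrix.trace_sub, Matrix.trace_smul, smul_eq_mul, Matrix.mul_assoc]
  ring

theorem tr₃_rotate (g h k l : symTensors E M) (x : M) : tr₃ g h k l x = tr₃ g k l h x := by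
  simp only [tr₃]
  have h1 : (gram E g x)⁻¹ * gram E h x * (gram E g x)⁻¹ * gram E k x * (gram E g x)⁻¹ *
    gram E l x = ((gram E g x)⁻¹ * gram E h x) * ((gram E g x)⁻¹ * gram E k x * (gram E g x)⁻¹ *
    gram E l x) := by simp only [Matrix.mul_assoc]
  rw [h1, Matrix.trace_mul_comm]
  simp only [Matrix.mul_assoc]

variable [T2Space M] [CompactSpace M]

theorem gE_eq (g h k : symTensors E M) : gE E g h k = integral E g (tr₂ g h k) := rfl

omit [T2Space M] [CompactSpace M] in
theorem continuous_tr₁ {g : symTensors E M} (hg : g ∈ metrics E M) (h : symTensors E M) :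
    Continuous (tr₁ g h) := (contMDiff_tr₁ hg h).continuous

omit [T2Space M] [CompactSpace M] in
theorem continuous_tr₂ {g : symTensors E M} (hg : g ∈ metrics E M) (h k : symTensors E M) :
    Continuous (tr₂ g h k) := (contMDiff_tr₂ hg h k).continuous

theorem gE_comm (g h k : symTensors E M) : gE E g h k = gE E g k h := by
  rw [gE_eq, gE_eq]; congr 1; funext x; exact tr₂_comm g h k x

theorem gE_add_left {g : symTensors E M} (hg : g ∈ metrics E M) (h k l : symTensors E M) :
    gE E g (h + k) l = gE E g h l + gE E g k l := by
  rw [gE_eq, gE_eq, gE_eq, ← integral_add g (continuous_tr₂ hg h l) (continuous_tr₂ hg k l)]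
  congr 1; funext x; exact tr₂_add_left g h k l x

theorem gE_smul_left (g : symTensors E M) (r : ℝ) (h l : symTensors E M) :
    gE E g (r • h) l = r * gE E g h l := by
  rw [gE_eq, gE_eq, ← integral_const_mul]
  congr 1; funext x; exact tr₂_smul_left g r h l x

theorem gE_add_right {g : symTensors E M} (hg : g ∈ metrics E M) (h k l : symTensors E M) :
    gE E g h (k + l) = gE E g h k + gE E g h l := by
  rw [gE_comm, gE_add_left hg, gE_comm g k, gE_comm g l]

theorem gE_smul_right (g : symTensors E M) (r : ℝ) (h l : symTensors E M) :
    gE E g h (r • l) = r * gE E g h l := by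
  rw [gE_comm, gE_smul_left, gE_comm]

theorem vol_eq {g : symTensors E M} (hg : g ∈ metrics E M) (k : symTensors E M) :
    vol E k = integral E g (fun x ↦ Real.sqrt (detRatio g k x)) := by
  rw [vol, integral_eq_of_detRatio hg]; simp

theorem vol_pos [Nonempty M] {g : symTensors E M} (hg : g ∈ metrics E M) : 0 < vol E g := by
  refine lt_of_le_of_ne (integral_nonneg g fun _ ↦ zero_le_one) fun h ↦ ?_
  exact one_ne_zero (eq_zero_of_integral_eq_zero hg continuous_const (fun _ ↦ zero_le_one) h.symm
    (Classical.arbitrary M))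

/-- The integral of the trace `tr(g⁻¹ h)`. -/
def trInt (g h : symTensors E M) : ℝ := integral E g (tr₁ g h)

/-- Pairing with g itself gives ∫ tr(g⁻¹h), which is twice the derivative of the volume. Thus g/2 is
the gradient of V, the source of the term along g in the connection. -/
theorem gE_self_left {g : symTensors E M} (hg : g ∈ metrics E M) (h : symTensors E M) :
    gE E g g h = trInt g h := by
  rw [gE_eq, trInt]; congr 1; funext x; exact tr₂_self_left hg h x

theorem trInt_add {g : symTensors E M} (hg : g ∈ metrics E M) (h k : symTensors E M) :
    trInt g (h + k) = trInt g h + trInt g k := by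
  rw [← gE_self_left hg, gE_add_right hg, gE_self_left hg, gE_self_left hg]

theorem trInt_smul {g : symTensors E M} (hg : g ∈ metrics E M) (r : ℝ) (h : symTensors E M) :
    trInt g (r • h) = r * trInt g h := by
  rw [← gE_self_left hg, gE_smul_right, gE_self_left hg]

/-- The Christoffel symbol of the generalized Calabi metric. -/
def calabiChristoffel {g : symTensors E M} (hg : g ∈ metrics E M) (h k : symTensors E M) :
    symTensors E M :=
  ebinChristoffel hg h k + (1 / (4 * vol E g)) •
    (gE E g h k • g - trInt g h • k - trInt g k • h)

theorem calabiChristoffel_comm {g : symTensors E M} (hg : g ∈ metrics E M)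
    (h k : symTensors E M) : calabiChristoffel hg h k = calabiChristoffel hg k h := by
  rw [calabiChristoffel, calabiChristoffel, ebinChristoffel_comm, gE_comm g h k, sub_right_comm]

theorem calabiChristoffel_add_left {g : symTensors E M} (hg : g ∈ metrics E M)
    (h h' k : symTensors E M) :
    calabiChristoffel hg (h + h') k = calabiChristoffel hg h k + calabiChristoffel hg h' k := by
  simp only [calabiChristoffel, ebinChristoffel_add_left, gE_add_left hg, trInt_add hg]
  module

theorem calabiChristoffel_smul_left {g : symTensors E M} (hg : g ∈ metrics E M) (r : ℝ)
    (h k : symTensors E M) :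
    calabiChristoffel hg (r • h) k = r • calabiChristoffel hg h k := by
  simp only [calabiChristoffel, ebinChristoffel_smul_left, gE_smul_left, trInt_smul hg]
  module

theorem calabiChristoffel_add_right {g : symTensors E M} (hg : g ∈ metrics E M)
    (h k l : symTensors E M) :
    calabiChristoffel hg h (k + l) = calabiChristoffel hg h k + calabiChristoffel hg h l := by
  rw [calabiChristoffel_comm hg h, calabiChristoffel_add_left hg, calabiChristoffel_comm hg k,
    calabiChristoffel_comm hg l]

theorem calabiChristoffel_smul_right {g : symTensors E M} (hg : g ∈ metrics E M) (r : ℝ)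
    (h k : symTensors E M) :
    calabiChristoffel hg h (r • k) = r • calabiChristoffel hg h k := by
  rw [calabiChristoffel_comm hg h, calabiChristoffel_smul_left hg, calabiChristoffel_comm hg k]

end LeviCivita

section LeviCivita

variable {E : Type*} [NormedAddCommGroup E] [NormedSpace ℝ E] [FiniteDimensional ℝ E]
  {M : Type*} [TopologicalSpace M] [ChartedSpace E M] [IsManifold 𝓘(ℝ, E) ∞ M]
  [T2Space M] [CompactSpace M]

/-- The Christoffel symbol of the generalized Calabi metric, as a linear map. -/
def calabiLinear {g : symTensors E M} (hg : g ∈ metrics E M) (h : symTensors E M) :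
    symTensors E M →ₗ[ℝ] symTensors E M where
  toFun k := calabiChristoffel hg h k
  map_add' k l := calabiChristoffel_add_right hg h k l
  map_smul' r k := calabiChristoffel_smul_right hg r h k

/-- The Christoffel symbol of the generalized Calabi metric, as a bilinear map. -/
def calabiBilinear {g : symTensors E M} (hg : g ∈ metrics E M) :
    symTensors E M →ₗ[ℝ] symTensors E M →ₗ[ℝ] symTensors E M where
  toFun h := calabiLinear hg h
  map_add' h h' := LinearMap.ext fun k ↦ calabiChristoffel_add_left hg h h' k
  map_smul' r h := LinearMap.ext fun k ↦ calabiChristoffel_smul_left hg r h k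

variable (E M) in
/-- The Levi-Civita connection of the generalized Calabi metric. -/
def calabiConnection : Christoffel E M := fun g ↦
  @dite _ (g ∈ metrics E M) (Classical.propDecidable _) (fun hg ↦ calabiBilinear hg) fun _ ↦ 0

theorem calabiConnection_apply {g : symTensors E M} (hg : g ∈ metrics E M) (h k : symTensors E M) :
    calabiConnection E M g h k = calabiChristoffel hg h k := by
  rw [calabiConnection, dif_pos hg]; rfl

omit [FiniteDimensional ℝ E] [ChartedSpace E M] [IsManifold 𝓘(ℝ, E) ∞ M] [T2Space M] in
-- The tube lemma: since M is compact, an open condition holding at time t₀ holds for nearby times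
-- uniformly on M.
theorem exists_ball_prod_subset {U : Set (ℝ × M)} (hU : IsOpen U) {t₀ : ℝ}
    (h : ∀ x, (t₀, x) ∈ U) : ∃ ε > 0, ∀ t ∈ Metric.ball t₀ ε, ∀ x, (t, x) ∈ U := by
  obtain ⟨u, v, hu, -, h0, hv, huv⟩ := generalized_tube_lemma (isCompact_singleton (x := t₀))
    (isCompact_univ (X := M)) hU (by
      rintro ⟨t, x⟩ ⟨ht, -⟩
      obtain rfl : t = t₀ := ht
      exact h x)
  obtain ⟨ε, hε, hb⟩ := Metric.isOpen_iff.1 hu t₀ (h0 rfl)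
  exact ⟨ε, hε, fun t ht x ↦ huv ⟨hb ht, hv (mem_univ x)⟩⟩

omit [T2Space M] in
/-- Metrics stay nondegenerate along a short segment. -/
theorem exists_det_pos_line {g : symTensors E M} (hg : g ∈ metrics E M) (h : symTensors E M) :
    ∃ ε > 0, ∀ t ∈ Metric.ball (0 : ℝ) ε, ∀ x, 0 < (gram E (g + t • h) x).det := by
  have h1 : SmoothOver E (fun p : ℝ × M ↦ detRatio g (g + p.1 • h) p.2) univ :=
    SmoothCurveOn.detRatio (c := fun _ ↦ g) (k := fun t ↦ g + t • h) (smoothCurveOn_const g univ)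
      (smoothCurveOn_line g h univ) fun _ _ x ↦ (det_gram_pos hg x).ne'
  have hcont : Continuous (fun p : ℝ × M ↦ detRatio g (g + p.1 • h) p.2) := by
    rw [← continuousOn_univ, ← univ_prod_univ]; exact h1.continuousOn
  have ho : IsOpen {p : ℝ × M | 0 < detRatio g (g + p.1 • h) p.2} :=
    isOpen_lt continuous_const hcont
  have h0 : ∀ x : M, ((0 : ℝ), x) ∈ {p : ℝ × M | 0 < detRatio g (g + p.1 • h) p.2} := by
    intro x
    have e : g + (0 : ℝ) • h = g := by rw [zero_smul, add_zero]
    change 0 < detRatio g (g + (0 : ℝ) • h) x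
    rw [e, detRatio_self hg]
    exact one_pos
  obtain ⟨ε, hε, hb⟩ := exists_ball_prod_subset ho h0
  exact ⟨ε, hε, fun t ht x ↦ (div_pos_iff_of_pos_right (det_gram_pos hg x)).1 (hb t ht x)⟩

omit [T2Space M] [CompactSpace M] in
theorem hasVelocityAt_line (g h : symTensors E M) (t : ℝ) :
    HasVelocityAt E (fun s ↦ g + s • h) h t := by
  refine hasVelocityAt_iff.2 fun x i j ↦ ?_
  have h1 := ((hasDerivAt_id t).mul_const (gram E h x i j)).const_add (gram E g x i j)
  simpa [gram_add, gram_smul] using h1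

omit [FiniteDimensional ℝ E] [IsManifold 𝓘(ℝ, E) ∞ M] [T2Space M] [CompactSpace M] in
theorem SmoothOver.comp {F : ℝ × M → ℝ} {J : Set ℝ} (hF : SmoothOver E F J) {u : ℝ → ℝ}
    (hu : ∀ p ∈ J ×ˢ (univ : Set M), ContDiffAt ℝ ∞ u (F p)) :
    SmoothOver E (fun p ↦ u (F p)) J :=
  fun p hp ↦ ContMDiffAt.comp_contMDiffWithinAt p (hu p hp).contMDiffAt (hF p hp)

omit [FiniteDimensional ℝ E] [IsManifold 𝓘(ℝ, E) ∞ M] [T2Space M] [CompactSpace M] in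
theorem SmoothOver.mul {F G : ℝ × M → ℝ} {J : Set ℝ} (hF : SmoothOver E F J)
    (hG : SmoothOver E G J) : SmoothOver E (fun p ↦ F p * G p) J :=
  ContMDiffOn.mul hF hG

omit [T2Space M] [CompactSpace M] in
theorem SmoothCurveOn.sqrt_detRatio {g : symTensors E M} (hg : g ∈ metrics E M)
    {c : ℝ → symTensors E M} {J : Set ℝ} (hc : SmoothCurveOn E c J)
    (hd : ∀ t ∈ J, ∀ x, 0 < (gram E (c t) x).det) :
    SmoothOver E (fun p ↦ Real.sqrt (RiemMetrics.detRatio g (c p.1) p.2)) J :=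
  (SmoothCurveOn.detRatio (c := fun _ ↦ g) (k := c) (smoothCurveOn_const g J) hc
    fun _ _ x ↦ (det_gram_pos hg x).ne').comp fun p hp ↦
    Real.contDiffAt_sqrt (div_pos (hd p.1 hp.1 p.2) (det_gram_pos hg p.2)).ne'

/-- The reference metric is chosen to be `c t` itself, so the density ratio equals 1 at the time of
differentiation. -/
theorem hasDerivAt_vol {c : ℝ → symTensors E M} {J : Set ℝ} (hc : SmoothCurveOn E c J)
    (hJ : IsOpen J) {t : ℝ} (ht : t ∈ J) (hd : ∀ t ∈ J, ∀ x, 0 < (gram E (c t) x).det)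
    (hct : c t ∈ metrics E M) {h : symTensors E M} (hv : HasVelocityAt E c h t) :
    HasDerivAt (fun s ↦ vol E (c s)) (1 / 2 * trInt (c t) h) t := by
  simp only [vol_eq hct]
  refine (hasDerivAt_integral (c t) (hc.sqrt_detRatio hct hd) hJ ht
    (fun x ↦ hasDerivAt_sqrt_detRatio hct hv (hd t ht x))).congr_deriv ?_
  simp only [detRatio_self hct, Real.sqrt_one, mul_one]
  exact integral_const_mul _ _ _

theorem hasDerivAt_gE_line {g : symTensors E M} (hg : g ∈ metrics E M) (h k l : symTensors E M) :
    HasDerivAt (fun t : ℝ ↦ gE E (g + t • h) k l) (integral E g fun x ↦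
      -tr₃ g h k l x - tr₃ g k h l x + 1 / 2 * tr₁ g h x * tr₂ g k l x) 0 := by
  obtain ⟨ε, hε, hd⟩ := exists_det_pos_line hg h
  have hc := smoothCurveOn_line g h (Metric.ball 0 ε)
  have h1 : SmoothOver E (fun p : ℝ × M ↦ tr₂ (g + p.1 • h) k l p.2 *
      Real.sqrt (detRatio g (g + p.1 • h) p.2)) (Metric.ball 0 ε) :=
    (SmoothCurveOn.tr₂ (c := fun t ↦ g + t • h) (h := fun _ ↦ k) (k := fun _ ↦ l) hc
      (smoothCurveOn_const k _) (smoothCurveOn_const l _) fun t ht x ↦ (hd t ht x).ne').mul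
      (SmoothCurveOn.sqrt_detRatio (c := fun t ↦ g + t • h) hg hc hd)
  have h2 : ∀ t : ℝ, gE E (g + t • h) k l = integral E g (fun x ↦ tr₂ (g + t • h) k l x *
      Real.sqrt (detRatio g (g + t • h) x)) := fun t ↦ integral_eq_of_detRatio hg _ _
  have h0 : (0 : ℝ) ∈ Metric.ball (0 : ℝ) ε := Metric.mem_ball_self hε
  have hg0 : g + (0 : ℝ) • h = g := by simp
  have hF : ∀ x, HasDerivAt (fun t : ℝ ↦ tr₂ (g + t • h) k l x *
      Real.sqrt (detRatio g (g + t • h) x))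
      (-tr₃ g h k l x - tr₃ g k h l x + 1 / 2 * tr₁ g h x * tr₂ g k l x) 0 := by
    intro x
    have e1 := hasDerivAt_tr₂ (hasVelocityAt_line g h 0) k l (hd 0 h0 x).ne'
    have e2 := hasDerivAt_sqrt_detRatio hg (hasVelocityAt_line g h 0) (hd 0 h0 x)
    refine (e1.mul e2).congr_deriv ?_
    rw [hg0, detRatio_self hg, Real.sqrt_one]
    ring
  have h3 := hasDerivAt_integral g h1 Metric.isOpen_ball h0 hF
  exact h3.congr_of_eventuallyEq (Filter.Eventually.of_forall h2)

/-- The identity holds before integration: two of the trace products cancel, and cyclic invariance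
pairs the four cubic traces into two. -/
theorem gE_ebinChristoffel {g : symTensors E M} (hg : g ∈ metrics E M) (h k l : symTensors E M) :
    gE E g (ebinChristoffel hg h k) l + gE E g k (ebinChristoffel hg h l) = integral E g fun x ↦
      -tr₃ g h k l x - tr₃ g k h l x + 1 / 2 * tr₁ g h x * tr₂ g k l x := by
  rw [gE_comm g k, gE_eq, gE_eq, ← integral_add g (continuous_tr₂ hg _ _) (continuous_tr₂ hg _ _)]
  congr 1; funext x
  rw [tr₂_ebinChristoffel, tr₂_ebinChristoffel, tr₂_comm g l k, tr₃_rotate g h l k,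
    tr₃_rotate g l k h, tr₃_rotate g l h k]
  ring

/-- Apply the quotient rule to g_E/V. The derivative of V is absorbed by the terms that
`calabiChristoffel` adds to the Ebin connection, as for any conformal rescaling. -/
theorem calabiConnection_isLeviCivita : IsLeviCivita E (gN E) (calabiConnection E M) := by
  refine ⟨fun g hg h k ↦ ?_, fun g hg h k l ↦ ?_⟩
  · rw [calabiConnection_apply hg, calabiConnection_apply hg, calabiChristoffel_comm]
  cases isEmpty_or_nonempty M with
  | inl hM =>
    -- The empty manifold is treated apart because its volume is 0, and the quotient rule needs V ≠
    -- 0.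
    have h0 : ∀ g h k : symTensors E M, gN E g h k = 0 := by
      intro g h k
      have h1 : gE E g h k = 0 := by
        rw [gE_eq, show tr₂ g h k = fun _ ↦ 0 from funext fun x ↦ hM.elim x, integral_zero]
      rw [gN, h1, zero_div]
    simp only [h0, add_zero]
    exact hasDerivAt_const _ _
  | inr hM =>
    obtain ⟨ε, hε, hd⟩ := exists_det_pos_line hg h
    have h0 : (0 : ℝ) ∈ Metric.ball (0 : ℝ) ε := Metric.mem_ball_self hε
    have hg0 : g + (0 : ℝ) • h = g := by simp
    have hV : HasDerivAt (fun t : ℝ ↦ vol E (g + t • h)) (1 / 2 * trInt g h) 0 := by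
      have := hasDerivAt_vol (smoothCurveOn_line g h _) Metric.isOpen_ball h0 hd
        (by rwa [hg0]) (hasVelocityAt_line g h 0)
      rwa [hg0] at this
    have hV0 := (vol_pos hg).ne'
    refine ((hasDerivAt_gE_line hg h k l).div hV (by rwa [hg0])).congr_deriv ?_
    rw [← gE_ebinChristoffel hg, hg0, calabiConnection_apply hg, calabiConnection_apply hg]
    simp only [gN, calabiChristoffel, sub_eq_add_neg, ← neg_smul, gE_add_left hg, gE_smul_left,
      gE_add_right hg, gE_smul_right, gE_self_left hg, gE_comm g k g, gE_comm g h k]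
    field_simp
    ring

/-- The difference A of two such connections is symmetric, and g_E(A(h, ·), ·) is skew. A trilinear
form symmetric in one pair of slots and skew in an adjacent one vanishes; pairing A(h, k) with
itself then gives A = 0, so only definiteness is used. -/
theorem IsLeviCivita.eq {Γ Γ' : Christoffel E M} (hΓ : IsLeviCivita E (gN E) Γ)
    (hΓ' : IsLeviCivita E (gN E) Γ') {g : symTensors E M} (hg : g ∈ metrics E M)
    (h k : symTensors E M) : Γ g h k = Γ' g h k := by
  cases isEmpty_or_nonempty M with
  | inl hM => exact gram_ext fun x ↦ hM.elim x
  | inr hM =>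
    have hV0 := (vol_pos hg).ne'
    set A : symTensors E M → symTensors E M → symTensors E M := fun h k ↦ Γ g h k - Γ' g h k
    have hA : ∀ h k, Γ g h k = Γ' g h k + A h k := fun h k ↦ by simp [A]
    have hs : ∀ h k, A h k = A k h := fun h k ↦ by
      simp only [A, hΓ.symm g hg h k, hΓ'.symm g hg h k]
    have hm : ∀ h k l, gE E g (A h k) l = -gE E g (A h l) k := by
      intro h k l
      have := (hΓ.metric g hg h k l).unique (hΓ'.metric g hg h k l)
      simp only [hA, gN, gE_add_left hg, gE_add_right hg] at this
      field_simp at this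
      rw [gE_comm g (A h l)]
      linarith
    -- Three skew exchanges alternating with three symmetric ones return to the initial term with
    -- the opposite sign.
    have h0 : ∀ h k l, gE E g (A h k) l = 0 := by
      intro h k l
      have h1 := hm h k l
      have h2 := hm l h k
      have h3 := hm k l h
      have h4 := congrArg (fun z ↦ gE E g z k) (hs h l)
      have h5 := congrArg (fun z ↦ gE E g z h) (hs l k)
      have h6 := congrArg (fun z ↦ gE E g z l) (hs k h)
      linarith
    have h1 : ∀ x, tr₂ g (A h k) (A h k) x = 0 :=
      eq_zero_of_integral_eq_zero hg (continuous_tr₂ hg _ _)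
        (fun x ↦ (trace_inv_mul_sq_nonneg (mem_metrics_iff.1 hg x) (gram_transpose _ x)).1)
        (h0 h k _)
    have h2 : A h k = 0 := gram_ext fun x ↦
      (trace_inv_mul_sq_nonneg (mem_metrics_iff.1 hg x) (gram_transpose _ x)).2 (h1 x)
    exact sub_eq_zero.1 h2

theorem IsLeviCivita.eq_calabiChristoffel {Γ : Christoffel E M} (hΓ : IsLeviCivita E (gN E) Γ)
    {g : symTensors E M} (hg : g ∈ metrics E M) (h k : symTensors E M) :
    Γ g h k = calabiChristoffel hg h k :=
  (hΓ.eq calabiConnection_isLeviCivita hg h k).trans (calabiConnection_apply hg h k)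

end LeviCivita

/-! ### Conformal directions and the tangent vectors of a fixed-volume conformal class -/

section Conformal

variable {E : Type*} [NormedAddCommGroup E] [NormedSpace ℝ E] [FiniteDimensional ℝ E]
  {M : Type*} [TopologicalSpace M] [ChartedSpace E M] [IsManifold 𝓘(ℝ, E) ∞ M]

variable (E M) in
/-- Smooth real functions on `M`. -/
abbrev Fn : Type _ := C^∞⟮𝓘(ℝ, E), M; 𝓘(ℝ), ℝ⟯

/-- A smooth function as an element of `C^∞(M)`. -/
def mkFn (f : M → ℝ) (hf : ContMDiff 𝓘(ℝ, E) 𝓘(ℝ) ∞ f) : Fn E M := ⟨f, hf⟩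

omit [FiniteDimensional ℝ E] [IsManifold 𝓘(ℝ, E) ∞ M] in
theorem mkFn_apply (f : M → ℝ) (hf : ContMDiff 𝓘(ℝ, E) 𝓘(ℝ) ∞ f) (x : M) : mkFn f hf x = f x :=
  rfl

variable (E) in
/-- The dimension as a real number. -/
def dim : ℝ := Module.finrank ℝ E

omit [FiniteDimensional ℝ E] [IsManifold 𝓘(ℝ, E) ∞ M] in
theorem contMDiff_rpow {ρ : M → ℝ} (hρ : ContMDiff 𝓘(ℝ, E) 𝓘(ℝ) ∞ ρ) (h0 : ∀ x, 0 < ρ x) (q : ℝ) :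
    ContMDiff 𝓘(ℝ, E) 𝓘(ℝ) ∞ (fun x ↦ ρ x ^ q) := fun x ↦
  ContMDiffAt.comp x (Real.contDiffAt_rpow_const_of_ne (h0 x).ne').contMDiffAt (hρ x)

omit [FiniteDimensional ℝ E] [IsManifold 𝓘(ℝ, E) ∞ M] in
theorem SmoothOver.rpow {F : ℝ × M → ℝ} {J : Set ℝ} (hF : SmoothOver E F J)
    (h0 : ∀ t ∈ J, ∀ x, 0 < F (t, x)) (q : ℝ) : SmoothOver E (fun p ↦ F p ^ q) J :=
  hF.comp (u := fun y ↦ y ^ q) fun p hp ↦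
    Real.contDiffAt_rpow_const_of_ne (h0 p.1 hp.1 p.2).ne'

omit [FiniteDimensional ℝ E] [IsManifold 𝓘(ℝ, E) ∞ M] in
theorem continuous_mul_rpow (θ ρ : Fn E M) (h0 : ∀ x, 0 < ρ x) (q : ℝ) :
    Continuous (fun x ↦ θ x * ρ x ^ q) :=
  θ.contMDiff.continuous.mul (contMDiff_rpow ρ.contMDiff h0 q).continuous

theorem fmul_mem_metrics {g : symTensors E M} (hg : g ∈ metrics E M) {ρ : Fn E M}
    (h0 : ∀ x, 0 < ρ x) : fmul ρ g ∈ metrics E M := by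
  intro x v hv
  rw [val_fmul]
  exact mul_pos (h0 x) (hg x v hv)

theorem tr₁_fmul_fmul {g : symTensors E M} (hg : g ∈ metrics E M) {ρ : Fn E M}
    (h0 : ∀ x, 0 < ρ x) (h : symTensors E M) (σ : Fn E M) (x : M) :
    tr₁ (fmul ρ g) (fmul σ h) x = σ x / ρ x * tr₁ g h x := by
  have hu : IsUnit (gram E g x).det := (det_gram_pos hg x).ne'.isUnit
  have : Invertible (ρ x) := invertibleOfNonzero (h0 x).ne'
  rw [tr₁, tr₁, gram_fmul, gram_fmul, Matrix.inv_smul _ _ hu, Matrix.smul_mul, Matrix.mul_smul,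
    Matrix.trace_smul, Matrix.trace_smul, invOf_eq_inv, smul_eq_mul, smul_eq_mul]
  ring

theorem tr₁_self {g : symTensors E M} (hg : g ∈ metrics E M) (x : M) : tr₁ g g x = dim E := by
  rw [tr₁, inv_mul_gram hg, Matrix.trace_one, Fintype.card_fin, dim]

theorem tr₁_fmul_self {g : symTensors E M} (hg : g ∈ metrics E M) {ρ : Fn E M}
    (h0 : ∀ x, 0 < ρ x) (σ : Fn E M) (x : M) :
    tr₁ (fmul ρ g) (fmul σ g) x = dim E * (σ x / ρ x) := by
  rw [tr₁_fmul_fmul hg h0, tr₁_self hg, mul_comm]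

theorem tr₂_fmul_self {g : symTensors E M} (hg : g ∈ metrics E M) {ρ : Fn E M}
    (h0 : ∀ x, 0 < ρ x) (σ τ : Fn E M) (x : M) :
    tr₂ (fmul ρ g) (fmul σ g) (fmul τ g) x = dim E * (σ x * τ x / ρ x ^ 2) := by
  have hu : IsUnit (gram E g x).det := (det_gram_pos hg x).ne'.isUnit
  have : Invertible (ρ x) := invertibleOfNonzero (h0 x).ne'
  rw [tr₂, gram_fmul, gram_fmul, gram_fmul, Matrix.inv_smul _ _ hu]
  simp only [Matrix.smul_mul, Matrix.mul_smul, Matrix.trace_smul, invOf_eq_inv, smul_eq_mul,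
    inv_mul_gram hg, Matrix.one_mul, Matrix.trace_one, Fintype.card_fin, dim]
  ring

theorem sqrt_detRatio_fmul {g : symTensors E M} (hg : g ∈ metrics E M) {ρ : Fn E M}
    (h0 : ∀ x, 0 < ρ x) (x : M) :
    Real.sqrt (detRatio g (fmul ρ g) x) = ρ x ^ (dim E / 2) := by
  rw [detRatio, gram_fmul, Matrix.det_smul, Fintype.card_fin,
    mul_div_cancel_right₀ _ (det_gram_pos hg x).ne', Real.sqrt_eq_rpow, ← Real.rpow_natCast,
    ← Real.rpow_mul (h0 x).le, dim]
  ring_nf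

variable [T2Space M] [CompactSpace M]

theorem integral_fmul {g : symTensors E M} (hg : g ∈ metrics E M) {ρ : Fn E M}
    (h0 : ∀ x, 0 < ρ x) (f : M → ℝ) :
    integral E (fmul ρ g) f = integral E g (fun x ↦ f x * ρ x ^ (dim E / 2)) := by
  rw [integral_eq_of_detRatio hg]
  simp only [sqrt_detRatio_fmul hg h0]

theorem vol_fmul {g : symTensors E M} (hg : g ∈ metrics E M) {ρ : Fn E M}
    (h0 : ∀ x, 0 < ρ x) :
    vol E (fmul ρ g) = integral E g (fun x ↦ ρ x ^ (dim E / 2)) := by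
  rw [vol, integral_fmul hg h0]
  simp only [one_mul]

theorem trInt_fmul {g : symTensors E M} (hg : g ∈ metrics E M) {ρ : Fn E M}
    (h0 : ∀ x, 0 < ρ x) (σ : Fn E M) :
    trInt (fmul ρ g) (fmul σ g) = dim E * integral E g (fun x ↦ σ x * ρ x ^ (dim E / 2 - 1)) := by
  rw [trInt, integral_fmul hg h0, ← integral_const_mul]
  congr 1; funext x
  rw [tr₁_fmul_self hg h0, Real.rpow_sub_one (h0 x).ne']
  ring

theorem gE_fmul {g : symTensors E M} (hg : g ∈ metrics E M) {ρ : Fn E M}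
    (h0 : ∀ x, 0 < ρ x) (σ τ : Fn E M) :
    gE E (fmul ρ g) (fmul σ g) (fmul τ g) =
      dim E * integral E g (fun x ↦ σ x * τ x * ρ x ^ (dim E / 2 - 2)) := by
  rw [gE_eq, integral_fmul hg h0, ← integral_const_mul]
  congr 1; funext x
  rw [tr₂_fmul_self hg h0, Real.rpow_sub (h0 x), Real.rpow_two]
  ring

/-- The conformal factor of the covariant derivative of conformal directions. -/
def confChristoffel (g : symTensors E M) (ρ σ τ : M → ℝ) (x : M) : ℝ :=
  (dim E / 4 - 1) * (σ x * τ x / ρ x) +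
    dim E / (4 * integral E g (fun x ↦ ρ x ^ (dim E / 2))) *
    (integral E g (fun x ↦ σ x * τ x * ρ x ^ (dim E / 2 - 2)) * ρ x -
      integral E g (fun x ↦ σ x * ρ x ^ (dim E / 2 - 1)) * τ x -
      integral E g (fun x ↦ τ x * ρ x ^ (dim E / 2 - 1)) * σ x)

/-- Every term of the connection preserves multiples of g. The symmetrized product contributes -στ/ρ
and the three pointwise trace terms add up to (n/4) στ/ρ. -/
theorem gram_calabiChristoffel_fmul {g : symTensors E M} (hg : g ∈ metrics E M) {ρ : Fn E M}
    (h0 : ∀ x, 0 < ρ x) (σ τ : Fn E M) (x : M) :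
    gram E (calabiChristoffel (fmul_mem_metrics hg h0) (fmul σ g) (fmul τ g)) x =
      confChristoffel g ρ σ τ x • gram E g x := by
  have hu : IsUnit (gram E g x).det := (det_gram_pos hg x).ne'.isUnit
  have : Invertible (ρ x) := invertibleOfNonzero (h0 x).ne'
  have hρ := (h0 x).ne'
  rw [calabiChristoffel, gram_add, gram_ebinChristoffel, gram_smul, gram_sub, gram_sub, gram_smul,
    gram_smul, gram_smul, gE_fmul hg h0, trInt_fmul hg h0, trInt_fmul hg h0, vol_fmul hg h0,
    tr₁_fmul_self hg h0, tr₁_fmul_self hg h0, tr₂_fmul_self hg h0]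
  simp only [gram_fmul, Matrix.inv_smul _ _ hu, Matrix.smul_mul, Matrix.mul_smul, invOf_eq_inv,
    Matrix.mul_assoc, inv_mul_gram hg, Matrix.mul_one, smul_smul, ← add_smul, ← sub_smul,
    ← neg_smul]
  congr 1
  rw [confChristoffel]
  field_simp
  ring

omit [FiniteDimensional ℝ E] [IsManifold 𝓘(ℝ, E) ∞ M] [T2Space M] [CompactSpace M] in
theorem contMDiff_div {ρ : Fn E M} (h0 : ∀ x, 0 < ρ x) {σ : M → ℝ}
    (hσ : ContMDiff 𝓘(ℝ, E) 𝓘(ℝ) ∞ σ) :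
    ContMDiff 𝓘(ℝ, E) 𝓘(ℝ) ∞ (fun x ↦ σ x / ρ x) :=
  fun x ↦ (hσ x).div₀ (ρ.contMDiff x) (h0 x).ne'

theorem contMDiff_confChristoffel (g : symTensors E M) {ρ : Fn E M} (h0 : ∀ x, 0 < ρ x)
    (σ τ : Fn E M) : ContMDiff 𝓘(ℝ, E) 𝓘(ℝ) ∞ (confChristoffel g ρ σ τ) :=
  (contMDiff_const.mul (contMDiff_div h0 (σ.contMDiff.mul τ.contMDiff))).add
    (contMDiff_const.mul (((contMDiff_const.mul ρ.contMDiff).sub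
      (contMDiff_const.mul τ.contMDiff)).sub (contMDiff_const.mul σ.contMDiff)))

theorem IsLeviCivita.apply_fmul {Γ : Christoffel E M} (hΓ : IsLeviCivita E (gN E) Γ)
    {g : symTensors E M} (hg : g ∈ metrics E M) {ρ : Fn E M} (h0 : ∀ x, 0 < ρ x) (σ τ : Fn E M) :
    Γ (fmul ρ g) (fmul σ g) (fmul τ g) =
      fmul (mkFn (confChristoffel g ρ σ τ) (contMDiff_confChristoffel g h0 σ τ)) g := by
  rw [hΓ.eq_calabiChristoffel (fmul_mem_metrics hg h0)]
  refine gram_ext fun x ↦ ?_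
  rw [gram_calabiChristoffel_fmul hg h0, gram_fmul, mkFn_apply]

omit [T2Space M] [CompactSpace M] in
/-- The conformal factor of a tensor field with respect to a metric (its trace part). -/
def confFactor {g : symTensors E M} (hg : g ∈ metrics E M) (h : symTensors E M) : Fn E M :=
  mkFn (fun x ↦ (dim E)⁻¹ * tr₁ g h x) (contMDiff_const.mul (contMDiff_tr₁ hg h))

omit [T2Space M] [CompactSpace M] in
theorem confFactor_apply {g : symTensors E M} (hg : g ∈ metrics E M) (h : symTensors E M) (x : M) :
    confFactor hg h x = (dim E)⁻¹ * tr₁ g h x := rfl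

omit [T2Space M] [CompactSpace M] in
theorem confFactor_fmul {g : symTensors E M} (hg : g ∈ metrics E M) (hn : dim E ≠ 0)
    (σ : Fn E M) : confFactor hg (fmul σ g) = σ := by
  ext x
  have h1 : tr₁ g (fmul σ g) x = σ x * dim E := by
    rw [tr₁, gram_fmul, Matrix.mul_smul, Matrix.trace_smul, ← tr₁, tr₁_self hg, smul_eq_mul]
  rw [confFactor_apply, h1]
  field_simp

omit [T2Space M] [CompactSpace M] in
theorem SmoothCurveOn.confFactor {g : symTensors E M} (hg : g ∈ metrics E M)
    {c : ℝ → symTensors E M} {J : Set ℝ} (hc : SmoothCurveOn E c J) :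
    SmoothFunCurveOn E (fun t ↦ confFactor hg (c t)) J := by
  have h1 : SmoothOver E (fun p : ℝ × M ↦ RiemMetrics.tr₁ g (c p.1) p.2) J :=
    SmoothCurveOn.tr₁ (c := fun _ ↦ g) (h := c) (smoothCurveOn_const g J) hc
      fun _ _ x ↦ (det_gram_pos hg x).ne'
  have h2 : SmoothOver E (fun _ : ℝ × M ↦ (dim E)⁻¹) J := contMDiffOn_const
  exact h2.mul h1

omit [FiniteDimensional ℝ E] [T2Space M] [CompactSpace M] in
theorem SmoothCurveOn.congr {c k : ℝ → symTensors E M} {J : Set ℝ} (hc : SmoothCurveOn E c J)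
    (h : ∀ t ∈ J, k t = c t) : SmoothCurveOn E k J := by
  have h1 : ∀ p ∈ J ×ˢ (univ : Set M), (k p.1).1.toSection p.2 = (c p.1).1.toSection p.2 :=
    fun p hp ↦ by rw [h p.1 hp.1]
  exact ContMDiffOn.congr hc h1

omit [T2Space M] [CompactSpace M] in
-- The conformal factor is recovered by the pointwise linear map n⁻¹ tr(g⁻¹ ·), which commutes with
-- differentiation in time. The same map applied to `h` shows that the derivative of the factor is
-- smooth on M.
theorem hasVelocityAt_fmul_iff {g : symTensors E M} (hg : g ∈ metrics E M) (hn : dim E ≠ 0)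
    {u : ℝ → Fn E M} {h : symTensors E M} {t : ℝ} :
    HasVelocityAt E (fun s ↦ fmul (u s) g) h t ↔
      ∃ σ : Fn E M, h = fmul σ g ∧ ∀ x, HasDerivAt (fun s ↦ u s x) (σ x) t := by
  constructor
  · intro hv
    have h1 : ∀ x, HasDerivAt (fun s ↦ u s x) (confFactor hg h x) t := by
      intro x
      have h2 := (hasDerivAt_matrix_trace (hasDerivAt_matrix_mul (A := fun _ ↦ (gram E g x)⁻¹)
        (B := fun s ↦ gram E (fmul (u s) g) x) (A' := 0) (fun i j ↦ hasDerivAt_const _ _)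
        (fun i j ↦ hasVelocityAt_iff.1 hv x i j))).const_mul (dim E)⁻¹
      have h3 : (fun s ↦ (dim E)⁻¹ * ((gram E g x)⁻¹ * gram E (fmul (u s) g) x).trace) =
          fun s ↦ u s x := by
        funext s
        exact congrArg (fun f : Fn E M ↦ f x) (confFactor_fmul hg hn (u s))
      rw [h3] at h2
      rw [Matrix.zero_mul, zero_add] at h2
      exact h2
    refine ⟨confFactor hg h, gram_ext fun x ↦ ?_, h1⟩
    ext i j
    have h4 := hasVelocityAt_iff.1 hv x i j
    simp only [gram_fmul, Matrix.smul_apply, smul_eq_mul] at h4 ⊢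
    exact h4.unique ((h1 x).mul_const _)
  · rintro ⟨σ, rfl, hσ⟩
    refine hasVelocityAt_iff.2 fun x i j ↦ ?_
    simp only [gram_fmul, Matrix.smul_apply, smul_eq_mul]
    exact (hσ x).mul_const _

omit [FiniteDimensional ℝ E] [T2Space M] [CompactSpace M] in
theorem hasVelocityAt_congr {c k : ℝ → symTensors E M} {h : symTensors E M} {t : ℝ}
    (he : ∀ᶠ s in nhds t, k s = c s) (hc : HasVelocityAt E c h t) : HasVelocityAt E k h t :=
  fun x v w ↦ (hc x v w).congr_of_eventuallyEq (he.mono fun s hs ↦ by simp only [hs])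

omit [T2Space M] [CompactSpace M] in
theorem mem_conformalClass_iff {g h : symTensors E M} :
    h ∈ conformalClass E g ↔ ∃ ρ : Fn E M, (∀ x, 0 < ρ x) ∧ h = fmul ρ g := by
  refine exists_congr fun ρ ↦ and_congr_right fun _ ↦ ⟨fun H ↦ gram_ext fun x ↦ ?_, ?_⟩
  · rw [gram_fmul]; ext i j; exact H x _ _
  · rintro rfl x v w; exact val_fmul ρ g x v w

/-- The metrics of volume `v` in a conformal class. -/
abbrev confVol (g : symTensors E M) (v : ℝ) : Set (symTensors E M) :=
  conformalClass E g ∩ metricsOfVol E M v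

theorem mem_confVol_iff {g h : symTensors E M} (hg : g ∈ metrics E M) {v : ℝ} :
    h ∈ confVol g v ↔ ∃ ρ : Fn E M, (∀ x, 0 < ρ x) ∧ h = fmul ρ g ∧
      integral E g (fun x ↦ ρ x ^ (dim E / 2)) = v := by
  constructor
  · rintro ⟨h1, -, h2⟩
    obtain ⟨ρ, h0, rfl⟩ := mem_conformalClass_iff.1 h1
    exact ⟨ρ, h0, rfl, by rw [← h2, vol_fmul hg h0]⟩
  · rintro ⟨ρ, h0, rfl, h2⟩
    exact ⟨mem_conformalClass_iff.2 ⟨ρ, h0, rfl⟩, fmul_mem_metrics hg h0,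
      by rw [vol_fmul hg h0, h2]⟩

/-- Derivative of weighted integrals along a curve of conformal factors. -/
theorem hasDerivAt_integral_mul_rpow (g : symTensors E M) {W U : ℝ × M → ℝ} {J : Set ℝ}
    (hW : SmoothOver E W J) (hU : SmoothOver E U J) (hJ : IsOpen J)
    (h0 : ∀ t ∈ J, ∀ x, 0 < U (t, x)) {t : ℝ} (ht : t ∈ J) {W' U' : M → ℝ}
    (hW' : ∀ x, HasDerivAt (fun s ↦ W (s, x)) (W' x) t)
    (hU' : ∀ x, HasDerivAt (fun s ↦ U (s, x)) (U' x) t) (q : ℝ) :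
    HasDerivAt (fun s ↦ integral E g (fun x ↦ W (s, x) * U (s, x) ^ q))
      (integral E g (fun x ↦ W' x * U (t, x) ^ q + q * (W (t, x) * U' x * U (t, x) ^ (q - 1)))) t := by
  refine hasDerivAt_integral g (hW.mul (hU.rpow h0 q)) hJ ht fun x ↦ ?_
  refine ((hW' x).mul ((hU' x).rpow_const (Or.inl (h0 t ht x).ne'))).congr_deriv ?_
  ring

theorem hasDerivAt_integral_rpow (g : symTensors E M) {U : ℝ × M → ℝ} {J : Set ℝ}
    (hU : SmoothOver E U J) (hJ : IsOpen J)
    (h0 : ∀ t ∈ J, ∀ x, 0 < U (t, x)) {t : ℝ} (ht : t ∈ J) {U' : M → ℝ}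
    (hU' : ∀ x, HasDerivAt (fun s ↦ U (s, x)) (U' x) t) (q : ℝ) :
    HasDerivAt (fun s ↦ integral E g (fun x ↦ U (s, x) ^ q))
      (q * integral E g (fun x ↦ U' x * U (t, x) ^ (q - 1))) t := by
  rw [← integral_const_mul]
  refine hasDerivAt_integral g (hU.rpow h0 q) hJ ht fun x ↦ ?_
  refine ((hU' x).rpow_const (Or.inl (h0 t ht x).ne')).congr_deriv ?_
  ring

/-- A curve in the conformal class is given by a smooth curve of conformal factors. -/
theorem SmoothCurveOn.exists_confFactor {g : symTensors E M} (hg : g ∈ metrics E M)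
    (hn : dim E ≠ 0) {v : ℝ} {c : ℝ → symTensors E M} {J : Set ℝ} (hc : SmoothCurveOn E c J)
    (hN : ∀ t ∈ J, c t ∈ confVol g v) :
    ∃ u : ℝ → Fn E M, SmoothFunCurveOn E u J ∧ ∀ t ∈ J, (∀ x, 0 < u t x) ∧
      c t = RiemMetrics.fmul (u t) g ∧
      integral E g (fun x ↦ u t x ^ (dim E / 2)) = v := by
  refine ⟨fun t ↦ RiemMetrics.confFactor hg (c t), hc.confFactor hg, fun t ht ↦ ?_⟩
  obtain ⟨ρ, h0, h1, h2⟩ := (mem_confVol_iff hg).1 (hN t ht)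
  have h3 : RiemMetrics.confFactor hg (c t) = ρ := by rw [h1, confFactor_fmul hg hn]
  simp only [h3]
  exact ⟨h0, h1, h2⟩

/-- The integral condition is the derivative of the constant volume ∫ ρ^{n/2} dV_g. The converse is
`isTangentTo_fmul`. -/
theorem IsTangentTo.exists_fmul {g : symTensors E M} (hg : g ∈ metrics E M)
    (hn : dim E ≠ 0) {v : ℝ} {ρ : Fn E M} {h : symTensors E M}
    (ht : IsTangentTo E (confVol g v) (fmul ρ g) h) :
    ∃ σ : Fn E M, h = fmul σ g ∧ integral E g (fun x ↦ σ x * ρ x ^ (dim E / 2 - 1)) = 0 := by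
  obtain ⟨c, J, hJ, h0J, hc, hN, hc0, hv⟩ := ht
  obtain ⟨u, hu, H⟩ := hc.exists_confFactor hg hn hN
  have hv' : HasVelocityAt E (fun s ↦ fmul (u s) g) h 0 :=
    hasVelocityAt_congr (by filter_upwards [hJ.mem_nhds h0J] with s hs; exact (H s hs).2.1.symm) hv
  obtain ⟨σ, hσ, hd⟩ := (hasVelocityAt_fmul_iff hg hn).1 hv'
  have hu0 : u 0 = ρ := by
    rw [← confFactor_fmul hg hn (u 0), ← (H 0 h0J).2.1, hc0, confFactor_fmul hg hn]
  refine ⟨σ, hσ, ?_⟩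
  have h1 := hasDerivAt_integral_rpow g (U := fun p ↦ u p.1 p.2) hu hJ
    (fun t ht x ↦ (H t ht).1 x) h0J hd (dim E / 2)
  have h2 := h1.congr_of_eventuallyEq (f₁ := fun _ ↦ v) (by
    filter_upwards [hJ.mem_nhds h0J] with s hs; exact (H s hs).2.2.symm)
  have h3 := h2.unique (hasDerivAt_const _ _)
  simpa [hn, hu0] using h3

end Conformal

/-! ### Great circles and the geodesics they give -/

section GreatCircles

variable {E : Type*} [NormedAddCommGroup E] [NormedSpace ℝ E]
  {M : Type*} [TopologicalSpace M] [ChartedSpace E M]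

/-- The curve of smooth functions given by a function which is smooth over `J`. -/
def sliceFn {F : ℝ × M → ℝ} {J : Set ℝ} (hF : SmoothOver E F J) (t : ℝ) : Fn E M :=
  @dite _ (t ∈ J) (Classical.propDecidable _) (fun h ↦ hF.fn h) fun _ ↦ 0

theorem sliceFn_apply {F : ℝ × M → ℝ} {J : Set ℝ} (hF : SmoothOver E F J) {t : ℝ} (ht : t ∈ J)
    (x : M) : sliceFn hF t x = F (t, x) := by
  rw [sliceFn, dif_pos ht]; rfl

theorem smoothFunCurveOn_sliceFn {F : ℝ × M → ℝ} {J : Set ℝ} (hF : SmoothOver E F J) :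
    SmoothFunCurveOn E (sliceFn hF) J :=
  ContMDiffOn.congr hF fun p hp ↦ sliceFn_apply hF hp.1 p.2

theorem hasDerivAt_sliceFn {F : ℝ × M → ℝ} {J : Set ℝ} (hF : SmoothOver E F J) (hJ : IsOpen J)
    {t : ℝ} (ht : t ∈ J) {x : M} {y : ℝ} (h : HasDerivAt (fun s ↦ F (s, x)) y t) :
    HasDerivAt (fun s ↦ sliceFn hF s x) y t :=
  h.congr_of_eventuallyEq (by
    filter_upwards [hJ.mem_nhds ht] with s hs; exact sliceFn_apply hF hs x)

theorem smoothOver_fun (f : Fn E M) (J : Set ℝ) : SmoothOver E (fun p : ℝ × M ↦ f p.2) J :=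
  (f.contMDiff.comp (contMDiff_snd (I := 𝓘(ℝ, ℝ)))).contMDiffOn

theorem smoothOver_time {f : ℝ → ℝ} (hf : ContDiff ℝ ∞ f) (J : Set ℝ) :
    SmoothOver E (fun p : ℝ × M ↦ f p.1) J :=
  (hf.contMDiff.comp (contMDiff_fst (J := 𝓘(ℝ, E)))).contMDiffOn

theorem SmoothOver.add {F G : ℝ × M → ℝ} {J : Set ℝ} (hF : SmoothOver E F J)
    (hG : SmoothOver E G J) : SmoothOver E (fun p ↦ F p + G p) J :=
  ContMDiffOn.add hF hG

theorem SmoothOver.mono {F : ℝ × M → ℝ} {J J' : Set ℝ} (hF : SmoothOver E F J) (h : J' ⊆ J) :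
    SmoothOver E F J' :=
  ContMDiffOn.mono hF (prod_mono h subset_rfl)

variable [FiniteDimensional ℝ E] [IsManifold 𝓘(ℝ, E) ∞ M] [T2Space M] [CompactSpace M]

theorem integral_quadratic (g : symTensors E M) (f k : Fn E M) (A B C : ℝ) :
    integral E g (fun x ↦ A * f x ^ 2 + B * (f x * k x) + C * k x ^ 2) =
      A * integral E g (fun x ↦ f x ^ 2) + B * integral E g (fun x ↦ f x * k x) +
        C * integral E g (fun x ↦ k x ^ 2) := by
  have hf := f.contMDiff.continuous
  have hk := k.contMDiff.continuous
  have h1 : Continuous fun x ↦ A * f x ^ 2 := continuous_const.mul (hf.pow 2)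
  have h2 : Continuous fun x ↦ B * (f x * k x) := continuous_const.mul (hf.mul hk)
  have h3 : Continuous fun x ↦ C * k x ^ 2 := continuous_const.mul (hk.pow 2)
  have h12 : Continuous fun x ↦ A * f x ^ 2 + B * (f x * k x) := h1.add h2
  rw [integral_add g h12 h3, integral_add g h1 h2, integral_const_mul, integral_const_mul,
    integral_const_mul]

/-- The curve is F = cos(at) f + sin(at) η, where p = aη and a² = ‖p‖²/v, so that η is orthogonal to
f with the same norm when a ≠ 0. It stays positive only for a short time, by compactness of M. -/
theorem exists_great_circle {g : symTensors E M} (hg : g ∈ metrics E M) {v : ℝ} (hv : 0 < v)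
    (f p : Fn E M) (hf0 : ∀ x, 0 < f x) (hf : integral E g (fun x ↦ f x ^ 2) = v)
    (hp : integral E g (fun x ↦ f x * p x) = 0) :
    ∃ (a ε : ℝ) (F F' : ℝ × M → ℝ), 0 < ε ∧ SmoothOver E F univ ∧ SmoothOver E F' univ ∧
      (∀ t ∈ Metric.ball (0 : ℝ) ε, ∀ x, 0 < F (t, x)) ∧
      (∀ t x, HasDerivAt (fun s ↦ F (s, x)) (F' (t, x)) t) ∧
      (∀ t x, HasDerivAt (fun s ↦ F' (s, x)) (-a ^ 2 * F (t, x)) t) ∧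
      (∀ x, F (0, x) = f x) ∧ (∀ x, F' (0, x) = p x) ∧
      (∀ t, integral E g (fun x ↦ F (t, x) ^ 2) = v) ∧
      (∀ t, integral E g (fun x ↦ F (t, x) * F' (t, x)) = 0) ∧
      (∀ t, integral E g (fun x ↦ F' (t, x) ^ 2) = a ^ 2 * v) := by
  set S := integral E g (fun x ↦ p x ^ 2)
  have hS : 0 ≤ S := integral_nonneg g fun x ↦ sq_nonneg _
  obtain ⟨a, ha⟩ : ∃ a : ℝ, a ^ 2 = S / v := ⟨Real.sqrt (S / v), Real.sq_sqrt (by positivity)⟩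
  have hpc : Continuous p := p.contMDiff.continuous
  -- If a = 0, then p has norm zero and vanishes, and η = 0 is taken; it does not have norm √v.
  obtain ⟨η, hη⟩ : ∃ η : Fn E M, ∀ x, p x = a * η x := by
    by_cases h : a = 0
    · refine ⟨0, fun x ↦ ?_⟩
      have hS0 : S = 0 := by
        rw [h] at ha
        field_simp at ha
        linarith
      have := eq_zero_of_integral_eq_zero hg (hpc.pow 2) (fun x ↦ sq_nonneg _) hS0 x
      rw [h, zero_mul]
      exact pow_eq_zero_iff (two_ne_zero) |>.1 this
    · refine ⟨mkFn (fun x ↦ a⁻¹ * p x) (contMDiff_const.mul p.contMDiff), fun x ↦ ?_⟩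
      rw [mkFn_apply]
      field_simp
  have hη2 : a ^ 2 * integral E g (fun x ↦ η x ^ 2) = a ^ 2 * v := by
    rw [← integral_const_mul, ha, div_mul_cancel₀ _ hv.ne', ← ha]
    congr 1; funext x; rw [hη x]; ring
  have hη1 : a * integral E g (fun x ↦ f x * η x) = 0 := by
    rw [← integral_const_mul, ← hp]
    congr 1; funext x; rw [hη x]; ring
  have hη2' : a * integral E g (fun x ↦ η x ^ 2) = a * v := by
    rcases eq_or_ne a 0 with h | h
    · simp [h]
    · exact mul_left_cancel₀ h (by linarith [hη2])
  -- To include a = 0 with η = 0, the relations for η are kept only after multiplication by sin(at),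
  -- which vanishes in that case.
  have hsin : ∀ t, Real.sin (a * t) * integral E g (fun x ↦ η x ^ 2) = Real.sin (a * t) * v ∧
      Real.sin (a * t) * integral E g (fun x ↦ f x * η x) = 0 := by
    intro t
    rcases eq_or_ne a 0 with h | h
    · simp [h]
    · exact ⟨by rw [mul_left_cancel₀ h hη2'], by
        rw [(mul_eq_zero.1 hη1).resolve_left h, mul_zero]⟩
  have hcos : ContDiff ℝ ∞ fun t ↦ Real.cos (a * t) :=
    Real.contDiff_cos.comp (contDiff_const.mul contDiff_id)
  have hsin' : ContDiff ℝ ∞ fun t ↦ Real.sin (a * t) :=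
    Real.contDiff_sin.comp (contDiff_const.mul contDiff_id)
  have dcos : ∀ t, HasDerivAt (fun t ↦ Real.cos (a * t)) (-Real.sin (a * t) * a) t := fun t ↦ by
    exact ((hasDerivAt_id t).const_mul a).cos.congr_deriv (by simp)
  have dsin : ∀ t, HasDerivAt (fun t ↦ Real.sin (a * t)) (Real.cos (a * t) * a) t := fun t ↦ by
    exact ((hasDerivAt_id t).const_mul a).sin.congr_deriv (by simp)
  set F : ℝ × M → ℝ := fun q ↦ Real.cos (a * q.1) * f q.2 + Real.sin (a * q.1) * η q.2 with hF
  set F' : ℝ × M → ℝ := fun q ↦ (-a * Real.sin (a * q.1)) * f q.2 +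
    (a * Real.cos (a * q.1)) * η q.2 with hF'
  have hFs : SmoothOver E F univ :=
    ((smoothOver_time hcos univ).mul (smoothOver_fun f univ)).add
      ((smoothOver_time hsin' univ).mul (smoothOver_fun η univ))
  have hFs' : SmoothOver E F' univ :=
    ((smoothOver_time (contDiff_const.mul hsin') univ).mul (smoothOver_fun f univ)).add
      ((smoothOver_time (contDiff_const.mul hcos) univ).mul (smoothOver_fun η univ))
  have hopen : IsOpen {q : ℝ × M | 0 < F q} := by
    refine isOpen_lt continuous_const ?_
    rw [← continuousOn_univ, ← univ_prod_univ]
    exact hFs.continuousOn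
  have hF0 : ∀ x, F (0, x) = f x := fun x ↦ by simp [hF]
  obtain ⟨ε, hε, hpos⟩ := exists_ball_prod_subset hopen (t₀ := 0) fun x ↦ by
    change 0 < F (0, x)
    rw [hF0]; exact hf0 x
  refine ⟨a, ε, F, F', hε, hFs, hFs', hpos, fun t x ↦ ?_, fun t x ↦ ?_, hF0, fun x ↦ ?_,
    fun t ↦ ?_, fun t ↦ ?_, fun t ↦ ?_⟩
  · refine (((dcos t).mul_const (f x)).add ((dsin t).mul_const (η x))).congr_deriv ?_
    simp only [hF']; ring
  · refine ((((dsin t).const_mul (-a)).mul_const (f x)).add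
      (((dcos t).const_mul a).mul_const (η x))).congr_deriv ?_
    simp only [hF]; ring
  · simp [hF', hη x]
  · have h1 : (fun x ↦ F (t, x) ^ 2) = fun x ↦ Real.cos (a * t) ^ 2 * f x ^ 2 +
        (2 * Real.cos (a * t) * Real.sin (a * t)) * (f x * η x) +
        Real.sin (a * t) ^ 2 * η x ^ 2 := by
      funext x; simp only [hF]; ring
    rw [h1, integral_quadratic, hf]
    linear_combination Real.sin (a * t) * (hsin t).1 + 2 * Real.cos (a * t) * (hsin t).2 +
      v * Real.sin_sq_add_cos_sq (a * t)
  · have h1 : (fun x ↦ F (t, x) * F' (t, x)) = fun x ↦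
        (-a * (Real.cos (a * t) * Real.sin (a * t))) * f x ^ 2 +
        (a * (Real.cos (a * t) ^ 2 - Real.sin (a * t) ^ 2)) * (f x * η x) +
        (a * (Real.cos (a * t) * Real.sin (a * t))) * η x ^ 2 := by
      funext x; simp only [hF, hF']; ring
    rw [h1, integral_quadratic, hf]
    linear_combination (Real.cos (a * t) ^ 2 - Real.sin (a * t) ^ 2) * hη1 +
      (a * Real.cos (a * t)) * (hsin t).1
  · have h1 : (fun x ↦ F' (t, x) ^ 2) = fun x ↦ (a ^ 2 * Real.sin (a * t) ^ 2) * f x ^ 2 +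
        (-2 * a ^ 2 * (Real.cos (a * t) * Real.sin (a * t))) * (f x * η x) +
        (a ^ 2 * Real.cos (a * t) ^ 2) * η x ^ 2 := by
      funext x; simp only [hF']; ring
    rw [h1, integral_quadratic, hf]
    linear_combination (-2 * a * Real.cos (a * t) * Real.sin (a * t)) * hη1 +
      Real.cos (a * t) ^ 2 * hη2 + a ^ 2 * v * Real.sin_sq_add_cos_sq (a * t)

/-- Great circles through a point of the space of conformal factors of fixed volume. -/
theorem exists_conformal_geodesic {g : symTensors E M} (hg : g ∈ metrics E M) (hn : 0 < dim E)
    {v : ℝ} (hv : 0 < v) {ρ σ : Fn E M} (h0 : ∀ x, 0 < ρ x)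
    (hρ : integral E g (fun x ↦ ρ x ^ (dim E / 2)) = v)
    (hσ : integral E g (fun x ↦ σ x * ρ x ^ (dim E / 2 - 1)) = 0) :
    ∃ (ε : ℝ) (u u' : ℝ → Fn E M), 0 < ε ∧ SmoothFunCurveOn E u (Metric.ball 0 ε) ∧
      (∀ t ∈ Metric.ball (0 : ℝ) ε, (∀ x, 0 < u t x) ∧
        integral E g (fun x ↦ u t x ^ (dim E / 2)) = v ∧
        (∀ x, HasDerivAt (fun s ↦ u s x) (u' t x) t) ∧
        (∀ x, HasDerivAt (fun s ↦ u' s x) (-confChristoffel g (u t) (u' t) (u' t) x) t)) ∧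
      u 0 = ρ ∧ u' 0 = σ := by
  set n := dim E with hndef
  have hn0 := hn.ne'
  -- The substitution f = ρ^{n/4}; p is its derivative in the direction σ, and the tangency
  -- condition becomes orthogonality of f and p.
  let f : Fn E M := mkFn (fun x ↦ ρ x ^ (n / 4)) (contMDiff_rpow ρ.contMDiff h0 _)
  let p : Fn E M := mkFn (fun x ↦ n / 4 * (σ x * ρ x ^ (n / 4 - 1)))
    (contMDiff_const.mul (σ.contMDiff.mul (contMDiff_rpow ρ.contMDiff h0 _)))
  have hfx : ∀ x, f x = ρ x ^ (n / 4) := fun _ ↦ rfl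
  have hpx : ∀ x, p x = n / 4 * (σ x * ρ x ^ (n / 4 - 1)) := fun _ ↦ rfl
  obtain ⟨a, ε, F, F', hε, hF, hF', hpos, hd, hd', hF0, hF0', i1, i2, i3⟩ :=
    exists_great_circle hg hv f p (fun x ↦ Real.rpow_pos_of_pos (h0 x) _)
      (by
        rw [← hρ]; congr 1; funext x
        rw [hfx, ← Real.rpow_natCast, ← Real.rpow_mul (h0 x).le]
        congr 1; push_cast; ring)
      (by
        rw [← mul_zero (n / 4), ← hσ, ← integral_const_mul]; congr 1; funext x
        have e : ρ x ^ (n / 2 - 1) = ρ x ^ (n / 4) * ρ x ^ (n / 4 - 1) := by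
          rw [← Real.rpow_add (h0 x)]; congr 1; ring
        rw [hfx, hpx, e]; ring)
  set J := Metric.ball (0 : ℝ) ε
  have h0J : (0 : ℝ) ∈ J := Metric.mem_ball_self hε
  have hJ : IsOpen J := Metric.isOpen_ball
  have hFJ := hF.mono (subset_univ J)
  have hU : SmoothOver E (fun q ↦ F q ^ (4 / n)) J := hFJ.rpow hpos _
  have hU' : SmoothOver E (fun q ↦ 4 / n * (F q ^ (4 / n - 1) * F' q)) J :=
    (smoothOver_time contDiff_const J).mul ((hFJ.rpow hpos _).mul (hF'.mono (subset_univ J)))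
  have hu : ∀ t ∈ J, ∀ x, sliceFn hU t x = F (t, x) ^ (4 / n) := fun t ht x ↦
    sliceFn_apply hU ht x
  have hu' : ∀ t ∈ J, ∀ x, sliceFn hU' t x = 4 / n * (F (t, x) ^ (4 / n - 1) * F' (t, x)) :=
    fun t ht x ↦ sliceFn_apply hU' ht x
  have e2 : ∀ t ∈ J, ∀ x, (F (t, x) ^ (4 / n)) ^ (n / 2) = F (t, x) ^ 2 := by
    intro t ht x
    rw [← Real.rpow_mul (hpos t ht x).le, ← Real.rpow_natCast]
    congr 1; field_simp; norm_num
  refine ⟨ε, sliceFn hU, sliceFn hU', hε, smoothFunCurveOn_sliceFn hU, fun t ht ↦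
    ⟨fun x ↦ ?_, ?_, fun x ↦ ?_, fun x ↦ ?_⟩, ?_, ?_⟩
  · rw [hu t ht]; exact Real.rpow_pos_of_pos (hpos t ht x) _
  · simp only [hu t ht, e2 t ht, i1]
  · rw [hu' t ht]
    refine hasDerivAt_sliceFn hU hJ ht (((hd t x).rpow_const
      (Or.inl (hpos t ht x).ne')).congr_deriv ?_)
    ring
  · have hp := hpos t ht
    have hup : ∀ x, 0 < F (t, x) ^ (4 / n) := fun x ↦ Real.rpow_pos_of_pos (hp x) _
    refine hasDerivAt_sliceFn hU' hJ ht ((((((hd t x).rpow_const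
      (Or.inl (hp x).ne')).mul (hd' t x)).const_mul (4 / n))).congr_deriv ?_)
    -- For u = F^{4/n} the three integrals in `confChristoffel` are 0, (16/n²) a²v and v, so that
    -- the geodesic equation for u is F'' = -a²F.
    have j1 : integral E g (fun x ↦ sliceFn hU' t x * sliceFn hU t x ^ (n / 2 - 1)) = 0 := by
      rw [← mul_zero (4 / n), ← i2 t, ← integral_const_mul]
      congr 1; funext y
      have := (hp y).ne'
      have := (hup y).ne'
      rw [hu' t ht, hu t ht, Real.rpow_sub_one (hup y).ne', e2 t ht, Real.rpow_sub_one (hp y).ne']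
      field_simp
    have j2 : integral E g (fun x ↦ sliceFn hU' t x * sliceFn hU' t x *
        sliceFn hU t x ^ (n / 2 - 2)) = 16 / n ^ 2 * (a ^ 2 * v) := by
      rw [← i3 t, ← integral_const_mul]
      congr 1; funext y
      have := (hp y).ne'
      have := (hup y).ne'
      rw [hu' t ht, hu t ht, Real.rpow_sub (hup y), Real.rpow_two, e2 t ht,
        Real.rpow_sub_one (hp y).ne']
      field_simp
      ring
    have j3 : integral E g (fun x ↦ sliceFn hU t x ^ (n / 2)) = v := by
      simp only [hu t ht, e2 t ht, i1]
    have h1 := (hp x).ne'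
    have h2 := (hup x).ne'
    rw [confChristoffel, ← hndef, j1, j2, j3, hu t ht, hu' t ht, sub_sub, one_add_one_eq_two,
      Real.rpow_sub (hp x), Real.rpow_sub_one h1, Real.rpow_two]
    field_simp
    ring
  · ext x
    rw [hu 0 h0J, hF0, hfx, ← Real.rpow_mul (h0 x).le]
    have : n / 4 * (4 / n) = 1 := by field_simp
    rw [this, Real.rpow_one]
  · ext x
    rw [hu' 0 h0J, hF0, hF0', hfx, hpx, ← Real.rpow_mul (h0 x).le]
    have e : n / 4 * (4 / n - 1) = 1 - n / 4 := by field_simp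
    have e3 : ρ x ^ (1 - n / 4) * ρ x ^ (n / 4 - 1) = 1 := by
      rw [← Real.rpow_add (h0 x)]; simp
    have e4 : 4 / n * (n / 4) = 1 := by field_simp
    rw [e]
    linear_combination σ x * e3 + σ x * (ρ x ^ (1 - n / 4) * ρ x ^ (n / 4 - 1)) * e4

/-- The great circle with the given initial velocity is a curve in the set that realizes it. -/
theorem isTangentTo_fmul {g : symTensors E M} (hg : g ∈ metrics E M) (hn : 0 < dim E)
    {v : ℝ} (hv : 0 < v) {ρ σ : Fn E M} (h0 : ∀ x, 0 < ρ x)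
    (hρ : integral E g (fun x ↦ ρ x ^ (dim E / 2)) = v)
    (hσ : integral E g (fun x ↦ σ x * ρ x ^ (dim E / 2 - 1)) = 0) :
    IsTangentTo E (confVol g v) (fmul ρ g) (fmul σ g) := by
  obtain ⟨ε, u, u', hε, hu, H, hu0, hu0'⟩ := exists_conformal_geodesic hg hn hv h0 hρ hσ
  refine ⟨fun t ↦ fmul (u t) g, Metric.ball 0 ε, Metric.isOpen_ball, Metric.mem_ball_self hε,
    SmoothCurveOn.fmul (c := fun _ ↦ g) hu (smoothCurveOn_const g _), fun t ht ↦ ?_, ?_, ?_⟩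
  · exact (mem_confVol_iff hg).2 ⟨u t, (H t ht).1, rfl, (H t ht).2.1⟩
  · simp only [hu0]
  · refine (hasVelocityAt_fmul_iff hg hn.ne').2 ⟨σ, rfl, ?_⟩
    have := (H 0 (Metric.mem_ball_self hε)).2.2.1
    rwa [hu0'] at this

theorem exists_geodesic_confVol {g : symTensors E M} (hg : g ∈ metrics E M) (hn : 0 < dim E)
    {v : ℝ} (hv : 0 < v) {Γ : Christoffel E M} (hΓ : IsLeviCivita E (gN E) Γ) {k h : symTensors E M}
    (hk : k ∈ confVol g v) (hh : IsTangentTo E (confVol g v) k h) :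
    ∃ (c c' : ℝ → symTensors E M) (J : Set ℝ), IsGeodesicOn E Γ c c' J ∧ (0 : ℝ) ∈ J ∧
      c 0 = k ∧ c' 0 = h ∧ ∀ t ∈ J, c t ∈ confVol g v := by
  obtain ⟨ρ, h0, rfl, hρ⟩ := (mem_confVol_iff hg).1 hk
  obtain ⟨σ, rfl, hσ⟩ := hh.exists_fmul hg hn.ne'
  obtain ⟨ε, u, u', hε, hu, H, hu0, hu0'⟩ := exists_conformal_geodesic hg hn hv h0 hρ hσ
  have hN : ∀ t ∈ Metric.ball (0 : ℝ) ε, fmul (u t) g ∈ confVol g v := fun t ht ↦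
    (mem_confVol_iff hg).2 ⟨u t, (H t ht).1, rfl, (H t ht).2.1⟩
  have hv1 : ∀ t ∈ Metric.ball (0 : ℝ) ε,
      HasVelocityAt E (fun s ↦ fmul (u s) g) (fmul (u' t) g) t := fun t ht ↦
    (hasVelocityAt_fmul_iff hg hn.ne').2 ⟨u' t, rfl, (H t ht).2.2.1⟩
  refine ⟨fun t ↦ fmul (u t) g, fun t ↦ fmul (u' t) g, Metric.ball 0 ε,
    ⟨Metric.isOpen_ball, (convex_ball 0 ε).ordConnected,
      SmoothCurveOn.fmul (c := fun _ ↦ g) hu (smoothCurveOn_const g _), fun t ht ↦ (hN t ht).2.1,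
      hv1, fun t ht ↦ ?_⟩, Metric.mem_ball_self hε, by simp only [hu0], by simp only [hu0'], hN⟩
  let Q : Fn E M := mkFn (confChristoffel g (u t) (u' t) (u' t))
    (contMDiff_confChristoffel g (H t ht).1 _ _)
  refine ⟨fmul (u' t) g, fmul (-Q) g, hv1 t ht,
    (hasVelocityAt_fmul_iff hg hn.ne').2 ⟨-Q, rfl, (H t ht).2.2.2⟩, ?_⟩
  rw [hΓ.apply_fmul hg (H t ht).1]
  refine gram_ext fun x ↦ ?_
  rw [gram_add, gram_fmul, gram_fmul, gram_zero, ← add_smul]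
  have : (-Q) x + Q x = 0 := by simp
  exact (by rw [show (mkFn _ (contMDiff_confChristoffel g (H t ht).1 (u' t) (u' t)) : Fn E M) = Q
    from rfl, this, zero_smul])

end GreatCircles

/-! ### Vanishing of the second fundamental form -/

section TotallyGeodesic

variable {E : Type*} [NormedAddCommGroup E] [NormedSpace ℝ E] [FiniteDimensional ℝ E]
  {M : Type*} [TopologicalSpace M] [ChartedSpace E M] [IsManifold 𝓘(ℝ, E) ∞ M]

theorem HasVelocityAt.unique {c : ℝ → symTensors E M} {h k : symTensors E M} {t : ℝ}
    (hh : HasVelocityAt E c h t) (hk : HasVelocityAt E c k t) : h = k :=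
  gram_ext fun x ↦ by
    ext i j; exact (hasVelocityAt_iff.1 hh x i j).unique (hasVelocityAt_iff.1 hk x i j)

theorem fmul_one (g : symTensors E M) : fmul (1 : Fn E M) g = g :=
  gram_ext fun x ↦ by rw [gram_fmul]; exact one_smul _ _

theorem fmul_fmul (ρ σ : Fn E M) (g : symTensors E M) : fmul ρ (fmul σ g) = fmul (ρ * σ) g :=
  gram_ext fun x ↦ by rw [gram_fmul, gram_fmul, gram_fmul, smul_smul]; rfl

theorem fmul_add (ρ σ : Fn E M) (g : symTensors E M) : fmul ρ g + fmul σ g = fmul (ρ + σ) g :=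
  gram_ext fun x ↦ by rw [gram_add, gram_fmul, gram_fmul, gram_fmul, ← add_smul]; rfl

theorem fmul_sub (ρ σ : Fn E M) (g : symTensors E M) : fmul ρ g - fmul σ g = fmul (ρ - σ) g :=
  gram_ext fun x ↦ by rw [gram_sub, gram_fmul, gram_fmul, gram_fmul, ← sub_smul]; rfl

/-- Any member of the class can serve as its base point; this reduces the curvature to a computation
at ρ = 1. -/
theorem conformalClass_eq {g : symTensors E M} {ρ : Fn E M} (h0 : ∀ x, 0 < ρ x) :
    conformalClass E (fmul ρ g) = conformalClass E g := by
  ext h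
  rw [mem_conformalClass_iff, mem_conformalClass_iff]
  constructor
  · rintro ⟨σ, hσ, rfl⟩
    exact ⟨σ * ρ, fun x ↦ mul_pos (hσ x) (h0 x), fmul_fmul _ _ _⟩
  · rintro ⟨σ, hσ, rfl⟩
    refine ⟨mkFn (fun x ↦ σ x / ρ x) (contMDiff_div h0 σ.contMDiff),
      fun x ↦ div_pos (hσ x) (h0 x), gram_ext fun x ↦ ?_⟩
    rw [gram_fmul, gram_fmul, gram_fmul, smul_smul, mkFn_apply, div_mul_cancel₀ _ (h0 x).ne']

/-- The form in which the conservation laws along geodesics are used. -/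
theorem eqOn_of_hasDerivAt_zero {f : ℝ → ℝ} {J : Set ℝ} (hJ : IsOpen J) (hc : J.OrdConnected)
    (hf : ∀ t ∈ J, HasDerivAt f 0 t) {s t : ℝ} (hs : s ∈ J) (ht : t ∈ J) : f s = f t :=
  hJ.is_const_of_deriv_eq_zero hc.convex.isPreconnected
    (fun t ht ↦ (hf t ht).differentiableAt.differentiableWithinAt) (fun t ht ↦ (hf t ht).deriv)
    hs ht

variable [T2Space M] [CompactSpace M]

/-- For tangent σ and τ the two linear terms drop out, and (n/4 - 1) + n/4 = n/2 - 1. This is the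
factor produced by differentiating the tangency condition ∫ τ ρ^{n/2-1} = 0. -/
theorem integral_confChristoffel (g : symTensors E M) {v : ℝ} (hv : 0 < v) {ρ σ τ : Fn E M}
    (h0 : ∀ x, 0 < ρ x) (hρ : integral E g (fun x ↦ ρ x ^ (dim E / 2)) = v)
    (hσ : integral E g (fun x ↦ σ x * ρ x ^ (dim E / 2 - 1)) = 0)
    (hτ : integral E g (fun x ↦ τ x * ρ x ^ (dim E / 2 - 1)) = 0) :
    integral E g (fun x ↦ confChristoffel g ρ σ τ x * ρ x ^ (dim E / 2 - 1)) =
      (dim E / 2 - 1) * integral E g (fun x ↦ σ x * τ x * ρ x ^ (dim E / 2 - 2)) := by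
  set I := integral E g (fun x ↦ σ x * τ x * ρ x ^ (dim E / 2 - 2)) with hI
  have h1 : (fun x ↦ confChristoffel g ρ σ τ x * ρ x ^ (dim E / 2 - 1)) = fun x ↦
      (dim E / 4 - 1) * (σ x * τ x * ρ x ^ (dim E / 2 - 2)) +
        dim E / (4 * v) * I * ρ x ^ (dim E / 2) := by
    funext x
    have := (h0 x).ne'
    rw [confChristoffel, hρ, hσ, hτ, ← hI, Real.rpow_sub_one this, Real.rpow_sub (h0 x),
      Real.rpow_two]
    field_simp
    ring
  have c1 : Continuous fun x ↦ (dim E / 4 - 1) * (σ x * τ x * ρ x ^ (dim E / 2 - 2)) :=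
    continuous_const.mul (continuous_mul_rpow (σ * τ) ρ h0 _)
  have c2 : Continuous fun x ↦ dim E / (4 * v) * I * ρ x ^ (dim E / 2) :=
    continuous_const.mul (contMDiff_rpow ρ.contMDiff h0 _).continuous
  rw [h1, integral_add g c1 c2, integral_const_mul, integral_const_mul, hρ, ← hI]
  field_simp
  ring

/-- For c = ug and Y = wg the covariant derivative is (w' + Q)g with Q given by `confChristoffel`.
Its tangency is the time derivative of the tangency of Y, rewritten through
`integral_confChristoffel`. -/
theorem covDeriv_isTangentTo {Γ : Christoffel E M} (hΓ : IsLeviCivita E (gN E) Γ)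
    {g : symTensors E M} (hg : g ∈ metrics E M) (hn : 0 < dim E) {v : ℝ} (hv : 0 < v)
    {c Y : ℝ → symTensors E M} {J : Set ℝ} (hJ : IsOpen J) (hc : SmoothCurveOn E c J)
    (hY : SmoothCurveOn E Y J) (hN : ∀ t ∈ J, c t ∈ confVol g v)
    (hT : ∀ t ∈ J, IsTangentTo E (confVol g v) (c t) (Y t)) {t : ℝ} (ht : t ∈ J) :
    ∃ Z, IsCovDerivAt E Γ c Y Z t ∧ IsTangentTo E (confVol g v) (c t) Z := by
  obtain ⟨u, hu, H⟩ := hc.exists_confFactor hg hn.ne' hN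
  have hw : SmoothFunCurveOn E (fun t ↦ confFactor hg (Y t)) J := hY.confFactor hg
  set w : ℝ → Fn E M := fun t ↦ confFactor hg (Y t)
  have K : ∀ s ∈ J, Y s = fmul (w s) g ∧
      integral E g (fun x ↦ w s x * u s x ^ (dim E / 2 - 1)) = 0 := by
    intro s hs
    have h1 := hT s hs
    rw [(H s hs).2.1] at h1
    obtain ⟨σ, h2, h3⟩ := h1.exists_fmul hg hn.ne'
    have h4 : w s = σ := by
      change confFactor hg (Y s) = σ
      rw [h2, confFactor_fmul hg hn.ne']
    rw [h4]
    exact ⟨h2, h3⟩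
  have hu' : SmoothOver E (fun p ↦ u p.1 p.2) J := hu
  have hw' : SmoothOver E (fun p ↦ w p.1 p.2) J := hw
  let u₁ : Fn E M := (hu'.deriv hJ).fn ht
  let w₁ : Fn E M := (hw'.deriv hJ).fn ht
  have du : ∀ x, HasDerivAt (fun s ↦ u s x) (u₁ x) t := fun x ↦ hu'.hasDerivAt hJ ht x
  have dw : ∀ x, HasDerivAt (fun s ↦ w s x) (w₁ x) t := fun x ↦ hw'.hasDerivAt hJ ht x
  have vc : HasVelocityAt E c (fmul u₁ g) t := hasVelocityAt_congr (c := fun s ↦ fmul (u s) g)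
    (by filter_upwards [hJ.mem_nhds ht] with s hs; exact (H s hs).2.1)
    ((hasVelocityAt_fmul_iff hg hn.ne').2 ⟨u₁, rfl, du⟩)
  have vY : HasVelocityAt E Y (fmul w₁ g) t := hasVelocityAt_congr (c := fun s ↦ fmul (w s) g)
    (by filter_upwards [hJ.mem_nhds ht] with s hs; exact (K s hs).1)
    ((hasVelocityAt_fmul_iff hg hn.ne').2 ⟨w₁, rfl, dw⟩)
  obtain ⟨hp, hct, hv'⟩ := H t ht
  have pu : ∀ t ∈ J, ∀ x, 0 < u t x := fun t ht ↦ (H t ht).1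
  have i1 : integral E g (fun x ↦ u₁ x * u t x ^ (dim E / 2 - 1)) = 0 := by
    have h1 := hasDerivAt_integral_rpow g hu' hJ pu ht du (dim E / 2)
    have h2 := h1.congr_of_eventuallyEq (f₁ := fun _ ↦ v) (by
      filter_upwards [hJ.mem_nhds ht] with s hs; exact (H s hs).2.2.symm)
    have h3 := h2.unique (hasDerivAt_const _ _)
    simpa [hn.ne'] using h3
  have i2 : integral E g (fun x ↦ w₁ x * u t x ^ (dim E / 2 - 1) +
      (dim E / 2 - 1) * (w t x * u₁ x * u t x ^ (dim E / 2 - 1 - 1))) = 0 := by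
    have h1 := hasDerivAt_integral_mul_rpow g hw' hu' hJ pu ht dw du (dim E / 2 - 1)
    have h2 := h1.congr_of_eventuallyEq (f₁ := fun _ ↦ 0) (by
      filter_upwards [hJ.mem_nhds ht] with s hs; exact (K s hs).2.symm)
    exact h2.unique (hasDerivAt_const _ _)
  let Q : Fn E M := mkFn (confChristoffel g (u t) u₁ (w t)) (contMDiff_confChristoffel g hp _ _)
  refine ⟨fmul (w₁ + Q) g, ⟨_, _, vc, vY, ?_⟩, ?_⟩
  · rw [hct, (K t ht).1, hΓ.apply_fmul hg hp, fmul_add]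
  · rw [hct]
    refine isTangentTo_fmul hg hn hv hp hv' ?_
    have h1 : (fun x ↦ (w₁ + Q) x * u t x ^ (dim E / 2 - 1)) = fun x ↦
        w₁ x * u t x ^ (dim E / 2 - 1) +
          confChristoffel g (u t) u₁ (w t) x * u t x ^ (dim E / 2 - 1) := by
      funext x; exact add_mul _ _ _
    have c1 : Continuous fun x ↦ w₁ x * u t x ^ (dim E / 2 - 1) := continuous_mul_rpow w₁ _ hp _
    have c2 : Continuous fun x ↦
        confChristoffel g (u t) u₁ (w t) x * u t x ^ (dim E / 2 - 1) :=
      continuous_mul_rpow Q _ hp _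
    have c3 : Continuous fun x ↦
        (dim E / 2 - 1) * (w t x * u₁ x * u t x ^ (dim E / 2 - 1 - 1)) :=
      continuous_const.mul (continuous_mul_rpow (w t * u₁) _ hp _)
    rw [integral_add g c1 c3, integral_const_mul] at i2
    rw [h1, integral_add g c1 c2, integral_confChristoffel g hv hp hv' i1 (K t ht).2, ← i2]
    congr 3
    funext x
    rw [sub_sub, one_add_one_eq_two]
    ring

end TotallyGeodesic

/-! ### Geodesics tangent to the fixed-volume conformal class stay in it -/

section Geodesics

variable {E : Type*} [NormedAddCommGroup E] [NormedSpace ℝ E] [FiniteDimensional ℝ E]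
  {M : Type*} [TopologicalSpace M] [ChartedSpace E M] [IsManifold 𝓘(ℝ, E) ∞ M]
  [T2Space M] [CompactSpace M]

/-- The endomorphism `g⁻¹ h` of the tangent space, as a matrix. -/
def endo (g h : symTensors E M) (x : M) : Mat E := (gram E g x)⁻¹ * gram E h x

omit [T2Space M] [CompactSpace M] in
theorem trace_endo (g h : symTensors E M) (x : M) : (endo g h x).trace = tr₁ g h x := rfl

omit [T2Space M] [CompactSpace M] in
theorem gram_mul_endo {g : symTensors E M} (hg : g ∈ metrics E M) (h : symTensors E M) (x : M) :
    gram E g x * endo g h x = gram E h x := by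
  rw [endo, ← Matrix.mul_assoc, Matrix.mul_nonsing_inv _ (det_gram_pos hg x).ne'.isUnit,
    Matrix.one_mul]

/-- Along a geodesic, the endomorphism `c⁻¹ c'` satisfies a scalar equation. -/
theorem IsGeodesicOn.hasDerivAt_endo {Γ : Christoffel E M} (hΓ : IsLeviCivita E (gN E) Γ)
    {c c' : ℝ → symTensors E M} {J : Set ℝ} (hc : IsGeodesicOn E Γ c c' J) {t : ℝ} (ht : t ∈ J)
    (x : M) (i j) :
    HasDerivAt (fun s ↦ endo (c s) (c' s) x i j)
      (((trInt (c t) (c' t) / (2 * vol E (c t)) - 1 / 2 * tr₁ (c t) (c' t) x) •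
          endo (c t) (c' t) x + (1 / 4 * (tr₂ (c t) (c' t) (c' t) x -
          gE E (c t) (c' t) (c' t) / vol E (c t))) • (1 : Mat E)) i j) t := by
  have hm := hc.mem t ht
  obtain ⟨c₁, Y', h1, h2, h3⟩ := hc.geodesic t ht
  obtain rfl : c₁ = c' t := h1.unique (hc.velocity t ht)
  have hY : Y' = -calabiChristoffel hm (c' t) (c' t) := by
    rw [← hΓ.eq_calabiChristoffel hm]; exact eq_neg_of_add_eq_zero_left h3.symm
  have hd := (det_gram_pos hm x).ne'
  have e1 := hasDerivAt_matrix_inv (A := fun s ↦ gram E (c s) x) (A' := gram E (c' t) x)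
    (fun i j ↦ hasVelocityAt_iff.1 h1 x i j) hd
  have e2 := hasDerivAt_matrix_mul (A := fun s ↦ (gram E (c s) x)⁻¹)
    (B := fun s ↦ gram E (c' s) x) e1 (fun i j ↦ hasVelocityAt_iff.1 h2 x i j) i j
  refine e2.congr_deriv (congrArg (fun A : Mat E ↦ A i j) ?_)
  rw [hY, gram_neg, calabiChristoffel, gram_add, gram_ebinChristoffel, gram_smul, gram_sub, gram_sub,
    gram_smul, gram_smul]
  have hi := inv_mul_gram hm x
  rw [endo]
  set G := gram E (c t) x
  set H := gram E (c' t) x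
  -- In terms of A = c⁻¹c' the quadratic term A² from differentiating c⁻¹ cancels the one from the
  -- symmetrized product, leaving multiples of A and of the identity.
  have k1 : G⁻¹ * (H * G⁻¹ * H) = G⁻¹ * H * G⁻¹ * H := by simp only [Matrix.mul_assoc]
  simp only [Matrix.mul_neg, Matrix.mul_add, Matrix.mul_sub, Matrix.mul_smul, Matrix.neg_mul, hi, k1]
  generalize G⁻¹ * H * G⁻¹ * H = X
  generalize G⁻¹ * H = A
  module

theorem IsGeodesicOn.hasDerivAt_tr₁ {Γ : Christoffel E M} (hΓ : IsLeviCivita E (gN E) Γ)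
    {c c' : ℝ → symTensors E M} {J : Set ℝ} (hc : IsGeodesicOn E Γ c c' J) {t : ℝ} (ht : t ∈ J)
    (x : M) :
    HasDerivAt (fun s ↦ tr₁ (c s) (c' s) x)
      ((trInt (c t) (c' t) / (2 * vol E (c t)) - 1 / 2 * tr₁ (c t) (c' t) x) *
          tr₁ (c t) (c' t) x + dim E / 4 * (tr₂ (c t) (c' t) (c' t) x -
          gE E (c t) (c' t) (c' t) / vol E (c t))) t := by
  refine (_root_.RiemMetrics.hasDerivAt_matrix_trace
    (fun i j ↦ hc.hasDerivAt_endo hΓ ht x i j)).congr_deriv ?_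
  rw [Matrix.trace_add, Matrix.trace_smul, Matrix.trace_smul, Matrix.trace_one, Fintype.card_fin,
    trace_endo, dim, smul_eq_mul, smul_eq_mul]
  ring

omit [T2Space M] [CompactSpace M] in
theorem IsGeodesicOn.smooth_sqrt_detRatio {Γ : Christoffel E M}
    {c c' : ℝ → symTensors E M} {J : Set ℝ} (hc : IsGeodesicOn E Γ c c' J) {g : symTensors E M}
    (hg : g ∈ metrics E M) :
    SmoothOver E (fun p ↦ Real.sqrt (detRatio g (c p.1) p.2)) J :=
  SmoothCurveOn.sqrt_detRatio hg hc.smooth fun t ht x ↦ det_gram_pos (hc.mem t ht) x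

/-- After integration the derivative of the volume form cancels the term -(1/2)(tr A)², where A =
c⁻¹c', and tr A² minus its mean integrates to zero. Only the nonlocal term survives. -/
theorem IsGeodesicOn.hasDerivAt_trInt {Γ : Christoffel E M} (hΓ : IsLeviCivita E (gN E) Γ)
    {c c' : ℝ → symTensors E M} {J : Set ℝ} (hc : IsGeodesicOn E Γ c c' J) {t : ℝ} (ht : t ∈ J)
    (hV : vol E (c t) ≠ 0) :
    HasDerivAt (fun s ↦ trInt (c s) (c' s)) (trInt (c t) (c' t) ^ 2 / (2 * vol E (c t))) t := by
  set g := c t with hgdef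
  have hg : g ∈ metrics E M := hc.mem t ht
  set F : ℝ × M → ℝ := fun p ↦ Real.sqrt (detRatio g (c p.1) p.2) with hF
  have hFs : SmoothOver E F J := hc.smooth_sqrt_detRatio hg
  have hF' : ∀ s ∈ J, ∀ x, HasDerivAt (fun s ↦ F (s, x))
      (1 / 2 * tr₁ (c s) (c' s) x * F (s, x)) s := fun s hs x ↦
    hasDerivAt_sqrt_detRatio hg (hc.velocity s hs) (det_gram_pos (hc.mem s hs) x)
  -- The velocity c' is only given pointwise, so smoothness of this product is obtained by
  -- recognizing it as twice the time derivative of F.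
  have hFd : SmoothOver E (fun p ↦ tr₁ (c p.1) (c' p.1) p.2 * F p) J := by
    have h1 : SmoothOver E (fun p ↦ 2 * deriv (fun s ↦ F (s, p.2)) p.1) J :=
      (smoothOver_time contDiff_const J).mul (hFs.deriv hc.isOpen)
    refine ContMDiffOn.congr h1 fun p hp ↦ ?_
    rw [(hF' p.1 hp.1 p.2).deriv]; ring
  have hs : ∀ s, trInt (c s) (c' s) = integral E g (fun x ↦ tr₁ (c s) (c' s) x * F (s, x)) :=
    fun s ↦ integral_eq_of_detRatio hg _ _
  have hF1 : ∀ x, F (t, x) = 1 := fun x ↦ by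
    simp only [hF, ← hgdef, detRatio_self hg, Real.sqrt_one]
  have h2 := hasDerivAt_integral g hFd hc.isOpen ht fun x ↦
    (hc.hasDerivAt_tr₁ hΓ ht x).mul (hF' t ht x)
  simp only [← hs] at h2
  refine h2.congr_deriv ?_
  set V := vol E g with hVdef
  set S := trInt g (c' t) with hS
  set I := gE E g (c' t) (c' t) with hI
  have h3 : (fun x ↦ ((S / (2 * V) - 1 / 2 * tr₁ g (c' t) x) * tr₁ g (c' t) x +
      dim E / 4 * (tr₂ g (c' t) (c' t) x - I / V)) * F (t, x) +
      tr₁ g (c' t) x * (1 / 2 * tr₁ g (c' t) x * F (t, x))) = fun x ↦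
      (S / (2 * V) * tr₁ g (c' t) x + dim E / 4 * tr₂ g (c' t) (c' t) x) +
        (-(dim E / 4) * (I / V)) * 1 := by
    funext x; rw [hF1]; ring
  have c1 : Continuous fun x ↦ S / (2 * V) * tr₁ g (c' t) x :=
    continuous_const.mul (continuous_tr₁ hg _)
  have c2 : Continuous fun x ↦ dim E / 4 * tr₂ g (c' t) (c' t) x :=
    continuous_const.mul (continuous_tr₂ hg _ _)
  have c3 : Continuous fun x ↦ S / (2 * V) * tr₁ g (c' t) x +
      dim E / 4 * tr₂ g (c' t) (c' t) x := c1.add c2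
  have c4 : Continuous fun _ : M ↦ (-(dim E / 4) * (I / V)) * (1 : ℝ) := continuous_const
  rw [← hgdef, h3, integral_add g c3 c4, integral_add g c1 c2, integral_const_mul,
    integral_const_mul, integral_const_mul, ← vol, ← hVdef, ← trInt, ← gE_eq, ← hS, ← hI]
  field_simp
  ring

/-- Uniqueness of geodesics is not invoked. The geodesic equation for c⁻¹c' yields enough conserved
quantities to integrate the deviation from the conformal class explicitly. -/
theorem IsGeodesicOn.mem_confVol {Γ : Christoffel E M} (hΓ : IsLeviCivita E (gN E) Γ)
    {g : symTensors E M} (hg : g ∈ metrics E M) (hn : 0 < dim E) {v : ℝ} (hv : 0 < v)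
    {c c' : ℝ → symTensors E M} {J : Set ℝ} (hc : IsGeodesicOn E Γ c c' J) {t₀ : ℝ} (ht₀ : t₀ ∈ J)
    (hN : c t₀ ∈ confVol g v) (hT : IsTangentTo E (confVol g v) (c t₀) (c' t₀)) {t : ℝ}
    (ht : t ∈ J) : c t ∈ confVol g v := by
  obtain ⟨ρ, h0, hρ, -⟩ := (mem_confVol_iff hg).1 hN
  have hne : Nonempty M := by
    by_contra hM
    rw [not_nonempty_iff] at hM
    have : vol E (c t₀) = 0 := by
      rw [vol, show (fun _ : M ↦ (1 : ℝ)) = fun _ ↦ 0 from funext fun x ↦ hM.elim x, integral_zero]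
    linarith [hN.2.2]
  have hV : ∀ s ∈ J, vol E (c s) ≠ 0 := fun s hs ↦ (vol_pos (hc.mem s hs)).ne'
  obtain ⟨σ, hσ, hσ0⟩ : ∃ σ : Fn E M, c' t₀ = fmul σ g ∧
      integral E g (fun x ↦ σ x * ρ x ^ (dim E / 2 - 1)) = 0 :=
    IsTangentTo.exists_fmul hg hn.ne' (by rwa [hρ] at hT)
  have dV : ∀ s ∈ J, HasDerivAt (fun s ↦ vol E (c s)) (1 / 2 * trInt (c s) (c' s)) s :=
    fun s hs ↦ hasDerivAt_vol hc.smooth hc.isOpen hs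
      (fun r hr x ↦ det_gram_pos (hc.mem r hr) x) (hc.mem s hs) (hc.velocity s hs)
  -- With S = ∫ tr(c⁻¹c') dV one has S' = S²/(2V) and V' = S/2, so S/V is constant; it is zero at
  -- `t₀` by tangency.
  have htr : ∀ s ∈ J, trInt (c s) (c' s) = 0 := by
    intro s hs
    have h1 := eqOn_of_hasDerivAt_zero (f := fun s ↦ trInt (c s) (c' s) / vol E (c s)) hc.isOpen
      hc.ordConnected (fun r hr ↦ ((hc.hasDerivAt_trInt hΓ hr (hV r hr)).div (dV r hr)
        (hV r hr)).congr_deriv (by have := hV r hr; field_simp; ring)) hs ht₀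
    have h2 : trInt (c t₀) (c' t₀) = 0 := by rw [hρ, hσ, trInt_fmul hg h0, hσ0, mul_zero]
    simp only [h2, zero_div] at h1
    exact (div_eq_zero_iff.1 h1).resolve_right (hV s hs)
  have hvol : vol E (c t) = v := by
    rw [← hN.2.2]
    exact eqOn_of_hasDerivAt_zero (f := fun s ↦ vol E (c s)) hc.isOpen hc.ordConnected
      (fun r hr ↦ (dV r hr).congr_deriv (by rw [htr r hr, mul_zero])) ht ht₀
  set k := c t₀ with hk
  have hkm : k ∈ metrics E M := hc.mem t₀ ht₀
  set F : ℝ → M → ℝ := fun s x ↦ Real.sqrt (detRatio k (c s) x) with hF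
  have hF' : ∀ s ∈ J, ∀ x, HasDerivAt (fun s ↦ F s x)
      (1 / 2 * tr₁ (c s) (c' s) x * F s x) s := fun s hs x ↦
    hasDerivAt_sqrt_detRatio hkm (hc.velocity s hs) (det_gram_pos (hc.mem s hs) x)
  have hFpos : ∀ s ∈ J, ∀ x, 0 < F s x := fun s hs x ↦
    Real.sqrt_pos.2 (detRatio_pos hkm (hc.mem s hs) x)
  have hF0 : ∀ x, F t₀ x = 1 := fun x ↦ by
    simp only [hF, ← hk, detRatio_self hkm, Real.sqrt_one]
  -- the trace free part of `c⁻¹ c'` vanishes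
  have hA : ∀ s ∈ J, ∀ x, gram E (c' s) x = (tr₁ (c s) (c' s) x / dim E) • gram E (c s) x := by
    intro s hs x
    have h1 : ∀ i j, (endo (c s) (c' s) x - (tr₁ (c s) (c' s) x / dim E) • (1 : Mat E)) i j = 0 := by
      intro i j
      -- F is an integrating factor: once S = 0, the trace free part has logarithmic derivative
      -- -(1/2) tr(c⁻¹c'), and F has the opposite one.
      have h2 := eqOn_of_hasDerivAt_zero (f := fun s ↦ F s x * (endo (c s) (c' s) x i j -
          tr₁ (c s) (c' s) x / dim E * (1 : Mat E) i j)) hc.isOpen hc.ordConnected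
        (fun r hr ↦ ((hF' r hr x).mul ((hc.hasDerivAt_endo hΓ hr x i j).sub
          (((hc.hasDerivAt_tr₁ hΓ hr x).div_const (dim E)).mul_const
            ((1 : Mat E) i j)))).congr_deriv (by
          rw [htr r hr]
          simp only [Matrix.add_apply, Matrix.smul_apply, smul_eq_mul, Pi.sub_apply]
          have := hn.ne'
          field_simp
          ring)) hs ht₀
      have h3 : endo k (c' t₀) x i j - tr₁ k (c' t₀) x / dim E * (1 : Mat E) i j = 0 := by
        have hu : IsUnit (gram E g x).det := (det_gram_pos hg x).ne'.isUnit
        have : Invertible (ρ x) := invertibleOfNonzero (h0 x).ne'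
        rw [hρ, hσ, tr₁_fmul_self hg h0, endo, gram_fmul, gram_fmul, Matrix.inv_smul _ _ hu,
          Matrix.smul_mul, Matrix.mul_smul, inv_mul_gram hg, invOf_eq_inv, smul_smul,
          Matrix.smul_apply, smul_eq_mul, mul_div_cancel_left₀ _ hn.ne']
        ring
      simp only [← hk, h3, mul_zero] at h2
      exact (mul_eq_zero.1 h2).resolve_left (hFpos s hs x).ne'
    have h4 : endo (c s) (c' s) x = (tr₁ (c s) (c' s) x / dim E) • (1 : Mat E) :=
      sub_eq_zero.1 (Matrix.ext h1)
    rw [← gram_mul_endo (hc.mem s hs), h4, Matrix.mul_smul, Matrix.mul_one]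
  -- Now c' = (tr(c⁻¹c')/n) c and F' = (1/2) tr(c⁻¹c') F, so F^{-2/n} c is constant.
  have hG : ∀ x, gram E (c t) x = (F t x ^ (2 / dim E)) • gram E k x := by
    intro x
    ext i j
    have h2 := eqOn_of_hasDerivAt_zero (f := fun s ↦ gram E (c s) x i j * F s x ^ (-(2 / dim E)))
      hc.isOpen hc.ordConnected (fun r hr ↦ ((hasVelocityAt_iff.1 (hc.velocity r hr) x i j).mul
        ((hF' r hr x).rpow_const (Or.inl (hFpos r hr x).ne'))).congr_deriv (by
          rw [hA r hr x, Matrix.smul_apply, smul_eq_mul, Real.rpow_sub_one (hFpos r hr x).ne']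
          have := hn.ne'
          have := (hFpos r hr x).ne'
          field_simp
          ring)) ht ht₀
    simp only [hF0, Real.one_rpow, mul_one, ← hk] at h2
    rw [Matrix.smul_apply, smul_eq_mul, ← h2, mul_comm, mul_assoc, ← Real.rpow_add (hFpos t ht x)]
    simp
  have hFs : SmoothOver E (fun p : ℝ × M ↦ F p.1 p.2) J := hc.smooth_sqrt_detRatio hkm
  have hFt : ContMDiff 𝓘(ℝ, E) 𝓘(ℝ) ∞ (F t) := hFs.slice ht
  refine ⟨?_, hc.mem t ht, hvol⟩
  rw [← conformalClass_eq h0, ← hρ]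
  exact mem_conformalClass_iff.2 ⟨mkFn _ (contMDiff_rpow hFt (hFpos t ht) (2 / dim E)),
    fun x ↦ Real.rpow_pos_of_pos (hFpos t ht x) _, gram_ext fun x ↦ by
      rw [gram_fmul, mkFn_apply, hG x]⟩

theorem isTotallyGeodesic_confVol {Γ : Christoffel E M} (hΓ : IsLeviCivita E (gN E) Γ)
    {g : symTensors E M} (hg : g ∈ metrics E M) (hn : 0 < dim E) {v : ℝ} (hv : 0 < v) :
    IsTotallyGeodesic E Γ (confVol g v) where
  subset _ h := h.2.1
  covDeriv_tangent _ _ _ hJ hc hY hN hT _ ht := covDeriv_isTangentTo hΓ hg hn hv hJ hc hY hN hT ht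
  geodesic_mem _ _ _ hc _ ht₀ hN hT _ ht := hc.mem_confVol hΓ hg hn hv ht₀ hN hT ht
  exists_geodesic _ hk _ hh := exists_geodesic_confVol hg hn hv hΓ hk hh

end Geodesics

/-! ### Sectional curvature of conformal planes -/

section Curvature

variable {E : Type*} [NormedAddCommGroup E] [NormedSpace ℝ E] [FiniteDimensional ℝ E]
  {M : Type*} [TopologicalSpace M] [ChartedSpace E M] [IsManifold 𝓘(ℝ, E) ∞ M]
  [T2Space M] [CompactSpace M]

/-- The derivative at `1`, in the direction `θ`, of the conformal factor of the covariant
derivative. -/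
def confChristoffelDeriv (g : symTensors E M) (σ τ θ : Fn E M) (x : M) : ℝ :=
  -(dim E / 4 - 1) * (σ x * τ x * θ x) + dim E / (4 * vol E g) *
    ((dim E / 2 - 2) * integral E g (fun x ↦ σ x * τ x * θ x) +
      integral E g (fun x ↦ σ x * τ x) * θ x -
      (dim E / 2 - 1) * integral E g (fun x ↦ σ x * θ x) * τ x -
      (dim E / 2 - 1) * integral E g (fun x ↦ τ x * θ x) * σ x)

theorem contMDiff_confChristoffelDeriv (g : symTensors E M) (σ τ θ : Fn E M) :
    ContMDiff 𝓘(ℝ, E) 𝓘(ℝ) ∞ (confChristoffelDeriv g σ τ θ) :=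
  (contMDiff_const.mul ((σ.contMDiff.mul τ.contMDiff).mul θ.contMDiff)).add
    (contMDiff_const.mul (((contMDiff_const.add (contMDiff_const.mul θ.contMDiff)).sub
      (contMDiff_const.mul τ.contMDiff)).sub (contMDiff_const.mul σ.contMDiff)))

theorem confChristoffel_one (g : symTensors E M) (σ τ : M → ℝ) (x : M) :
    confChristoffel g (1 : Fn E M) σ τ x = (dim E / 4 - 1) * (σ x * τ x) +
      dim E / (4 * vol E g) * (integral E g (fun x ↦ σ x * τ x) - integral E g σ * τ x -
        integral E g τ * σ x) := by
  have h1 : ∀ x, (1 : Fn E M) x = 1 := fun _ ↦ rfl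
  simp only [confChristoffel, h1, Real.one_rpow, mul_one, div_one]
  rfl

omit [FiniteDimensional ℝ E] [IsManifold 𝓘(ℝ, E) ∞ M] [T2Space M] in
theorem exists_pos_line (θ : Fn E M) :
    ∃ ε > 0, ∀ t ∈ Metric.ball (0 : ℝ) ε, ∀ x, 0 < 1 + t * θ x := by
  have h : IsOpen {p : ℝ × M | 0 < 1 + p.1 * θ p.2} :=
    isOpen_lt continuous_const (continuous_const.add
      (continuous_fst.mul (θ.contMDiff.continuous.comp continuous_snd)))
  exact exists_ball_prod_subset h fun x ↦ by
    change 0 < 1 + 0 * θ x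
    simp

/-- Differentiation at ρ = 1 suffices after changing the base point of the class. The mean zero
assumptions remove the derivative of the volume and the values of the two linear integrals, but not
the derivatives of the latter. -/
theorem hasDerivAt_confChristoffel (g : symTensors E M) (hV : vol E g ≠ 0) {σ τ θ : Fn E M}
    (hσ : integral E g σ = 0) (hτ : integral E g τ = 0) (hθ : integral E g θ = 0) (x : M) :
    HasDerivAt (fun t ↦ confChristoffel g (fun x ↦ 1 + t * θ x) σ τ x)
      (confChristoffelDeriv g σ τ θ x) 0 := by
  obtain ⟨ε, hε, hpos⟩ := exists_pos_line θ
  have h0 : (0 : ℝ) ∈ Metric.ball (0 : ℝ) ε := Metric.mem_ball_self hε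
  have hU : SmoothOver E (fun p : ℝ × M ↦ 1 + p.1 * θ p.2) (Metric.ball 0 ε) :=
    (smoothOver_time contDiff_const _).add ((smoothOver_time contDiff_id _).mul (smoothOver_fun θ _))
  have dU : ∀ x, HasDerivAt (fun t ↦ 1 + t * θ x) (θ x) 0 := fun x ↦ by
    simpa using ((hasDerivAt_id (0 : ℝ)).mul_const (θ x)).const_add 1
  have dW : ∀ (w : Fn E M) (q : ℝ),
      HasDerivAt (fun t ↦ integral E g (fun x ↦ w x * (1 + t * θ x) ^ q))
        (q * integral E g (fun x ↦ w x * θ x)) 0 := by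
    intro w q
    have h1 := hasDerivAt_integral_mul_rpow g (W := fun p ↦ w p.2)
      (smoothOver_fun w (Metric.ball 0 ε)) hU Metric.isOpen_ball hpos h0 (W' := fun _ ↦ 0)
      (fun x ↦ hasDerivAt_const _ (w x)) dU q
    simpa [integral_const_mul] using h1
  have d1 := dW 1 (dim E / 2)
  have d2 := dW (σ * τ) (dim E / 2 - 2)
  have d3 := dW σ (dim E / 2 - 1)
  have d4 := dW τ (dim E / 2 - 1)
  have e1 : ∀ x, (1 : Fn E M) x = 1 := fun _ ↦ rfl
  have e2 : ∀ x, (σ * τ) x = σ x * τ x := fun _ ↦ rfl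
  simp only [e1, one_mul, e2] at d1 d2
  have hvol : integral E g (fun x ↦ (1 + 0 * θ x) ^ (dim E / 2)) = vol E g := by
    simp [vol]
  have hone : integral E g (fun _ ↦ 1) = vol E g := rfl
  have hθ' : integral E g (fun x ↦ θ x) = 0 := hθ
  have hσ' : integral E g (fun x ↦ σ x) = 0 := hσ
  have hτ' : integral E g (fun x ↦ τ x) = 0 := hτ
  have key := (((hasDerivAt_const (0 : ℝ) (σ x * τ x)).div (dU x) (by simp)).const_mul
    (dim E / 4 - 1)).add (((hasDerivAt_const (0 : ℝ) (dim E)).div (d1.const_mul 4)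
      (by rw [hvol]; exact mul_ne_zero four_ne_zero hV)).mul
      (((d2.mul (dU x)).sub (d3.mul_const (τ x))).sub (d4.mul_const (σ x))))
  refine key.congr_deriv ?_
  simp only [Pi.sub_apply, Pi.mul_apply, Pi.div_apply, hθ', mul_zero, zero_mul, add_zero,
    Real.one_rpow, mul_one, hσ', hτ', sub_zero, hone, confChristoffelDeriv]
  field_simp
  ring

/-- The line g + tθg does not keep the volume fixed, but for small t it stays in the conformal
class, and there the formula for Γ on conformal directions holds for every volume. -/
theorem hasVelocityAt_connection {Γ : Christoffel E M} (hΓ : IsLeviCivita E (gN E) Γ)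
    {g : symTensors E M} (hg : g ∈ metrics E M) (hV : vol E g ≠ 0)
    {σ τ θ : Fn E M}
    (hσ : integral E g σ = 0) (hτ : integral E g τ = 0) (hθ : integral E g θ = 0) :
    HasVelocityAt E (fun t : ℝ ↦ Γ (g + t • fmul θ g) (fmul σ g) (fmul τ g))
      (fmul (mkFn _ (contMDiff_confChristoffelDeriv g σ τ θ)) g) 0 := by
  obtain ⟨ε, hε, hpos⟩ := exists_pos_line θ
  let ρ : ℝ → Fn E M := fun t ↦ mkFn (fun x ↦ 1 + t * θ x)
    (contMDiff_const.add (contMDiff_const.mul θ.contMDiff))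
  have hρ : ∀ t x, ρ t x = 1 + t * θ x := fun _ _ ↦ rfl
  have h1 : ∀ t : ℝ, g + t • fmul θ g = fmul (ρ t) g := fun t ↦ gram_ext fun x ↦ by
    rw [gram_add, gram_smul, gram_fmul, gram_fmul, hρ, add_smul, one_smul, smul_smul]
  refine hasVelocityAt_iff.2 fun x i j ↦ ?_
  have h2 := (hasDerivAt_confChristoffel g hV hσ hτ hθ x).mul_const (gram E g x i j)
  rw [gram_fmul, mkFn_apply, Matrix.smul_apply, smul_eq_mul]
  refine h2.congr_of_eventuallyEq ?_
  filter_upwards [Metric.ball_mem_nhds (0 : ℝ) hε] with t ht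
  rw [h1, hΓ.apply_fmul hg (ρ := ρ t) (hpos t ht), gram_fmul, mkFn_apply, Matrix.smul_apply,
    smul_eq_mul]
  rfl

theorem isTangentTo_self {g : symTensors E M} (hg : g ∈ metrics E M) (hn : dim E ≠ 0) {v : ℝ}
    {h : symTensors E M} (hh : IsTangentTo E (confVol g v) g h) :
    ∃ σ : Fn E M, h = fmul σ g ∧ integral E g σ = 0 := by
  have h1 : IsTangentTo E (confVol g v) (fmul (1 : Fn E M) g) h := by rwa [fmul_one]
  obtain ⟨σ, h2, h3⟩ := h1.exists_fmul hg hn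
  have e1 : ∀ x, (1 : Fn E M) x = 1 := fun _ ↦ rfl
  simp only [e1, Real.one_rpow, mul_one] at h3
  exact ⟨σ, h2, h3⟩

theorem gE_fmul_self {g : symTensors E M} (hg : g ∈ metrics E M) (σ τ : Fn E M) :
    gE E g (fmul σ g) (fmul τ g) = dim E * integral E g (fun x ↦ σ x * τ x) := by
  have e1 : ∀ x, (1 : Fn E M) x = 1 := fun _ ↦ rfl
  have h1 := gE_fmul hg (ρ := 1) (fun x ↦ one_pos) σ τ
  simpa only [fmul_one, e1, Real.one_rpow, mul_one] using h1

theorem apply_fmul_self {Γ : Christoffel E M} (hΓ : IsLeviCivita E (gN E) Γ)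
    {g : symTensors E M} (hg : g ∈ metrics E M) (σ τ : Fn E M) :
    ∃ q : Fn E M, Γ g (fmul σ g) (fmul τ g) = fmul q g ∧ ∀ x, q x =
      (dim E / 4 - 1) * (σ x * τ x) + dim E / (4 * vol E g) *
        (integral E g (fun x ↦ σ x * τ x) - integral E g σ * τ x - integral E g τ * σ x) := by
  have h1 := hΓ.apply_fmul hg (ρ := 1) (fun x ↦ one_pos) σ τ
  rw [fmul_one] at h1
  exact ⟨_, h1, confChristoffel_one g σ τ⟩

/-- Writing h = σg and k = τg, the pointwise cubic terms and the integrals of στ² cancel, and R(h,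
k)k = (n²/16V)((∫τ²)σ - (∫στ)τ) g. Pairing with σg yields the Gram determinant times n/16. -/
theorem curvature_at {Γ : Christoffel E M} (hΓ : IsLeviCivita E (gN E) Γ)
    {g : symTensors E M} (hg : g ∈ metrics E M) (hn : 0 < dim E) (hV : vol E g ≠ 0)
    {σ τ : Fn E M} (hσ : integral E g σ = 0) (hτ : integral E g τ = 0) :
    ∃ R, IsCurvature E Γ g (fmul σ g) (fmul τ g) (fmul τ g) R ∧
      gN E g R (fmul σ g) = dim E / 16 * (gN E g (fmul σ g) (fmul σ g) *
        gN E g (fmul τ g) (fmul τ g) - gN E g (fmul σ g) (fmul τ g) ^ 2) := by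
  obtain ⟨q₁, hq₁, e₁⟩ := apply_fmul_self hΓ hg τ τ
  obtain ⟨q₂, hq₂, e₂⟩ := apply_fmul_self hΓ hg σ τ
  obtain ⟨q₃, hq₃, e₃⟩ := apply_fmul_self hΓ hg σ q₁
  obtain ⟨q₄, hq₄, e₄⟩ := apply_fmul_self hΓ hg τ q₂
  -- A differentiates Γ(k, k) in the direction h and B differentiates Γ(h, k) in the direction k,
  -- with h = σg and k = τg.
  set A : Fn E M := mkFn _ (contMDiff_confChristoffelDeriv g τ τ σ)
  set B : Fn E M := mkFn _ (contMDiff_confChristoffelDeriv g σ τ τ)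
  have hA : ∀ x, A x = confChristoffelDeriv g τ τ σ x := fun _ ↦ rfl
  have hB : ∀ x, B x = confChristoffelDeriv g σ τ τ x := fun _ ↦ rfl
  refine ⟨_, ⟨_, _, hasVelocityAt_connection hΓ hg hV hτ hτ hσ,
    hasVelocityAt_connection hΓ hg hV hσ hτ hτ, rfl⟩, ?_⟩
  rw [hq₁, hq₂, hq₃, hq₄, fmul_add, fmul_add, fmul_sub]
  simp only [gN, gE_fmul_self hg]
  have cσ := σ.contMDiff.continuous
  have cτ := τ.contMDiff.continuous
  set a := integral E g (fun x ↦ σ x * σ x) with ha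
  set b := integral E g (fun x ↦ σ x * τ x) with hb
  set d := integral E g (fun x ↦ τ x * τ x) with hd
  set e := integral E g (fun x ↦ σ x * τ x * τ x) with he
  have hb' : integral E g (fun x ↦ τ x * σ x) = b := by simp only [hb, mul_comm]
  have cττ : Continuous fun x ↦ τ x * τ x := cτ.mul cτ
  have cστ : Continuous fun x ↦ σ x * τ x := cσ.mul cτ
  have csq : Continuous fun x ↦ σ x * τ x * τ x := cστ.mul cτ
  have hσ' : integral E g (fun x ↦ σ x) = 0 := hσ
  have hτ' : integral E g (fun x ↦ τ x) = 0 := hτ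
  -- integrals of the inner covariant derivatives
  have hone : integral E g (fun _ ↦ 1) = vol E g := rfl
  have i1 : integral E g q₁ = (dim E / 2 - 1) * d := by
    have h1 : (q₁ : M → ℝ) = fun x ↦ (dim E / 4 - 1) * (τ x * τ x) +
        dim E / (4 * vol E g) * d * 1 := by
      funext x; rw [e₁, hτ]; ring
    have c1 : Continuous fun x ↦ (dim E / 4 - 1) * (τ x * τ x) := continuous_const.mul cττ
    rw [h1, integral_add g c1 continuous_const, integral_const_mul, integral_const_mul, hone, ← hd]
    field_simp
    ring
  have i2 : integral E g q₂ = (dim E / 2 - 1) * b := by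
    have h1 : (q₂ : M → ℝ) = fun x ↦ (dim E / 4 - 1) * (σ x * τ x) +
        dim E / (4 * vol E g) * b * 1 := by
      funext x; rw [e₂, hτ, hσ]; ring
    have c1 : Continuous fun x ↦ (dim E / 4 - 1) * (σ x * τ x) := continuous_const.mul cστ
    rw [h1, integral_add g c1 continuous_const, integral_const_mul, integral_const_mul, hone, ← hb]
    field_simp
    ring
  have i3 : integral E g (fun x ↦ σ x * q₁ x) = (dim E / 4 - 1) * e := by
    have h1 : (fun x ↦ σ x * q₁ x) = fun x ↦ (dim E / 4 - 1) * (σ x * τ x * τ x) +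
        dim E / (4 * vol E g) * d * σ x := by
      funext x; rw [e₁, hτ]; ring
    have c1 : Continuous fun x ↦ (dim E / 4 - 1) * (σ x * τ x * τ x) := continuous_const.mul csq
    have c2 : Continuous fun x ↦ dim E / (4 * vol E g) * d * σ x := continuous_const.mul cσ
    rw [h1, integral_add g c1 c2, integral_const_mul, integral_const_mul, hσ', mul_zero, add_zero]
  have i4 : integral E g (fun x ↦ τ x * q₂ x) = (dim E / 4 - 1) * e := by
    have h1 : (fun x ↦ τ x * q₂ x) = fun x ↦ (dim E / 4 - 1) * (σ x * τ x * τ x) +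
        dim E / (4 * vol E g) * b * τ x := by
      funext x; rw [e₂, hτ, hσ]; ring
    have c1 : Continuous fun x ↦ (dim E / 4 - 1) * (σ x * τ x * τ x) := continuous_const.mul csq
    have c2 : Continuous fun x ↦ dim E / (4 * vol E g) * b * τ x := continuous_const.mul cτ
    rw [h1, integral_add g c1 c2, integral_const_mul, integral_const_mul, hτ', mul_zero, add_zero]
  have hR : ∀ x, (A + q₃ - (B + q₄)) x =
      dim E ^ 2 / (16 * vol E g) * (d * σ x - b * τ x) := by
    intro x
    change A x + q₃ x - (B x + q₄ x) = _
    have k1 : integral E g (fun x ↦ τ x * τ x * σ x) = e := by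
      rw [he]; congr 1; funext x; ring
    rw [hA, hB, e₃, e₄, confChristoffelDeriv, confChristoffelDeriv, i1, i2, i3, i4, hσ, hτ, e₁, e₂,
      hσ, hτ, k1, hb', ← he, ← hb, ← hd]
    field_simp
    ring
  have hI : integral E g (fun x ↦ (A + q₃ - (B + q₄)) x * σ x) =
      dim E ^ 2 / (16 * vol E g) * (d * a - b ^ 2) := by
    have h1 : (fun x ↦ (A + q₃ - (B + q₄)) x * σ x) = fun x ↦
        dim E ^ 2 / (16 * vol E g) * d * (σ x * σ x) -
          dim E ^ 2 / (16 * vol E g) * b * (σ x * τ x) := by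
      funext x; rw [hR]; ring
    have c1 : Continuous fun x ↦ dim E ^ 2 / (16 * vol E g) * d * (σ x * σ x) :=
      continuous_const.mul (cσ.mul cσ)
    have c2 : Continuous fun x ↦ dim E ^ 2 / (16 * vol E g) * b * (σ x * τ x) :=
      continuous_const.mul cστ
    rw [h1, integral_sub g c1 c2, integral_const_mul, integral_const_mul, ← ha, ← hb]
    ring
  rw [hI]
  field_simp

theorem hasConstantCurvature_confVol {Γ : Christoffel E M} (hΓ : IsLeviCivita E (gN E) Γ)
    (g : symTensors E M) (hn : 0 < dim E) {v : ℝ} (hv : 0 < v) :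
    HasConstantCurvature E (gN E) Γ (confVol g v) (dim E / 16) := by
  intro k hk h l hh hl
  obtain ⟨ρ, h0, h1⟩ := mem_conformalClass_iff.1 hk.1
  have h2 : confVol g v = confVol k v := by
    rw [confVol, confVol, h1, conformalClass_eq h0]
  rw [h2] at hh hl
  have hkm : k ∈ metrics E M := hk.2.1
  obtain ⟨σ, rfl, hσ⟩ := isTangentTo_self hkm hn.ne' hh
  obtain ⟨τ, rfl, hτ⟩ := isTangentTo_self hkm hn.ne' hl
  exact curvature_at hΓ hkm hn (by rw [hk.2.2]; exact hv.ne') hσ hτ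

end Curvature

/-! ### The isometry with a portion of a sphere -/

section Sphere

variable {E : Type*} [NormedAddCommGroup E] [NormedSpace ℝ E] [FiniteDimensional ℝ E]
  {M : Type*} [TopologicalSpace M] [ChartedSpace E M] [IsManifold 𝓘(ℝ, E) ∞ M]

/-- The map `ρ g ↦ K ρ^{n/4}` from the conformal class to functions. -/
def sphereMap {g : symTensors E M} (hg : g ∈ metrics E M) (K : ℝ) (h : symTensors E M) : Fn E M :=
  @dite _ (∀ x, 0 < confFactor hg h x) (Classical.propDecidable _) (fun h0 ↦
    mkFn (fun x ↦ K * confFactor hg h x ^ (dim E / 4))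
      (contMDiff_const.mul (contMDiff_rpow (confFactor hg h).contMDiff h0 _))) fun _ ↦ 0

theorem sphereMap_fmul {g : symTensors E M} (hg : g ∈ metrics E M) (hn : 0 < dim E) (K : ℝ)
    {ρ : Fn E M} (h0 : ∀ x, 0 < ρ x) (x : M) :
    sphereMap hg K (fmul ρ g) x = K * ρ x ^ (dim E / 4) := by
  have h1 : confFactor hg (fmul ρ g) = ρ := confFactor_fmul hg hn.ne' ρ
  rw [sphereMap, dif_pos (by rwa [h1]), mkFn_apply, h1]

theorem rpow_quarter_rpow {n r : ℝ} (hn : 0 < n) (hr : 0 < r) : (r ^ (n / 4)) ^ (4 / n) = r := by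
  rw [← Real.rpow_mul hr.le, div_mul_div_cancel₀ four_ne_zero, div_self hn.ne', Real.rpow_one]

theorem rpow_rpow_quarter {n r : ℝ} (hn : 0 < n) (hr : 0 < r) : (r ^ (4 / n)) ^ (n / 4) = r := by
  rw [← Real.rpow_mul hr.le, div_mul_div_cancel₀ hn.ne', div_self four_ne_zero, Real.rpow_one]

theorem sq_rpow_quarter {n r : ℝ} (hr : 0 < r) : (r ^ (n / 4)) ^ 2 = r ^ (n / 2) := by
  rw [← Real.rpow_natCast, ← Real.rpow_mul hr.le]
  congr 1; push_cast; ring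

variable [T2Space M] [CompactSpace M]

/-- The isometry is ρg ↦ Kρ^{n/4}; its image consists of the positive functions on the sphere, and
its inverse on them is u ↦ (u/K)^{4/n} g. -/
theorem isPortionOfSphere_confVol {g : symTensors E M} (hg : g ∈ metrics E M) (hn : 0 < dim E)
    {v : ℝ} (hv : 0 < v) : IsPortionOfSphere E (gN E) (confVol g v) (16 / dim E) := by
  set n := dim E with hndef
  -- The single condition K²v = 16/n both fixes the radius and gives K²(n/4)² = n/v, the factor that
  -- makes the differential isometric.
  obtain ⟨K, hK, hK2⟩ : ∃ K : ℝ, 0 < K ∧ K ^ 2 * v = 16 / n :=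
    ⟨Real.sqrt (16 / (n * v)), Real.sqrt_pos.2 (by positivity), by
      rw [Real.sq_sqrt (by positivity)]; field_simp⟩
  have hΦ : ∀ {ρ : Fn E M}, (∀ x, 0 < ρ x) → ∀ x, sphereMap hg K (fmul ρ g) x = K * ρ x ^ (n / 4) :=
    fun h0 x ↦ sphereMap_fmul hg hn K h0 x
  have hinv : ∀ {ρ : Fn E M}, (∀ x, 0 < ρ x) → ∀ x,
      (K⁻¹ * sphereMap hg K (fmul ρ g) x) ^ (4 / n) = ρ x := fun h0 x ↦ by
    rw [hΦ h0, inv_mul_cancel_left₀ hK.ne', rpow_quarter_rpow hn (h0 x)]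
  have hpos : ∀ {ρ : Fn E M}, (∀ x, 0 < ρ x) → ∀ x, 0 < sphereMap hg K (fmul ρ g) x :=
    fun h0 x ↦ by rw [hΦ h0]; exact mul_pos hK (Real.rpow_pos_of_pos (h0 x) _)
  refine ⟨g, hg, sphereMap hg K, ?_, ?_, ?_, ?_, ?_⟩
  · intro h hh k hk e
    obtain ⟨ρ, h0, rfl, -⟩ := (mem_confVol_iff hg).1 hh
    obtain ⟨σ, k0, rfl, -⟩ := (mem_confVol_iff hg).1 hk
    have : ρ = σ := by
      ext x
      rw [← hinv h0 x, e, hinv k0 x]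
    rw [this]
  · intro h hh
    obtain ⟨ρ, h0, rfl, h1⟩ := (mem_confVol_iff hg).1 hh
    change integral E g (fun x ↦ sphereMap hg K (fmul ρ g) x ^ 2) = 16 / n
    rw [← hK2, ← h1, ← integral_const_mul]
    congr 1; funext x
    rw [hΦ h0, mul_pow, sq_rpow_quarter (h0 x)]
  · rintro _ ⟨h, hh, rfl⟩
    obtain ⟨ρ, h0, rfl, -⟩ := (mem_confVol_iff hg).1 hh
    -- On compact M a positive function has a positive lower bound, so uniformly close functions are
    -- still positive.
    obtain ⟨ε, hε, hmin⟩ : ∃ ε > 0, ∀ x, ε ≤ sphereMap hg K (fmul ρ g) x := by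
      rcases isEmpty_or_nonempty M with hM | hM
      · exact ⟨1, one_pos, fun x ↦ hM.elim x⟩
      · obtain ⟨x₀, -, hx₀⟩ := isCompact_univ.exists_isMinOn univ_nonempty
          (sphereMap hg K (fmul ρ g)).contMDiff.continuous.continuousOn
        exact ⟨_, hpos h0 x₀, fun x ↦ hx₀ (mem_univ x)⟩
    refine ⟨ε, hε, fun w hw hwu ↦ ?_⟩
    have w0 : ∀ x, 0 < K⁻¹ * w x := fun x ↦ mul_pos (inv_pos.2 hK) (by
      have h1 := abs_lt.1 (hwu x)
      linarith [h1.1, hmin x])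
    let τ : Fn E M := mkFn (fun x ↦ (K⁻¹ * w x) ^ (4 / n))
      (contMDiff_rpow (contMDiff_const.mul w.contMDiff) w0 _)
    have hτ : ∀ x, τ x = (K⁻¹ * w x) ^ (4 / n) := fun _ ↦ rfl
    have τ0 : ∀ x, 0 < τ x := fun x ↦ Real.rpow_pos_of_pos (w0 x) _
    refine ⟨fmul τ g, (mem_confVol_iff hg).2 ⟨τ, τ0, rfl, ?_⟩, ?_⟩
    · have h1 : integral E g (fun x ↦ w x ^ 2) = 16 / n := hw
      have h2 : (fun x ↦ τ x ^ (n / 2)) = fun x ↦ (K⁻¹) ^ 2 * w x ^ 2 := by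
        funext x
        rw [← sq_rpow_quarter (τ0 x), hτ, rpow_rpow_quarter hn (w0 x), mul_pow]
      rw [← hndef, h2, integral_const_mul, h1, ← hK2]
      field_simp
    · ext x
      rw [hΦ τ0, hτ, rpow_rpow_quarter hn (w0 x), mul_inv_cancel_left₀ hK.ne']
  · intro c J hJ hN
    constructor
    · intro hc
      obtain ⟨u, hu, H⟩ := hc.exists_confFactor hg hn.ne' hN
      have hu' : SmoothOver E (fun p ↦ u p.1 p.2) J := hu
      have h1 : SmoothOver E (fun p ↦ K * u p.1 p.2 ^ (n / 4)) J :=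
        (smoothOver_time contDiff_const J).mul (hu'.rpow (fun t ht ↦ (H t ht).1) _)
      refine ContMDiffOn.congr h1 fun p hp ↦ ?_
      change sphereMap hg K (c p.1) p.2 = _
      rw [(H p.1 hp.1).2.1, hΦ (H p.1 hp.1).1]
    · intro hc
      have hc' : SmoothOver E (fun p ↦ sphereMap hg K (c p.1) p.2) J := hc
      have hp : ∀ t ∈ J, ∀ x, 0 < K⁻¹ * sphereMap hg K (c t) x := fun t ht x ↦ by
        obtain ⟨ρ, h0, h1, -⟩ := (mem_confVol_iff hg).1 (hN t ht)
        rw [h1]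
        exact mul_pos (inv_pos.2 hK) (hpos h0 x)
      have hU : SmoothOver E (fun p ↦ (K⁻¹ * sphereMap hg K (c p.1) p.2) ^ (4 / n)) J :=
        ((smoothOver_time contDiff_const J).mul hc').rpow hp _
      refine SmoothCurveOn.congr (SmoothCurveOn.fmul (c := fun _ ↦ g) (smoothFunCurveOn_sliceFn hU)
        (smoothCurveOn_const g J)) fun t ht ↦ ?_
      obtain ⟨ρ, h0, h1, -⟩ := (mem_confVol_iff hg).1 (hN t ht)
      have h2 : sliceFn hU t = ρ := by
        ext x
        rw [sliceFn_apply hU ht, h1, hinv h0]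
      rw [h2, h1]
  · intro c J hJ hN hc t ht c' hv'
    obtain ⟨u, hu, H⟩ := hc.exists_confFactor hg hn.ne' hN
    have he : ∀ᶠ s in nhds t, s ∈ J := hJ.mem_nhds ht
    have h1 : HasVelocityAt E (fun s ↦ fmul (u s) g) c' t :=
      hasVelocityAt_congr (he.mono fun s hs ↦ (H s hs).2.1.symm) hv'
    obtain ⟨σ, rfl, hσ⟩ := (hasVelocityAt_fmul_iff hg hn.ne').1 h1
    obtain ⟨h0, hct, hvol⟩ := H t ht
    refine ⟨mkFn (fun x ↦ K * (n / 4) * (σ x * u t x ^ (n / 4 - 1)))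
      (contMDiff_const.mul (σ.contMDiff.mul (contMDiff_rpow (u t).contMDiff h0 _))),
      fun x ↦ ?_, ?_⟩
    · refine ((((hσ x).rpow_const (p := n / 4) (Or.inl (h0 x).ne')).const_mul K).congr_deriv
        ?_).congr_of_eventuallyEq (he.mono fun s hs ↦ ?_)
      · rw [mkFn_apply]; ring
      · change sphereMap hg K (c s) x = _
        rw [(H s hs).2.1, hΦ (H s hs).1]
    · rw [hct, gN, gE_fmul hg h0, vol_fmul hg h0, hvol]
      have h2 : (fun x ↦ mkFn (fun x ↦ K * (n / 4) * (σ x * u t x ^ (n / 4 - 1)))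
          (contMDiff_const.mul (σ.contMDiff.mul (contMDiff_rpow (u t).contMDiff h0 _))) x ^ 2) =
          fun x ↦ K ^ 2 * (n ^ 2 / 16) * (σ x * σ x * u t x ^ (n / 2 - 2)) := by
        funext x
        rw [mkFn_apply, Real.rpow_sub_one (h0 x).ne', Real.rpow_sub (h0 x), Real.rpow_two,
          ← sq_rpow_quarter (h0 x)]
        field_simp
        ring
      have h3 : K ^ 2 * (n ^ 2 / 16) = n / v := by
        rw [show K ^ 2 = 16 / n / v by rw [← hK2]; field_simp]
        field_simp
      rw [h2, integral_const_mul, h3, ← hndef]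
      ring

end Sphere

/-! ### Transition maps, and computing integrals in a single chart -/

section Transition

variable {E : Type*} [NormedAddCommGroup E] [NormedSpace ℝ E]
  {M : Type*} [TopologicalSpace M] [ChartedSpace E M]

/-- The transition map between the preferred charts at `b` and `c`. -/
def trans (b c : M) (y : E) : E := chartAt E c ((chartAt E b).symm y)

/-- The domain of the transition map between the preferred charts at `b` and `c`. -/
def overlap (E : Type*) [NormedAddCommGroup E] [NormedSpace ℝ E] [ChartedSpace E M] (b c : M) :
    Set E := (chartAt E b).target ∩ (chartAt E b).symm ⁻¹' (chartAt E c).source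

theorem isOpen_overlap (b c : M) : IsOpen (overlap E b c) :=
  (chartAt E b).symm.isOpen_inter_preimage (chartAt E c).open_source

theorem symm_trans {b c : M} {y : E} (hy : y ∈ overlap E b c) :
    (chartAt E c).symm (trans b c y) = (chartAt E b).symm y :=
  (chartAt E c).left_inv hy.2

theorem trans_mem {b c : M} {y : E} (hy : y ∈ overlap E b c) : trans b c y ∈ overlap E c b := by
  refine ⟨(chartAt E c).map_source hy.2, ?_⟩
  rw [mem_preimage, symm_trans hy]
  exact (chartAt E b).map_target hy.1

theorem trans_trans {b c : M} {y : E} (hy : y ∈ overlap E b c) : trans c b (trans b c y) = y := by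
  rw [trans, symm_trans hy, (chartAt E b).right_inv hy.1]

theorem image_overlap (b c : M) : trans b c '' overlap E b c = overlap E c b := by
  refine Subset.antisymm (image_subset_iff.2 fun y hy ↦ trans_mem hy) fun y hy ↦ ?_
  exact ⟨_, trans_mem hy, trans_trans hy⟩

theorem injOn_trans (b c : M) : InjOn (trans b c) (overlap E b c) := fun y hy z hz h ↦ by
  rw [← trans_trans hy, h, trans_trans hz]

variable [IsManifold 𝓘(ℝ, E) ∞ M]

theorem contDiffOn_trans (b c : M) : ContDiffOn ℝ ∞ (trans b c) (overlap E b c) := by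
  rw [← contMDiffOn_iff_contDiffOn]
  exact (contMDiffOn_chart (x := c)).comp ((contMDiffOn_chart_symm (x := b)).mono
    inter_subset_left) fun y hy ↦ hy.2

theorem contDiffAt_trans {b c : M} {y : E} (hy : y ∈ overlap E b c) :
    ContDiffAt ℝ ∞ (trans b c) y :=
  (contDiffOn_trans b c).contDiffAt ((isOpen_overlap b c).mem_nhds hy)

theorem chartSymmDeriv_eq {b c : M} {y : E} (hy : y ∈ overlap E b c) :
    chartSymmDeriv b y =
      (chartSymmDeriv c (trans b c y)).comp (fderiv ℝ (trans b c) y) := by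
  have h1 : (chartAt E b).symm =ᶠ[nhds y] (chartAt E c).symm ∘ trans b c := by
    filter_upwards [(isOpen_overlap b c).mem_nhds hy] with z hz
    exact (symm_trans hz).symm
  have h2 : MDifferentiableAt 𝓘(ℝ, E) 𝓘(ℝ, E) (chartAt E c).symm (trans b c y) :=
    mdifferentiableAt_atlas_symm (chart_mem_atlas E c) (trans_mem hy).1
  have h3 : MDifferentiableAt 𝓘(ℝ, E) 𝓘(ℝ, E) (trans b c) y :=
    ((contDiffAt_trans hy).differentiableAt (by simp)).mdifferentiableAt
  have h4 := mfderiv_comp y h2 h3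
  rw [mfderiv_eq_fderiv] at h4
  exact (h1.mfderiv_eq).trans h4

variable [FiniteDimensional ℝ E]

/-- The density of the Riemannian volume in the preferred chart at `c`. -/
def dens (g : symTensors E M) (c : M) (y : E) : ℝ :=
  |(chartSymmDeriv c y).det| * Real.sqrt (gram E g ((chartAt E c).symm y)).det

/-- The density transforms with the absolute Jacobian of the transition map, the condition needed
for change of variables. -/
theorem dens_eq (g : symTensors E M) {b c : M} {y : E} (hy : y ∈ overlap E b c) :
    dens g b y = |(fderiv ℝ (trans b c) y).det| * dens g c (trans b c y) := by
  have h1 : (chartSymmDeriv b y).det =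
      (chartSymmDeriv c (trans b c y)).det * (fderiv ℝ (trans b c) y).det := by
    rw [chartSymmDeriv_eq hy]
    exact LinearMap.det_comp _ _
  rw [dens, dens, h1, symm_trans hy, abs_mul]
  ring

theorem sqrt_det_coordGram (g : symTensors E M) (c : M) (a : Fin (Module.finrank ℝ E) → ℝ) :
    Real.sqrt (coordGram E g c a).det = dens g c ((Module.finBasis ℝ E).equivFun.symm a) := by
  rw [coordGram_eq, Matrix.det_mul, Matrix.det_mul, Matrix.det_transpose, mapMat,
    LinearMap.det_toMatrix, mul_right_comm, ← sq, Real.sqrt_mul (sq_nonneg _), Real.sqrt_sq_eq_abs]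
  rfl

theorem continuousOn_dens (g : symTensors E M) (c : M) :
    ContinuousOn (dens g c) (chartAt E c).target := by
  have h1 : ContinuousOn (fun y ↦ Real.sqrt (coordGram E g c ((Module.finBasis ℝ E).equivFun y)).det)
      (chartAt E c).target :=
    ((continuousOn_coordGram_det g c).comp
      (Module.finBasis ℝ E).equivFunL.continuous.continuousOn fun (y : E) hy ↦ by
        change (Module.finBasis ℝ E).equivFun.symm ((Module.finBasis ℝ E).equivFun y) ∈ (chartAt E c).target
        rwa [LinearEquiv.symm_apply_apply]).sqrt
  refine h1.congr fun y _ ↦ ?_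
  beta_reduce
  rw [sqrt_det_coordGram, LinearEquiv.symm_apply_apply]

end Transition

section Localization

open MeasureTheory

variable {E : Type*} [NormedAddCommGroup E] [NormedSpace ℝ E] [FiniteDimensional ℝ E]
  [MeasurableSpace E] [BorelSpace E]

variable (E) in
/-- The Lebesgue measure of the coordinates with respect to the fixed basis. -/
def coordMeasure : Measure E := (volume : Measure (Fin (Module.finrank ℝ E) → ℝ)).map
  (Module.finBasis ℝ E).equivFunL.symm

instance : (coordMeasure E).IsAddHaarMeasure :=
  ContinuousLinearEquiv.isAddHaarMeasure_map _ _

variable {M : Type*} [TopologicalSpace M] [ChartedSpace E M] [IsManifold 𝓘(ℝ, E) ∞ M]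

omit [IsManifold 𝓘(ℝ, E) ∞ M] in
theorem integrableOn_target {b : M} {u : E → ℝ} (hu : ContinuousOn u (chartAt E b).target)
    {K : Set M} (hK : IsCompact K) (hKb : K ⊆ (chartAt E b).source)
    (h0 : ∀ y ∈ (chartAt E b).target, (chartAt E b).symm y ∉ K → u y = 0) :
    IntegrableOn u (chartAt E b).target (coordMeasure E) := by
  set L := chartAt E b '' K
  have hL : IsCompact L := hK.image_of_continuousOn ((chartAt E b).continuousOn.mono hKb)
  have hLt : L ⊆ (chartAt E b).target := by
    rintro _ ⟨x, hx, rfl⟩; exact (chartAt E b).map_source (hKb hx)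
  have h1 : IntegrableOn u L (coordMeasure E) := (hu.mono hLt).integrableOn_compact hL
  have h2 : IntegrableOn u ((chartAt E b).target \ L) (coordMeasure E) := by
    refine integrableOn_zero.congr_fun (fun y hy ↦ ?_)
      ((chartAt E b).open_target.measurableSet.diff hL.measurableSet)
    refine (h0 y hy.1 fun h ↦ hy.2 ⟨_, h, (chartAt E b).right_inv hy.1⟩).symm
  exact (h1.union h2).mono_set fun a ha ↦ by by_cases h : a ∈ L <;> simp [h, ha]

variable [T2Space M] [CompactSpace M]

theorem integral_eq_sum_chart (g : symTensors E M) (f : M → ℝ) :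
    integral E g f = ∑ c ∈ (finite_chartPartition (E := E) (M := M)).toFinset,
      ∫ y in (chartAt E c).target, chartPartition E M c ((chartAt E c).symm y) *
        f ((chartAt E c).symm y) * dens g c y ∂coordMeasure E := by
  rw [integral_eq_sum]
  refine Finset.sum_congr rfl fun c _ ↦ ?_
  have he : MeasurableEmbedding (Module.finBasis ℝ E).equivFunL.symm :=
    (Module.finBasis ℝ E).equivFunL.symm.toHomeomorph.measurableEmbedding
  rw [coordMeasure, he.setIntegral_map]
  refine setIntegral_congr_fun (isOpen_coordDomain c).measurableSet fun a ha ↦ ?_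
  rw [weight, sqrt_det_coordGram]
  change _ * _ = chartPartition E M c (param E c a) * f (param E c a) * _
  rw [mul_left_comm, mul_assoc]
  rfl

omit [T2Space M] [CompactSpace M] in
theorem setIntegral_chart_change (g : symTensors E M) {b c : M} {u : M → ℝ}
    (hb : ∀ x ∉ (chartAt E b).source, u x = 0) (hc : ∀ x ∉ (chartAt E c).source, u x = 0) :
    ∫ y in (chartAt E c).target, u ((chartAt E c).symm y) * dens g c y ∂coordMeasure E =
      ∫ y in (chartAt E b).target, u ((chartAt E b).symm y) * dens g b y ∂coordMeasure E := by
  have h1 : ∀ {b c : M}, (∀ x ∉ (chartAt E b).source, u x = 0) →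
      ∫ y in (chartAt E c).target, u ((chartAt E c).symm y) * dens g c y ∂coordMeasure E =
      ∫ y in overlap E c b, u ((chartAt E c).symm y) * dens g c y ∂coordMeasure E := by
    intro b c hb
    refine setIntegral_eq_of_subset_of_forall_sdiff_eq_zero (chartAt E c).open_target.measurableSet
      inter_subset_left fun y hy ↦ ?_
    rw [hb _ fun h ↦ hy.2 ⟨hy.1, h⟩, zero_mul]
  rw [h1 hb, h1 hc, ← image_overlap b c,
    integral_image_eq_integral_abs_det_fderiv_smul (coordMeasure E)
      (isOpen_overlap b c).measurableSet
      (fun y hy ↦ ((contDiffAt_trans hy).differentiableAt (by simp)).hasFDerivAt.hasFDerivWithinAt)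
      (injOn_trans b c)]
  refine setIntegral_congr_fun (isOpen_overlap b c).measurableSet fun y hy ↦ ?_
  rw [symm_trans hy, dens_eq g hy, smul_eq_mul]
  ring

/-- The integral of a function supported in a chart can be computed in this chart. -/
theorem integral_eq_chart (g : symTensors E M) {b : M} {u : M → ℝ} (hu : Continuous u)
    {K : Set M} (hK : IsCompact K) (hKb : K ⊆ (chartAt E b).source) (h0 : ∀ x ∉ K, u x = 0) :
    integral E g u =
      ∫ y in (chartAt E b).target, u ((chartAt E b).symm y) * dens g b y ∂coordMeasure E := by
  -- The function is supported in chart `b` and the partition function in chart `c`, so each term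
  -- can be moved to `b`; there the partition functions sum to 1.
  have h1 : ∀ c, ∫ y in (chartAt E c).target, chartPartition E M c ((chartAt E c).symm y) *
      u ((chartAt E c).symm y) * dens g c y ∂coordMeasure E =
      ∫ y in (chartAt E b).target, chartPartition E M c ((chartAt E b).symm y) *
        u ((chartAt E b).symm y) * dens g b y ∂coordMeasure E := by
    intro c
    refine setIntegral_chart_change g (u := fun x ↦ chartPartition E M c x * u x)
      (fun x hx ↦ ?_) fun x hx ↦ ?_
    · rw [h0 x fun h ↦ hx (hKb h), mul_zero]
    · rw [image_eq_zero_of_notMem_tsupport fun h ↦ hx (chartPartition_isSubordinate E M c h),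
        zero_mul]
  rw [integral_eq_sum_chart]
  simp only [h1]
  rw [← integral_finsetSum]
  · refine setIntegral_congr_fun (chartAt E b).open_target.measurableSet fun y hy ↦ ?_
    have h2 : ∑ c ∈ (finite_chartPartition (E := E) (M := M)).toFinset,
        chartPartition E M c ((chartAt E b).symm y) = 1 := by
      rw [← (chartPartition E M).sum_eq_one (mem_univ ((chartAt E b).symm y)),
        finsum_eq_sum_of_support_subset]
      intro c hc
      simp only [Finite.coe_toFinset, mem_ofPred_eq]
      exact ⟨_, hc⟩
    rw [← Finset.sum_mul, ← Finset.sum_mul, h2, one_mul]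
  · intro c _
    refine integrableOn_target ?_ hK hKb fun y _ hy ↦ ?_
    · exact (((chartPartition E M c).contMDiff.continuous.comp_continuousOn
        (chartAt E b).continuousOn_symm).mul (hu.comp_continuousOn
        (chartAt E b).continuousOn_symm)).mul (continuousOn_dens g b)
    · rw [h0 _ hy, mul_zero, zero_mul]

end Localization

/-! ### Exterior derivatives of 1-forms in charts, and exact 2-forms -/

section ExteriorDerivative

variable {E : Type*} [NormedAddCommGroup E] [NormedSpace ℝ E]

/-- The exterior derivative of a `1`-form on a vector space. -/
def extDer (A : E → E →L[ℝ] ℝ) (y v w : E) : ℝ := fderiv ℝ A y v w - fderiv ℝ A y w v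

theorem extDer_congr {A B : E → E →L[ℝ] ℝ} {y : E} (h : A =ᶠ[nhds y] B) (v w : E) :
    extDer A y v w = extDer B y v w := by
  rw [extDer, extDer, h.fderiv_eq]

theorem extDer_add {A B : E → E →L[ℝ] ℝ} {y : E} (hA : DifferentiableAt ℝ A y)
    (hB : DifferentiableAt ℝ B y) (v w : E) :
    extDer (A + B) y v w = extDer A y v w + extDer B y v w := by
  rw [extDer, extDer, extDer, fderiv_add hA hB]
  simp only [add_apply]
  ring

theorem extDer_const_smul {A : E → E →L[ℝ] ℝ} {y : E} (hA : DifferentiableAt ℝ A y) (r : ℝ)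
    (v w : E) : extDer (r • A) y v w = r * extDer A y v w := by
  rw [extDer, extDer, fderiv_const_smul hA]
  simp only [smul_apply, smul_eq_mul]
  ring

/-- Naturality of the exterior derivative. -/
theorem extDer_pullback {A : E → E →L[ℝ] ℝ} {T : E → E} {y : E} (hA : DifferentiableAt ℝ A (T y))
    (hT : ContDiffAt ℝ ∞ T y) (v w : E) :
    extDer (fun z ↦ (A (T z)).comp (fderiv ℝ T z)) y v w =
      extDer A (T y) (fderiv ℝ T y v) (fderiv ℝ T y w) := by
  have hT1 : DifferentiableAt ℝ T y := hT.differentiableAt (by simp)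
  have hT2 : DifferentiableAt ℝ (fderiv ℝ T) y :=
    (hT.fderiv_right (m := 1) (by norm_cast)).differentiableAt (by simp)
  have h1 : HasFDerivAt (fun z ↦ (A (T z)).comp (fderiv ℝ T z)) _ y :=
    (hA.hasFDerivAt.comp y hT1.hasFDerivAt).clm_comp hT2.hasFDerivAt
  -- The second derivative of T enters symmetrically in v and w, so it cancels in the
  -- antisymmetrization.
  have hs : IsSymmSndFDerivAt ℝ T y := hT.isSymmSndFDerivAt (by
    rw [minSmoothness_of_isRCLikeNormedField]; exact ENat.LEInfty.out)
  rw [extDer, extDer, h1.fderiv]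
  simp only [add_apply, ContinuousLinearMap.comp_apply, Function.comp_apply,
    ContinuousLinearMap.compL_apply, ContinuousLinearMap.flip_apply]
  rw [hs.eq v w]
  ring

variable {M : Type*} [TopologicalSpace M] [ChartedSpace E M] [IsManifold 𝓘(ℝ, E) ∞ M]

theorem coordForm_apply (α : OneForm E M) (c : M) (y v : E) :
    coordForm E α c y v = α ((chartAt E c).symm y) (chartSymmDeriv c y v) := rfl

/-- The identity `dα = β` at a point of the preferred chart at `c`. -/
def IsExtDerAt (α : OneForm E M) (β : M → E → E → ℝ) (c : M) (y : E) : Prop :=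
  ∀ v w : E, β ((chartAt E c).symm y) (chartSymmDeriv c y v) (chartSymmDeriv c y w) =
    extDer (coordForm E α c) y v w

theorem isExteriorDerivative_iff (α : OneForm E M) (β : M → E → E → ℝ) :
    IsExteriorDerivative E α β ↔ ∀ c, ∀ y ∈ (chartAt E c).target, IsExtDerAt α β c y := Iff.rfl

variable [FiniteDimensional ℝ E]

theorem contDiffOn_coordForm (α : OneForm E M) (c : M) :
    ContDiffOn ℝ ∞ (coordForm E α c) (chartAt E c).target := by
  rw [contDiffOn_clm_apply]
  intro v
  rw [← contMDiffOn_iff_contDiffOn]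
  intro y hy
  have h1 : ContMDiffWithinAt 𝓘(ℝ, E) 𝓘(ℝ, E) ∞ (chartAt E c).symm (chartAt E c).target y :=
    contMDiffOn_chart_symm y hy
  have h2 := (contMDiffWithinAt_oneForm_iff (I := 𝓘(ℝ, E)) (φ := (chartAt E c).symm)
    (fun z ↦ α ((chartAt E c).symm z)) h1 hy ((chartAt E c).map_target hy)).1
    ((α.contMDiff _).comp_contMDiffWithinAt y h1) v
  have h3 : ∀ z ∈ (chartAt E c).target, coordForm E α c z v =
      α ((chartAt E c).symm z) (frame c ((chartAt E c).symm z) v) := by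
    intro z hz
    have h4 : frameL c ((chartAt E c).symm z) v = chartSymmDeriv c z v := by
      rw [frameL_eq ((chartAt E c).map_target hz), (chartAt E c).right_inv hz]
    rw [coordForm_apply, ← h4]
    rfl
  exact h2.congr h3 (h3 y hy)

theorem differentiableAt_coordForm (α : OneForm E M) {c : M} {y : E}
    (hy : y ∈ (chartAt E c).target) : DifferentiableAt ℝ (coordForm E α c) y :=
  ((contDiffOn_coordForm α c).contDiffAt ((chartAt E c).open_target.mem_nhds hy)).differentiableAt
    (by simp)

omit [FiniteDimensional ℝ E] in
theorem coordForm_eq (α : OneForm E M) {b c : M} {y : E} (hy : y ∈ overlap E b c) :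
    coordForm E α b y = (coordForm E α c (trans b c y)).comp (fderiv ℝ (trans b c) y) := by
  ext v
  rw [ContinuousLinearMap.comp_apply, coordForm_apply, coordForm_apply, chartSymmDeriv_eq hy,
    symm_trans hy]
  rfl

theorem extDer_coordForm (α : OneForm E M) {b c : M} {y : E} (hy : y ∈ overlap E b c) (v w : E) :
    extDer (coordForm E α b) y v w = extDer (coordForm E α c) (trans b c y)
      (fderiv ℝ (trans b c) y v) (fderiv ℝ (trans b c) y w) := by
  rw [← extDer_pullback (differentiableAt_coordForm α (trans_mem hy).1) (contDiffAt_trans hy)]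
  refine extDer_congr ?_ v w
  filter_upwards [(isOpen_overlap b c).mem_nhds hy] with z hz
  exact coordForm_eq α hz

/-- The identity `dα = β` can be checked in any chart. -/
theorem IsExtDerAt.of_trans {α : OneForm E M} {β : M → E → E → ℝ} {b c : M} {y : E}
    (hy : y ∈ overlap E b c) (h : IsExtDerAt α β c (trans b c y)) : IsExtDerAt α β b y := by
  intro v w
  rw [extDer_coordForm α hy, ← h, symm_trans hy, chartSymmDeriv_eq hy]
  rfl

/-- The `2`-form `β` is exact. -/
def IsExact (β : M → E → E → ℝ) : Prop := ∃ α : OneForm E M, IsExteriorDerivative E α β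

theorem IsExact.add {β γ : M → E → E → ℝ} (hβ : IsExact β) (hγ : IsExact γ) :
    IsExact (fun x v w ↦ β x v w + γ x v w) := by
  obtain ⟨α, hα⟩ := hβ
  obtain ⟨δ, hδ⟩ := hγ
  refine ⟨α + δ, fun c y hy v w ↦ ?_⟩
  have h1 : coordForm E (α + δ) c = coordForm E α c + coordForm E δ c := rfl
  have h2 := extDer_add (differentiableAt_coordForm α hy) (differentiableAt_coordForm δ hy) v w
  rw [← h1] at h2
  exact (congrArg₂ (· + ·) (hα c y hy v w) (hδ c y hy v w)).trans h2.symm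

theorem IsExact.const_mul {β : M → E → E → ℝ} (hβ : IsExact β) (r : ℝ) :
    IsExact (fun x v w ↦ r * β x v w) := by
  obtain ⟨α, hα⟩ := hβ
  refine ⟨r • α, fun c y hy v w ↦ ?_⟩
  have h1 : coordForm E (r • α) c = r • coordForm E α c := rfl
  have h2 := extDer_const_smul (differentiableAt_coordForm α hy) r v w
  rw [← h1] at h2
  exact (congrArg (r * ·) (hα c y hy v w)).trans h2.symm

/-- The derivative of the preferred chart at `c`. -/
def chartDeriv (c x : M) : E →L[ℝ] E := mfderiv 𝓘(ℝ, E) 𝓘(ℝ, E) (chartAt E c) x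

/-- Extension of a compactly supported `1`-form in a chart by zero. -/
def extendForm (c : M) (A : E → E →L[ℝ] ℝ) (x : M) : E →L[ℝ] ℝ :=
  @ite _ (x ∈ (chartAt E c).source) (Classical.propDecidable _)
    ((A (chartAt E c x)).comp (chartDeriv c x)) 0

omit [FiniteDimensional ℝ E] in
theorem chartDeriv_frameL {c x : M} (hx : x ∈ (chartAt E c).source) (v : E) :
    chartDeriv c x (frameL c x v) = v := by
  rw [frameL_eq hx]
  have h1 := (chart_mem_atlas E c)
  have h2 : MDifferentiableAt 𝓘(ℝ, E) 𝓘(ℝ, E) (chartAt E c) ((chartAt E c).symm (chartAt E c x)) := by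
    rw [(chartAt E c).left_inv hx]
    exact mdifferentiableAt_atlas h1 hx
  have h3 : MDifferentiableAt 𝓘(ℝ, E) 𝓘(ℝ, E) (chartAt E c).symm (chartAt E c x) :=
    mdifferentiableAt_atlas_symm h1 ((chartAt E c).map_source hx)
  have h4 := mfderiv_comp (chartAt E c x) h2 h3
  have h5 : chartAt E c ∘ (chartAt E c).symm =ᶠ[nhds (chartAt E c x)] id := by
    filter_upwards [(chartAt E c).open_target.mem_nhds ((chartAt E c).map_source hx)] with y hy
    exact (chartAt E c).right_inv hy
  rw [h5.mfderiv_eq, mfderiv_id] at h4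
  have h6 := DFunLike.congr_fun h4 v
  have h7 : v = chartDeriv c ((chartAt E c).symm (chartAt E c x))
    (chartSymmDeriv c (chartAt E c x) v) := h6
  rw [(chartAt E c).left_inv hx] at h7
  exact h7.symm

omit [FiniteDimensional ℝ E] in
theorem extendForm_frame {c x : M} (hx : x ∈ (chartAt E c).source) (A : E → E →L[ℝ] ℝ) (v : E) :
    extendForm c A x (frameL c x v) = A (chartAt E c x) v := by
  rw [extendForm, if_pos hx, ContinuousLinearMap.comp_apply, chartDeriv_frameL hx]

variable [T2Space M]

/-- Inside the chart the form is read off from A. A point outside the chart has a neighbourhood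
disjoint from K, which is closed since M is Hausdorff, and there the form is zero. -/
theorem contMDiff_extendForm {c : M} {A : E → E →L[ℝ] ℝ}
    (hA : ContDiffOn ℝ ∞ A (chartAt E c).target) {K : Set M} (hK : IsCompact K)
    (hKc : K ⊆ (chartAt E c).source)
    (h0 : ∀ y ∈ (chartAt E c).target, (chartAt E c).symm y ∉ K → A y = 0) :
    ContMDiff 𝓘(ℝ, E) (𝓘(ℝ, E).prod 𝓘(ℝ, E →L[ℝ] ℝ)) ∞
      (fun x ↦ (⟨x, extendForm (E := E) c A x⟩ : Bundle.TotalSpace (E →L[ℝ] ℝ)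
      (fun x : M ↦ TangentSpace 𝓘(ℝ, E) x →L[ℝ] ℝ))) := by
  intro x
  have hz : ∀ x ∉ K, extendForm c A x = 0 := by
    intro x hx
    by_cases hs : x ∈ (chartAt E c).source
    · rw [extendForm, if_pos hs, h0 _ ((chartAt E c).map_source hs)
        (by rwa [(chartAt E c).left_inv hs]), ContinuousLinearMap.zero_comp]
    · rw [extendForm, if_neg hs]
  by_cases hx : x ∈ (chartAt E c).source
  · refine ((contMDiffWithinAt_oneForm_iff (I := 𝓘(ℝ, E)) (φ := fun x : M ↦ x)
      (fun x ↦ extendForm (E := E) c A x) contMDiffWithinAt_id (mem_univ x) hx).2 fun v ↦ ?_).contMDiffAt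
      Filter.univ_mem
    have h1 : ContMDiffAt 𝓘(ℝ, E) 𝓘(ℝ) ∞ (fun x ↦ A (chartAt E c x) v) x := by
      have h2 : ContDiffOn ℝ ∞ (fun y ↦ A y v) (chartAt E c).target := hA.clm_apply contDiffOn_const
      have h3 := (h2.contDiffAt ((chartAt E c).open_target.mem_nhds
        ((chartAt E c).map_source hx))).contMDiffAt
      exact h3.comp x (contMDiffAt_of_mem_maximalAtlas
        (IsManifold.chart_mem_maximalAtlas c) hx)
    refine (h1.congr_of_eventuallyEq ?_).contMDiffWithinAt
    filter_upwards [(chartAt E c).open_source.mem_nhds hx] with z hz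
    exact extendForm_frame hz A v
  · have hxK : x ∉ K := fun h ↦ hx (hKc h)
    refine ((contMDiffWithinAt_oneForm_iff (I := 𝓘(ℝ, E)) (φ := fun x : M ↦ x)
      (fun x ↦ extendForm (E := E) c A x) contMDiffWithinAt_id (mem_univ x)
        (mem_chart_source E x)).2 fun v ↦ ?_).contMDiffAt Filter.univ_mem
    refine ((contMDiffAt_const (c := (0 : ℝ))).congr_of_eventuallyEq ?_).contMDiffWithinAt
    filter_upwards [hK.isClosed.isOpen_compl.mem_nhds hxK] with z hzK
    rw [hz z hzK]
    rfl

/-- A `2`-form which is supported in a chart and is there the exterior derivative of a `1`-form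
with compact support, is exact. -/
theorem isExact_of_chart {c : M} {A : E → E →L[ℝ] ℝ} {β : M → E → E → ℝ}
    (hA : ContDiffOn ℝ ∞ A (chartAt E c).target) {K : Set M} (hK : IsCompact K)
    (hKc : K ⊆ (chartAt E c).source)
    (h0 : ∀ y ∈ (chartAt E c).target, (chartAt E c).symm y ∉ K → A y = 0)
    (hβ0 : ∀ x ∉ K, ∀ v w, β x v w = 0)
    (hβ : ∀ y ∈ (chartAt E c).target, ∀ v w : E,
      β ((chartAt E c).symm y) (chartSymmDeriv c y v) (chartSymmDeriv c y w) = extDer A y v w) :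
    IsExact β := by
  let α : OneForm E M := ⟨fun x ↦ extendForm (E := E) c A x, contMDiff_extendForm hA hK hKc h0⟩
  have hα : ∀ x, α x = extendForm (E := E) c A x := fun _ ↦ rfl
  have hαc : ∀ y ∈ (chartAt E c).target, coordForm E α c y = A y := by
    intro y hy
    ext v
    have hs := (chartAt E c).map_target hy
    have h1 : chartSymmDeriv c y v = frameL c ((chartAt E c).symm y) v := by
      rw [frameL_eq hs, (chartAt E c).right_inv hy]
    rw [coordForm_apply, h1, hα]
    exact (extendForm_frame hs A v).trans (by rw [(chartAt E c).right_inv hy])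
  have hc : ∀ y ∈ (chartAt E c).target, IsExtDerAt α β c y := by
    intro y hy v w
    rw [hβ y hy]
    refine extDer_congr ?_ v w
    filter_upwards [(chartAt E c).open_target.mem_nhds hy] with z hz
    exact (hαc z hz).symm
  refine ⟨α, (isExteriorDerivative_iff α β).2 fun b y hy ↦ ?_⟩
  -- Over the chart at `c` the identity transfers from `c`; elsewhere the point is off K, where `α`
  -- vanishes nearby and `β` is zero.
  by_cases hs : (chartAt E b).symm y ∈ (chartAt E c).source
  · have ho : y ∈ overlap E b c := ⟨hy, hs⟩
    exact (hc _ (trans_mem ho).1).of_trans ho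
  · intro v w
    have hyK : (chartAt E b).symm y ∉ K := fun h ↦ hs (hKc h)
    rw [hβ0 _ hyK]
    have h1 : coordForm E α b =ᶠ[nhds y] fun _ ↦ 0 := by
      have h2 : (chartAt E b).symm ⁻¹' Kᶜ ∈ nhds y :=
        ((chartAt E b).continuousAt_symm hy).preimage_mem_nhds (hK.isClosed.isOpen_compl.mem_nhds hyK)
      filter_upwards [h2] with z hz
      ext v
      rw [coordForm_apply, hα]
      have h3 : extendForm c A ((chartAt E b).symm z) = 0 := by
        rw [extendForm]
        split_ifs with hs
        · rw [h0 _ ((chartAt E c).map_source hs) (by rwa [(chartAt E c).left_inv hs]),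
            ContinuousLinearMap.zero_comp]
        · rfl
      rw [h3]; rfl
    rw [extDer_congr h1, extDer, fderiv_const_apply]
    simp

end ExteriorDerivative

/-! ### Integration along lines and the Poincaré lemma with compact support -/

section LineIntegrals

open MeasureTheory

variable {E : Type*} [NormedAddCommGroup E] [NormedSpace ℝ E]

/-- Integration along the lines of direction `v`, over the times in `A`. -/
def lineInt (A : Set ℝ) (v : E) (G : E → ℝ) (z : E) : ℝ := ∫ s in A, G (z + s • v)

theorem hasCompactSupport_line {v : E} (hv : v ≠ 0) {G : E → ℝ} (hG : HasCompactSupport G) (z : E) :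
    HasCompactSupport (fun s : ℝ ↦ G (z + s • v)) :=
  hG.comp_isClosedEmbedding
    ((Homeomorph.addLeft z).isClosedEmbedding.comp (isClosedEmbedding_smul_left hv))

theorem integrable_line {v : E} (hv : v ≠ 0) {G : E → ℝ} (hG : HasCompactSupport G)
    (hc : Continuous G) (z : E) : Integrable (fun s : ℝ ↦ G (z + s • v)) :=
  Continuous.integrable_of_hasCompactSupport (by fun_prop) (hasCompactSupport_line hv hG z)

/-- The line integral is the convolution of G with Lebesgue measure on A pushed forward along s ↦
-sv. This map is a closed embedding, so the measure is finite on compact sets and convolution with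
smooth compactly supported G is smooth. -/
theorem contDiff_lineInt [FiniteDimensional ℝ E] (A : Set ℝ) {v : E} (hv : v ≠ 0) {G : E → ℝ}
    (hG : HasCompactSupport G) (hs : ContDiff ℝ ∞ G) : ContDiff ℝ ∞ (lineInt A v G) := by
  borelize E
  have he : Topology.IsClosedEmbedding (fun s : ℝ ↦ s • (-v)) :=
    isClosedEmbedding_smul_left (neg_ne_zero.2 hv)
  set μ : Measure E := (volume.restrict A).map (fun s : ℝ ↦ s • (-v)) with hμ
  have h1 : IsFiniteMeasureOnCompacts μ := ⟨fun K hK ↦ by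
    rw [hμ, Measure.map_apply he.continuous.measurable hK.measurableSet]
    exact ((Measure.restrict_apply_le A _).trans_lt (he.isCompact_preimage hK).measure_lt_top)⟩
  have h2 : LocallyIntegrable (fun _ : E ↦ (1 : ℝ)) μ := locallyIntegrable_const 1
  have h3 := hG.contDiff_convolution_right (μ := μ) (n := ⊤) (ContinuousLinearMap.mul ℝ ℝ) h2 hs
  have h4 : lineInt A v G = convolution (fun _ : E ↦ (1 : ℝ)) G (ContinuousLinearMap.mul ℝ ℝ) μ := by
    funext z
    rw [convolution_def, hμ, he.measurableEmbedding.integral_map, lineInt]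
    refine integral_congr_ae (Filter.Eventually.of_forall fun s ↦ ?_)
    simp
  rw [h4]
  exact h3

/-- Moving the base point by rv moves the endpoint of the half-line by r; the fundamental theorem of
calculus then applies. -/
theorem fderiv_lineInt_Iic [FiniteDimensional ℝ E] {v : E} (hv : v ≠ 0) {G : E → ℝ}
    (hG : HasCompactSupport G) (hs : ContDiff ℝ ∞ G) (z : E) :
    fderiv ℝ (lineInt (Iic 0) v G) z v = G z := by
  have h1 : HasFDerivAt (lineInt (Iic 0) v G) (fderiv ℝ (lineInt (Iic 0) v G) z) z :=
    ((contDiff_lineInt (Iic 0) hv hG hs).differentiable (by simp) z).hasFDerivAt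
  have h2 : HasDerivAt (fun r : ℝ ↦ lineInt (Iic 0) v G (z + r • v))
      (fderiv ℝ (lineInt (Iic 0) v G) z v) 0 := by
    have h3 : HasDerivAt (fun r : ℝ ↦ z + r • v) v 0 := by
      simpa using ((hasDerivAt_id (0 : ℝ)).smul_const v).const_add z
    exact HasFDerivAt.comp_hasDerivAt (x := (0 : ℝ)) (f := fun r : ℝ ↦ z + r • v)
      (by simpa using h1) h3
  set g : ℝ → ℝ := fun s ↦ G (z + s • v) with hg
  have hgc : Continuous g := by have := hs.continuous; fun_prop
  have hgi : Integrable g := integrable_line hv hG hs.continuous z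
  have h4 : ∀ r : ℝ, lineInt (Iic 0) v G (z + r • v) =
      (∫ s in Iic (0 : ℝ), g s) + ∫ s in (0 : ℝ)..r, g s := by
    intro r
    rw [← intervalIntegral.integral_Iic_sub_Iic hgi.integrableOn hgi.integrableOn, add_sub_cancel,
      ← (measurePreserving_add_left volume r).setIntegral_preimage_emb
      (measurableEmbedding_addLeft r)]
    have h5 : (fun x ↦ r + x) ⁻¹' Iic r = Iic 0 := by ext x; simp
    rw [h5, lineInt]
    refine integral_congr_ae (Filter.Eventually.of_forall fun s ↦ ?_)
    simp only [hg, add_smul, add_assoc]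
  have h6 : HasDerivAt (fun r : ℝ ↦ lineInt (Iic 0) v G (z + r • v)) (g 0) 0 := by
    simp only [h4]
    exact (hgc.integral_hasStrictDerivAt 0 0).hasDerivAt.const_add _
  rw [h2.unique h6, hg]
  simp

end LineIntegrals

section Poincare

open MeasureTheory

/-- A closed box in the complex plane. -/
def box (a b c d : ℝ) : Set ℂ := {z | z.re ∈ Icc a b ∧ z.im ∈ Icc c d}

theorem isCompact_box (a b c d : ℝ) : IsCompact (box a b c d) :=
  (isCompact_Icc (a := a) (b := b)).reProdIm (isCompact_Icc (a := c) (b := d))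

theorem hasCompactSupport_of_box {a b c d : ℝ} {F : ℂ → ℝ} (h : ∀ z ∉ box a b c d, F z = 0) :
    HasCompactSupport F := HasCompactSupport.intro (isCompact_box a b c d) h

theorem exists_bump_Icc {a b : ℝ} (hab : a < b) :
    ∃ η : ℝ → ℝ, ContDiff ℝ ∞ η ∧ (∀ x ∉ Icc a b, η x = 0) ∧ ∫ x, η x = 1 := by
  let φ : ContDiffBump ((a + b) / 2) := ⟨(b - a) / 4, (b - a) / 2, by linarith, by linarith⟩
  refine ⟨φ.normed volume, φ.contDiff_normed, fun x hx ↦ ?_, φ.integral_normed⟩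
  by_contra h
  have h1 : x ∈ Function.support (φ.normed volume) := h
  rw [φ.support_normed_eq, Real.ball_eq_Ioo] at h1
  have h2 : φ.rOut = (b - a) / 2 := rfl
  rw [h2] at h1
  exact hx ⟨by linarith [h1.1], by linarith [h1.2]⟩

theorem integral_complex {F : ℂ → ℝ} (hF : Integrable F) :
    ∫ z, F z = ∫ y : ℝ, ∫ x : ℝ, F ⟨x, y⟩ := by
  rw [← Complex.volume_preserving_equiv_real_prod.symm.integral_comp
    Complex.measurableEquivRealProd.symm.measurableEmbedding]
  have h1 : Integrable (fun p : ℝ × ℝ ↦ F (Complex.measurableEquivRealProd.symm p))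
      (volume.prod volume) :=
    (Complex.volume_preserving_equiv_real_prod.symm.integrable_comp_emb
      Complex.measurableEquivRealProd.symm.measurableEmbedding).2 hF
  exact integral_prod_symm _ h1

/-- The Poincaré lemma with compact support in a box of the plane. -/
theorem exists_primitive_of_integral_eq_zero {a b c d : ℝ} (hab : a < b) {F : ℂ → ℝ}
    (hF : ContDiff ℝ ∞ F) (h0 : ∀ z ∉ box a b c d, F z = 0) (hI : ∫ z, F z = 0) :
    ∃ P Q : ℂ → ℝ, ContDiff ℝ ∞ P ∧ ContDiff ℝ ∞ Q ∧ (∀ z ∉ box a b c d, P z = 0) ∧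
      (∀ z ∉ box a b c d, Q z = 0) ∧
      ∀ z, fderiv ℝ Q z 1 - fderiv ℝ P z Complex.I = F z := by
  have hFc := hasCompactSupport_of_box h0
  obtain ⟨η, hη, hη0, hη1⟩ := exists_bump_Icc hab
  -- L is the integral of F over horizontal lines and K = η(x)L has the same horizontal integrals.
  -- Hence F - K has a horizontal primitive Q supported in the box. As F has total integral 0, the
  -- vertical integrals of K vanish and it has a vertical primitive supported in the box.
  set L : ℂ → ℝ := lineInt univ 1 F with hL
  have hLs : ContDiff ℝ ∞ L := contDiff_lineInt univ one_ne_zero hFc hF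
  have hLeq : ∀ z, L z = ∫ x : ℝ, F ⟨x, z.im⟩ := by
    intro z
    rw [hL, lineInt, setIntegral_univ, ← integral_add_left_eq_self (fun x : ℝ ↦ F ⟨x, z.im⟩) z.re]
    congr 1; funext s; congr 1
    apply Complex.ext <;> simp
  have hL0 : ∀ z : ℂ, z.im ∉ Icc c d → L z = 0 := by
    intro z hz
    rw [hLeq]
    exact integral_eq_zero_of_ae (Filter.Eventually.of_forall fun x ↦ h0 _ fun h ↦ hz h.2)
  set K : ℂ → ℝ := fun z ↦ η z.re * L z with hK
  have hre : ContDiff ℝ ∞ (fun z : ℂ ↦ z.re) := Complex.reCLM.contDiff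
  have hKs : ContDiff ℝ ∞ K := (hη.comp hre).mul hLs
  have hK0 : ∀ z ∉ box a b c d, K z = 0 := by
    intro z hz
    by_cases h : z.re ∈ Icc a b
    · rw [hK]; beta_reduce; rw [hL0 z fun h' ↦ hz ⟨h, h'⟩, mul_zero]
    · rw [hK]; beta_reduce; rw [hη0 _ h, zero_mul]
  have hKc := hasCompactSupport_of_box hK0
  set G : ℂ → ℝ := fun z ↦ F z - K z with hG
  have hGs : ContDiff ℝ ∞ G := hF.sub hKs
  have hG0 : ∀ z ∉ box a b c d, G z = 0 := fun z hz ↦ by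
    rw [hG]; beta_reduce; rw [h0 z hz, hK0 z hz, sub_zero]
  have hGc := hasCompactSupport_of_box hG0
  have hline : ∀ z, ∫ s : ℝ, G (z + s • (1 : ℂ)) = 0 := by
    intro z
    rw [hG]
    beta_reduce
    rw [MeasureTheory.integral_sub (integrable_line one_ne_zero hFc hF.continuous z)
      (integrable_line one_ne_zero hKc hKs.continuous z)]
    have h1 : ∀ s : ℝ, K (z + s • (1 : ℂ)) = η (z.re + s) * L z := by
      intro s
      rw [hK]; beta_reduce
      rw [hLeq, hLeq]
      simp
    have h2 : L z = ∫ s : ℝ, F (z + s • (1 : ℂ)) := by rw [hL, lineInt, setIntegral_univ]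
    simp only [h1]
    rw [integral_mul_const, integral_add_left_eq_self η z.re, hη1, one_mul, h2, sub_self]
  have hlineI : ∀ z, ∫ s : ℝ, K (z + s • Complex.I) = 0 := by
    intro z
    have h1 : ∀ s : ℝ, K (z + s • Complex.I) = η z.re * ∫ x : ℝ, F ⟨x, z.im + s⟩ := by
      intro s
      rw [hK]; beta_reduce
      rw [hLeq]
      simp
    simp only [h1]
    rw [MeasureTheory.integral_const_mul,
      integral_add_left_eq_self (fun y : ℝ ↦ ∫ x : ℝ, F ⟨x, y⟩) z.im,
      ← integral_complex (hF.continuous.integrable_of_hasCompactSupport hFc), hI, mul_zero]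
  refine ⟨fun z ↦ -lineInt (Iic 0) Complex.I K z, lineInt (Iic 0) 1 G,
    (contDiff_lineInt _ Complex.I_ne_zero hKc hKs).neg,
    contDiff_lineInt _ one_ne_zero hGc hGs, fun z hz ↦ ?_, fun z hz ↦ ?_, fun z ↦ ?_⟩
  · rw [neg_eq_zero, lineInt]
    -- Above the box the half-line integral is the full line integral, which is zero; at the
    -- remaining points outside the box the half-line misses the support.
    by_cases h : z.re ∈ Icc a b ∧ d < z.im
    · rw [setIntegral_eq_integral_of_forall_compl_eq_zero, hlineI]
      intro s hs
      have hs' : 0 < s := not_le.1 hs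
      refine hK0 _ fun h' ↦ ?_
      have := h'.2.2
      simp at this
      linarith [h.2]
    · refine setIntegral_eq_zero_of_forall_eq_zero fun s hs ↦ hK0 _ fun h' ↦ ?_
      have hs' : s ≤ 0 := hs
      have h1 := h'.1
      have h2 := h'.2
      simp only [Complex.add_re, Complex.add_im, Complex.real_smul, Complex.re_ofReal_mul,
        Complex.im_ofReal_mul, Complex.I_re, Complex.I_im, mul_zero, mul_one, add_zero] at h1 h2
      refine hz ⟨h1, by linarith [h2.1], not_lt.1 fun h3 ↦ h ⟨h1, h3⟩⟩
  · rw [lineInt]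
    by_cases h : z.im ∈ Icc c d ∧ b < z.re
    · rw [setIntegral_eq_integral_of_forall_compl_eq_zero, hline]
      intro s hs
      have hs' : 0 < s := not_le.1 hs
      refine hG0 _ fun h' ↦ ?_
      have := h'.1.2
      simp at this
      linarith [h.2]
    · refine setIntegral_eq_zero_of_forall_eq_zero fun s hs ↦ hG0 _ fun h' ↦ ?_
      have hs' : s ≤ 0 := hs
      have h1 := h'.1
      have h2 := h'.2
      simp only [Complex.add_re, Complex.add_im, Complex.real_smul, mul_one, Complex.ofReal_re,
        Complex.ofReal_im, add_zero] at h1 h2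
      refine hz ⟨⟨by linarith [h1.1], not_lt.1 fun h3 ↦ h ⟨h2, h3⟩⟩, h2⟩
  · have h1 : fderiv ℝ (fun z ↦ -lineInt (Iic 0) Complex.I K z) z =
        -fderiv ℝ (lineInt (Iic 0) Complex.I K) z := fderiv_neg
    rw [h1, neg_apply, fderiv_lineInt_Iic one_ne_zero hGc hGs,
      fderiv_lineInt_Iic Complex.I_ne_zero hKc hKs, hG]
    ring

end Poincare

/-! ### Compatible metrics on a Riemann surface -/

section Kahler

variable {X : Type*} [TopologicalSpace X] [ChartedSpace ℂ X] [IsManifold 𝓘(ℂ) ω X]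

/-- A tangent space is read in the chart preferred at its point, so this derivative is that of a
transition map, and hence complex linear because transition maps are holomorphic. -/
theorem chartSymmDeriv_eq_fderiv {c : X} {y : ℂ} (hy : y ∈ (chartAt ℂ c).target) :
    chartSymmDeriv c y = fderiv ℝ (trans c ((chartAt ℂ c).symm y)) y := by
  have h1 : MDifferentiableAt 𝓘(ℝ, ℂ) 𝓘(ℝ, ℂ) (chartAt ℂ c).symm y :=
    mdifferentiableAt_atlas_symm (chart_mem_atlas ℂ c) hy
  have h2 : mfderiv 𝓘(ℝ, ℂ) 𝓘(ℝ, ℂ) (chartAt ℂ c).symm y =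
      fderivWithin ℝ (trans c ((chartAt ℂ c).symm y)) univ y := by
    refine h1.mfderiv.trans ?_
    simp only [mfld_simps]
    rfl
  rw [fderivWithin_univ] at h2
  exact h2

omit [IsManifold 𝓘(ℂ) ω X] in
theorem mem_overlap_self {c : X} {y : ℂ} (hy : y ∈ (chartAt ℂ c).target) :
    y ∈ overlap ℂ c ((chartAt ℂ c).symm y) := ⟨hy, mem_chart_source ℂ _⟩

theorem chartSymmDeriv_I_mul {c : X} {y : ℂ} (hy : y ∈ (chartAt ℂ c).target) (v : ℂ) :
    chartSymmDeriv c y (Complex.I * v) = Complex.I * chartSymmDeriv c y v := by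
  set x := (chartAt ℂ c).symm y
  have h1 : ContDiffOn ℂ ω (trans c x) (overlap ℂ c x) := by
    rw [← contMDiffOn_iff_contDiffOn]
    exact (contMDiffOn_chart (x := x)).comp ((contMDiffOn_chart_symm (x := c)).mono
      inter_subset_left) fun y hy ↦ hy.2
  have h2 : DifferentiableAt ℂ (trans c x) y :=
    (h1.contDiffAt ((isOpen_overlap c x).mem_nhds (mem_overlap_self hy))).differentiableAt (by simp)
  rw [chartSymmDeriv_eq_fderiv hy, h2.fderiv_restrictScalars ℝ]
  change fderiv ℂ (trans c x) y (Complex.I * v) = Complex.I * fderiv ℂ (trans c x) y v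
  rw [← smul_eq_mul, map_smul, smul_eq_mul]

/-- The oriented area form of the plane. -/
def area (v w : ℂ) : ℝ := v.re * w.im - v.im * w.re

theorem re_I_mul_eq_area (v w : ℂ) :
    (Complex.I * v).re * w.re + (Complex.I * v).im * w.im = area v w := by
  simp [area]; ring

theorem apply_eq_re_im (L : ℂ →L[ℝ] ℂ) (v : ℂ) : L v = v.re • L 1 + v.im • L Complex.I := by
  rw [← map_smul, ← map_smul, ← map_add]
  congr 1
  apply Complex.ext <;> simp

theorem apply_eq_re_im_real (L : ℂ →L[ℝ] ℝ) (v : ℂ) : L v = v.re * L 1 + v.im * L Complex.I := by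
  rw [← smul_eq_mul, ← smul_eq_mul, ← map_smul, ← map_smul, ← map_add]
  congr 1
  apply Complex.ext <;> simp

theorem det_eq_area (L : ℂ →L[ℝ] ℂ) : L.det = area (L 1) (L Complex.I) := by
  rw [ContinuousLinearMap.det, ← LinearMap.det_toMatrix Complex.basisOneI, Matrix.det_fin_two]
  simp [LinearMap.toMatrix_apply, area]
  ring

theorem area_map (L : ℂ →L[ℝ] ℂ) (v w : ℂ) : area (L v) (L w) = L.det * area v w := by
  rw [det_eq_area, apply_eq_re_im L v, apply_eq_re_im L w]
  simp [area]
  ring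

/-- Complex linearity makes the determinant |L(1)|²: complex charts are oriented, which removes the
absolute value in the density. -/
theorem det_chartSymmDeriv_nonneg {c : X} {y : ℂ} (hy : y ∈ (chartAt ℂ c).target) :
    0 ≤ (chartSymmDeriv c y).det := by
  have h1 := chartSymmDeriv_I_mul hy 1
  rw [mul_one] at h1
  rw [det_eq_area, h1, area]
  simp
  nlinarith [sq_nonneg (chartSymmDeriv c y 1).re, sq_nonneg (chartSymmDeriv c y 1).im]

/-- The conformal factor of a compatible metric with respect to the coordinates. -/
def confDens (g : symTensors ℂ X) (x : X) : ℝ := form ℂ g x 1 1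

theorem confDens_pos {g : symTensors ℂ X} (hg : g ∈ metrics ℂ X) (x : X) : 0 < confDens g x :=
  hg x (1 : ℂ) (one_ne_zero (α := ℂ))

/-- Invariance under J together with symmetry forces g(1, i) = 0 and g(i, i) = g(1, 1). -/
theorem form_eq {g : symTensors ℂ X} (hg : g ∈ kahlerMetrics X) (x : X) (v w : ℂ) :
    form ℂ g x v w = confDens g x * (v.re * w.re + v.im * w.im) := by
  have hJ : ∀ v w : ℂ, form ℂ g x (Complex.I * v) (Complex.I * w) = form ℂ g x v w :=
    fun v w ↦ hg.2 x v w
  have hs : ∀ v w : ℂ, form ℂ g x v w = form ℂ g x w v := fun v w ↦ g.2.2 x v w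
  have h1 : form ℂ g x Complex.I Complex.I = confDens g x := by
    have := hJ 1 1
    rwa [mul_one] at this
  have h2 : form ℂ g x 1 Complex.I = 0 := by
    have h3 := hJ 1 Complex.I
    rw [mul_one, Complex.I_mul_I, map_neg, hs Complex.I 1] at h3
    linarith
  have h3 : form ℂ g x Complex.I 1 = 0 := by rw [hs, h2]
  have h4 : form ℂ g x 1 1 = confDens g x := rfl
  rw [apply_eq_re_im_real (form ℂ g x v) w]
  have h5 : ∀ z : ℂ, form ℂ g x v z = v.re * form ℂ g x 1 z + v.im * form ℂ g x Complex.I z := by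
    intro z
    rw [hs v z, apply_eq_re_im_real (form ℂ g x z) v, hs z 1, hs z Complex.I]
  rw [h5 1, h5 Complex.I, h1, h2, h3, h4]
  ring

theorem kahlerForm_eq {g : symTensors ℂ X} (hg : g ∈ kahlerMetrics X) (x : X) (v w : ℂ) :
    kahlerForm g x v w = confDens g x * area v w := by
  rw [← re_I_mul_eq_area]
  exact form_eq hg x (Complex.I * v) w

/-- The matrix of the Euclidean metric of the plane in the fixed basis. -/
def planeGram : Mat ℂ := Matrix.of fun i j ↦
  (Module.finBasis ℝ ℂ i).re * (Module.finBasis ℝ ℂ j).re +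
    (Module.finBasis ℝ ℂ i).im * (Module.finBasis ℝ ℂ j).im

theorem gram_eq_planeGram {g : symTensors ℂ X} (hg : g ∈ kahlerMetrics X) (x : X) :
    gram ℂ g x = confDens g x • planeGram := by
  ext i j
  exact form_eq hg x _ _

/-- In real dimension 2 the square root of the determinant is linear in the conformal factor. The
constant in front comes from the unspecified basis of ℂ over ℝ used to define the integral. -/
theorem dens_kahler {g : symTensors ℂ X} (hg : g ∈ kahlerMetrics X) {c : X} {y : ℂ}
    (hy : y ∈ (chartAt ℂ c).target) :
    dens g c y = Real.sqrt planeGram.det *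
      (confDens g ((chartAt ℂ c).symm y) * (chartSymmDeriv c y).det) := by
  have e : confDens g ((chartAt ℂ c).symm y) ^ Module.finrank ℝ ℂ =
      confDens g ((chartAt ℂ c).symm y) ^ 2 := by rw [Complex.finrank_real_complex]
  rw [dens, gram_eq_planeGram hg, Matrix.det_smul, Fintype.card_fin, e,
    Real.sqrt_mul (sq_nonneg _), Real.sqrt_sq (confDens_pos hg.1 _).le,
    abs_of_nonneg (det_chartSymmDeriv_nonneg hy)]
  ring

theorem sqrt_det_planeGram_pos [Nonempty X] {g : symTensors ℂ X} (hg : g ∈ kahlerMetrics X) :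
    0 < Real.sqrt planeGram.det := by
  refine Real.sqrt_pos.2 ?_
  have h1 := det_gram_pos hg.1 (Classical.arbitrary X)
  rw [gram_eq_planeGram hg, Matrix.det_smul] at h1
  exact (pos_iff_pos_of_mul_pos h1).1 (pow_pos (confDens_pos hg.1 _) _)

/-- The density of the Kähler form in the preferred chart at `c`. -/
def kahlerDens (g : symTensors ℂ X) (c : X) (y : ℂ) : ℝ :=
  form ℂ g ((chartAt ℂ c).symm y) (chartSymmDeriv c y Complex.I) (chartSymmDeriv c y Complex.I)

theorem kahlerDens_eq {g : symTensors ℂ X} (hg : g ∈ kahlerMetrics X) {c : X} {y : ℂ}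
    (hy : y ∈ (chartAt ℂ c).target) :
    kahlerDens g c y = confDens g ((chartAt ℂ c).symm y) * (chartSymmDeriv c y).det := by
  have h1 := chartSymmDeriv_I_mul hy 1
  rw [mul_one] at h1
  rw [kahlerDens, form_eq hg, det_eq_area, h1, ← re_I_mul_eq_area]

theorem dens_eq_kahlerDens {g : symTensors ℂ X} (hg : g ∈ kahlerMetrics X) {c : X} {y : ℂ}
    (hy : y ∈ (chartAt ℂ c).target) :
    dens g c y = Real.sqrt planeGram.det * kahlerDens g c y := by
  rw [dens_kahler hg hy, kahlerDens_eq hg hy]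

theorem kahlerForm_chart {g : symTensors ℂ X} (hg : g ∈ kahlerMetrics X) {c : X} {y : ℂ}
    (hy : y ∈ (chartAt ℂ c).target) (v w : ℂ) :
    kahlerForm g ((chartAt ℂ c).symm y) (chartSymmDeriv c y v) (chartSymmDeriv c y w) =
      kahlerDens g c y * area v w := by
  have h1 := kahlerForm_eq hg ((chartAt ℂ c).symm y) (chartSymmDeriv c y v) (chartSymmDeriv c y w)
  rw [kahlerDens_eq hg hy, mul_assoc, ← area_map]
  exact h1

theorem contDiffOn_kahlerDens (g : symTensors ℂ X) (c : X) :
    ContDiffOn ℝ ∞ (kahlerDens g c) (chartAt ℂ c).target := by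
  rw [← contMDiffOn_iff_contDiffOn]
  intro y hy
  have h1 : ContMDiffWithinAt 𝓘(ℝ, ℂ) 𝓘(ℝ, ℂ) ∞ (chartAt ℂ c).symm (chartAt ℂ c).target y :=
    contMDiffOn_chart_symm y hy
  have h2 := (contMDiffWithinAt_form_iff (I := 𝓘(ℝ, ℂ)) (E := ℂ) (φ := (chartAt ℂ c).symm)
    (fun z ↦ form ℂ g ((chartAt ℂ c).symm z)) h1 hy ((chartAt ℂ c).map_target hy)).1
    ((g.2.1 _).comp_contMDiffWithinAt y h1) Complex.I Complex.I
  have h3 : ∀ z ∈ (chartAt ℂ c).target, kahlerDens g c z = form ℂ g ((chartAt ℂ c).symm z)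
      (frameL c ((chartAt ℂ c).symm z) Complex.I) (frameL c ((chartAt ℂ c).symm z) Complex.I) := by
    intro z hz
    rw [kahlerDens, frameL_eq ((chartAt ℂ c).map_target hz), (chartAt ℂ c).right_inv hz]
  exact ContMDiffWithinAt.congr h2 h3 (h3 y hy)

/-- The metrics compatible with the complex structure form a conformal class. -/
theorem kahlerMetrics_eq {g₀ : symTensors ℂ X} (hg₀ : g₀ ∈ kahlerMetrics X) :
    kahlerMetrics X = conformalClass ℂ g₀ := by
  ext g
  constructor
  · intro hg
    have h0 : ∀ x, 0 < confDens g x / confDens g₀ x := fun x ↦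
      div_pos (confDens_pos hg.1 x) (confDens_pos hg₀.1 x)
    have h1 : ∀ x, gram ℂ g x = (confDens g x / confDens g₀ x) • gram ℂ g₀ x := fun x ↦ by
      rw [gram_eq_planeGram hg, gram_eq_planeGram hg₀, smul_smul,
        div_mul_cancel₀ _ (confDens_pos hg₀.1 x).ne']
    have h2 : ∀ x, confFactor hg₀.1 g x = confDens g x / confDens g₀ x := fun x ↦ by
      have hd : dim ℂ ≠ 0 := by rw [dim, Complex.finrank_real_complex]; norm_num
      have h3 : tr₁ g₀ g x = confDens g x / confDens g₀ x * dim ℂ := by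
        rw [← tr₁_self hg₀.1 x, tr₁, tr₁, h1, Matrix.mul_smul, Matrix.trace_smul, smul_eq_mul]
      rw [confFactor_apply, h3]
      field_simp
    exact mem_conformalClass_iff.2 ⟨confFactor hg₀.1 g, fun x ↦ by rw [h2]; exact h0 x,
      gram_ext fun x ↦ by rw [gram_fmul, h2, h1]⟩
  · intro hg
    obtain ⟨ρ, h0, rfl⟩ := mem_conformalClass_iff.1 hg
    refine ⟨fmul_mem_metrics hg₀.1 h0, fun x v w ↦ ?_⟩
    rw [val_fmul, val_fmul, hg₀.2]

end Kahler

/-- Outside U the function is zero near each point, since L is closed and contained in U. -/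
theorem contDiff_indicator {E F : Type*} [NormedAddCommGroup E] [NormedSpace ℝ E]
    [NormedAddCommGroup F] [NormedSpace ℝ F] {u : E → F} {U L : Set E} (hU : IsOpen U)
    (hu : ContDiffOn ℝ ∞ u U) (hL : IsClosed L) (hLU : L ⊆ U) (h0 : ∀ y ∈ U, y ∉ L → u y = 0) :
    ContDiff ℝ ∞ (U.indicator u) := by
  rw [contDiff_iff_contDiffAt]
  intro y
  by_cases hy : y ∈ U
  · refine (hu.contDiffAt (hU.mem_nhds hy)).congr_of_eventuallyEq ?_
    filter_upwards [hU.mem_nhds hy] with z hz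
    exact indicator_of_mem hz u
  · refine (contDiffAt_const (c := (0 : F))).congr_of_eventuallyEq ?_
    filter_upwards [hL.isOpen_compl.mem_nhds fun h ↦ hy (hLU h)] with z hz
    by_cases hzU : z ∈ U
    · rw [indicator_of_mem hzU, h0 z hzU hz]
    · exact indicator_of_notMem hzU u

/-! ### Exactness of 2-forms supported in a coordinate box -/

section Local

variable {X : Type*} [TopologicalSpace X] [ChartedSpace ℂ X] [IsManifold 𝓘(ℂ) ω X]

omit [IsManifold 𝓘(ℂ) ω X] in
theorem isCompact_symm_image {p : X} {K : Set ℂ} (hK : IsCompact K) (hKp : K ⊆ (chartAt ℂ p).target) :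
    IsCompact ((chartAt ℂ p).symm '' K) :=
  hK.image_of_continuousOn ((chartAt ℂ p).continuousOn_symm.mono hKp)

omit [IsManifold 𝓘(ℂ) ω X] in
theorem symm_image_subset {p : X} {K : Set ℂ} (hKp : K ⊆ (chartAt ℂ p).target) :
    (chartAt ℂ p).symm '' K ⊆ (chartAt ℂ p).source :=
  image_subset_iff.2 fun _ hy ↦ (chartAt ℂ p).map_target (hKp hy)

omit [IsManifold 𝓘(ℂ) ω X] in
theorem mem_of_symm_mem_image {p : X} {K : Set ℂ} (hKp : K ⊆ (chartAt ℂ p).target) {y : ℂ}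
    (hy : y ∈ (chartAt ℂ p).target) (h : (chartAt ℂ p).symm y ∈ (chartAt ℂ p).symm '' K) : y ∈ K := by
  obtain ⟨z, hz, h⟩ := h
  rwa [← (chartAt ℂ p).symm.injOn (hKp hz) hy h]

/-- A `2`-form supported in a coordinate box is exact as soon as its integral vanishes. -/
theorem isExact_of_box [T2Space X] [CompactSpace X] {g : symTensors ℂ X} (hg : g ∈ kahlerMetrics X)
    {p : X} {a b c d : ℝ} (hab : a < b) (hbox : box a b c d ⊆ (chartAt ℂ p).target) {F : X → ℝ}
    (hF : ContMDiff 𝓘(ℝ, ℂ) 𝓘(ℝ) ∞ F)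
    (h0 : ∀ x ∉ (chartAt ℂ p).symm '' box a b c d, F x = 0) (hI : integral ℂ g F = 0) :
    IsExact (fun x v w ↦ F x * kahlerForm g x v w) := by
  have : Nonempty X := ⟨p⟩
  set T := (chartAt ℂ p).target with hT
  have hT0 : IsOpen T := (chartAt ℂ p).open_target
  set G : ℂ → ℝ := T.indicator fun z ↦ F ((chartAt ℂ p).symm z) * kahlerDens g p z with hG
  have hGz : ∀ z ∈ T, G z = F ((chartAt ℂ p).symm z) * kahlerDens g p z := fun z hz ↦
    indicator_of_mem hz _
  have h0' : ∀ y ∈ T, y ∉ box a b c d → F ((chartAt ℂ p).symm y) = 0 := fun y hy hyb ↦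
    h0 _ fun h ↦ hyb (mem_of_symm_mem_image hbox hy h)
  have hGs : ContDiff ℝ ∞ G := by
    refine contDiff_indicator hT0 (ContDiffOn.mul ?_ (contDiffOn_kahlerDens g p))
      (isCompact_box a b c d).isClosed hbox fun y hy hyb ↦ by rw [h0' y hy hyb, zero_mul]
    rw [← contMDiffOn_iff_contDiffOn]
    exact hF.comp_contMDiffOn (contMDiffOn_chart_symm (x := p))
  have hG0 : ∀ z ∉ box a b c d, G z = 0 := by
    intro z hz
    by_cases hzT : z ∈ T
    · rw [hGz z hzT, h0' z hzT hz, zero_mul]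
    · exact indicator_of_notMem hzT _
  have hGI : ∫ z, G z = 0 := by
    have h1 := integral_eq_chart g hF.continuous
      (isCompact_symm_image (isCompact_box a b c d) hbox) (symm_image_subset hbox) h0
    rw [hI, ← hT] at h1
    have h2 : ∫ z in T, F ((chartAt ℂ p).symm z) * dens g p z ∂coordMeasure ℂ =
        Real.sqrt planeGram.det * ∫ z, G z ∂coordMeasure ℂ := by
      rw [hG, MeasureTheory.integral_indicator hT0.measurableSet, ← MeasureTheory.integral_const_mul]
      refine MeasureTheory.setIntegral_congr_fun hT0.measurableSet fun z hz ↦ ?_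
      rw [dens_eq_kahlerDens hg hz]
      ring
    rw [h2] at h1
    have h3 := (mul_eq_zero.1 h1.symm).resolve_left (sqrt_det_planeGram_pos hg).ne'
    -- The standard measure of ℂ and the coordinate measure are both Haar measures, hence
    -- proportional, so vanishing of the integral passes between them.
    rw [MeasureTheory.Measure.isAddLeftInvariant_eq_smul
      (MeasureTheory.volume : MeasureTheory.Measure ℂ) (coordMeasure ℂ),
      MeasureTheory.integral_smul_nnreal_measure, h3, smul_zero]
  obtain ⟨P, Q, hP, hQ, hP0, hQ0, hPQ⟩ := exists_primitive_of_integral_eq_zero hab hGs hG0 hGI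
  refine isExact_of_chart (c := p) (A := fun z ↦ P z • Complex.reCLM + Q z • Complex.imCLM)
    ((hP.smul contDiff_const).add (hQ.smul contDiff_const)).contDiffOn
    (isCompact_symm_image (isCompact_box a b c d) hbox) (symm_image_subset hbox) ?_ ?_ ?_
  · intro y hy hyb
    have hyb' : y ∉ box a b c d := fun h ↦ hyb (mem_image_of_mem _ h)
    rw [hP0 y hyb', hQ0 y hyb', zero_smul, zero_smul, add_zero]
  · intro x hx v w
    rw [h0 x hx, zero_mul]
  · intro y hy v w
    have hd : (∞ : WithTop ℕ∞) ≠ 0 := by simp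
    have hPd : HasFDerivAt P (fderiv ℝ P y) y := (hP.differentiable hd y).hasFDerivAt
    have hQd : HasFDerivAt Q (fderiv ℝ Q y) y := (hQ.differentiable hd y).hasFDerivAt
    have hA := (hPd.smul_const Complex.reCLM).add (hQd.smul_const Complex.imCLM)
    rw [kahlerForm_chart hg hy, ← mul_assoc, ← hGz y hy, ← hPQ, extDer]
    have hA' : fderiv ℝ (fun z ↦ P z • Complex.reCLM + Q z • Complex.imCLM) y = _ := hA.fderiv
    rw [hA']
    simp only [add_apply, ContinuousLinearMap.smulRight_apply,
      smul_apply, Complex.reCLM_apply, Complex.imCLM_apply, smul_eq_mul]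
    rw [apply_eq_re_im_real (fderiv ℝ P y) v, apply_eq_re_im_real (fderiv ℝ P y) w,
      apply_eq_re_im_real (fderiv ℝ Q y) v, apply_eq_re_im_real (fderiv ℝ Q y) w, area]
    ring

end Local

/-- Integration by parts against the constant function 1. -/
theorem integral_fderiv_eq_zero {E : Type*} [NormedAddCommGroup E] [NormedSpace ℝ E]
    [FiniteDimensional ℝ E] [MeasurableSpace E] [BorelSpace E] (μ : MeasureTheory.Measure E)
    [μ.IsAddHaarMeasure] {u : E → ℝ} (hu : ContDiff ℝ ∞ u) (hc : HasCompactSupport u) (v : E) :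
    ∫ z, fderiv ℝ u z v ∂μ = 0 := by
  have hd : (∞ : WithTop ℕ∞) ≠ 0 := by simp
  have h1 : Continuous fun z ↦ fderiv ℝ u z v := (hu.continuous_fderiv hd).clm_apply continuous_const
  have h2 : HasCompactSupport fun z ↦ fderiv ℝ u z v := hc.fderiv_apply ℝ v
  have h3 := integral_mul_fderiv_eq_neg_fderiv_mul_of_integrable (μ := μ) (f := fun _ : E ↦ (1 : ℝ))
    (g := u) (v := v) (by simp) (by simpa using h1.integrable_of_hasCompactSupport h2)
    (by simpa using hu.continuous.integrable_of_hasCompactSupport hc)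
    (fun _ _ ↦ differentiableAt_const _) fun x _ ↦ hu.differentiable hd x
  simpa using h3

/-- Every alternating 2-form on the plane is a multiple of the area form. -/
theorem extDer_eq_area (A : ℂ → ℂ →L[ℝ] ℝ) (y v w : ℂ) :
    extDer A y v w = extDer A y 1 Complex.I * area v w := by
  have h : ∀ v w : ℂ, fderiv ℝ A y v w =
      v.re * fderiv ℝ A y 1 w + v.im * fderiv ℝ A y Complex.I w := fun v w ↦ by
    have := apply_eq_re_im_real ((fderiv ℝ A y).flip w) v
    simpa only [ContinuousLinearMap.flip_apply] using this
  rw [extDer, extDer, h v, h w, apply_eq_re_im_real (fderiv ℝ A y 1) w,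
    apply_eq_re_im_real (fderiv ℝ A y Complex.I) w, apply_eq_re_im_real (fderiv ℝ A y 1) v,
    apply_eq_re_im_real (fderiv ℝ A y Complex.I) v, area]
  ring

/-! ### Stokes' theorem for 1-forms on a compact surface -/

section Stokes

variable {X : Type*} [TopologicalSpace X] [ChartedSpace ℂ X] [IsManifold 𝓘(ℂ) ω X]
  {g : symTensors ℂ X}

theorem kahlerDens_pos (hg : g ∈ kahlerMetrics X) {c : X} {y : ℂ}
    (hy : y ∈ (chartAt ℂ c).target) : 0 < kahlerDens g c y := by
  have hs := (chartAt ℂ c).map_target hy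
  have h1 := chartDeriv_frameL hs Complex.I
  rw [frameL_eq hs, (chartAt ℂ c).right_inv hy] at h1
  refine hg.1 _ _ fun h0 ↦ Complex.I_ne_zero ?_
  rw [← h1, show chartSymmDeriv c y Complex.I = 0 from h0, map_zero]

/-- The function `f` with `dα = f ω_g`. -/
def curl (g : symTensors ℂ X) (α : OneForm ℂ X) (x : X) : ℝ :=
  extDer (coordForm ℂ α x) (chartAt ℂ x x) 1 Complex.I / kahlerDens g x (chartAt ℂ x x)

/-- At each point `curl` uses the chart preferred at that point; naturality of the exterior
derivative carries the identity to every other chart. -/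
theorem isExtDerAt_curl (hg : g ∈ kahlerMetrics X) (α : OneForm ℂ X) {c : X} {y : ℂ}
    (hy : y ∈ (chartAt ℂ c).target) :
    IsExtDerAt α (fun x v w ↦ curl g α x * kahlerForm g x v w) c y := by
  refine IsExtDerAt.of_trans (mem_overlap_self hy) ?_
  set x := (chartAt ℂ c).symm y with hx
  have h1 : trans c x y = chartAt ℂ x x := rfl
  rw [h1]
  intro v w
  have hxt := mem_chart_target ℂ x
  have h2 := kahlerForm_chart hg hxt v w
  have h3 : curl g α ((chartAt ℂ x).symm (chartAt ℂ x x)) = curl g α x := by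
    rw [(chartAt ℂ x).left_inv (mem_chart_source ℂ x)]
  refine (congrArg₂ (· * ·) h3 h2).trans ?_
  rw [extDer_eq_area, curl, ← mul_assoc, div_mul_cancel₀ _ (kahlerDens_pos hg hxt).ne']

theorem curl_mul_kahlerDens (hg : g ∈ kahlerMetrics X) (α : OneForm ℂ X) {c : X} {y : ℂ}
    (hy : y ∈ (chartAt ℂ c).target) :
    curl g α ((chartAt ℂ c).symm y) * kahlerDens g c y =
      extDer (coordForm ℂ α c) y 1 Complex.I := by
  refine Eq.trans ?_ (isExtDerAt_curl hg α hy 1 Complex.I)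
  refine congrArg (curl g α ((chartAt ℂ c).symm y) * ·) ?_
  rw [kahlerForm_chart hg hy]
  simp [area]

theorem eq_curl (hg : g ∈ kahlerMetrics X) {α : OneForm ℂ X} {f : X → ℝ}
    (h : IsExteriorDerivative ℂ α fun x v w ↦ f x * kahlerForm g x v w) (x : X) :
    f x = curl g α x := by
  have hx := mem_chart_target ℂ x
  have h1 := (isExteriorDerivative_iff α _).1 h x _ hx 1 Complex.I
  rw [← curl_mul_kahlerDens hg α hx, kahlerForm_chart hg hx,
    (chartAt ℂ x).left_inv (mem_chart_source ℂ x)] at h1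
  have h2 : area 1 Complex.I = 1 := by simp [area]
  rw [h2, mul_one] at h1
  exact mul_right_cancel₀ (kahlerDens_pos hg hx).ne' h1

theorem curl_add (α β : OneForm ℂ X) (x : X) : curl g (α + β) x = curl g α x + curl g β x := by
  have hx := mem_chart_target ℂ x
  have h1 : coordForm ℂ (α + β) x = coordForm ℂ α x + coordForm ℂ β x := rfl
  rw [curl, h1, extDer_add (differentiableAt_coordForm α hx) (differentiableAt_coordForm β hx),
    add_div]
  rfl

theorem continuousOn_extDer {A : ℂ → ℂ →L[ℝ] ℝ} {U : Set ℂ} (hU : IsOpen U)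
    (hA : ContDiffOn ℝ ∞ A U) (v w : ℂ) : ContinuousOn (fun y ↦ extDer A y v w) U := by
  have h1 : ContinuousOn (fderiv ℝ A) U := hA.continuousOn_fderiv_of_isOpen hU (by simp)
  exact ((h1.clm_apply continuousOn_const).clm_apply continuousOn_const).sub
    ((h1.clm_apply continuousOn_const).clm_apply continuousOn_const)

theorem continuous_curl (hg : g ∈ kahlerMetrics X) (α : OneForm ℂ X) : Continuous (curl g α) := by
  rw [continuous_iff_continuousAt]
  intro c
  have h1 : ContinuousOn (fun y ↦ extDer (coordForm ℂ α c) y 1 Complex.I / kahlerDens g c y)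
      (chartAt ℂ c).target :=
    (continuousOn_extDer (chartAt ℂ c).open_target (contDiffOn_coordForm α c) 1 Complex.I).div
      (contDiffOn_kahlerDens g c).continuousOn fun y hy ↦ (kahlerDens_pos hg hy).ne'
  have h2 := h1.comp (chartAt ℂ c).continuousOn (chartAt ℂ c).mapsTo
  refine (h2.continuousAt (chart_source_mem_nhds ℂ c)).congr ?_
  filter_upwards [chart_source_mem_nhds ℂ c] with x hx
  have hy := (chartAt ℂ c).map_source hx
  rw [Function.comp_apply, div_eq_iff (kahlerDens_pos hg hy).ne', ← curl_mul_kahlerDens hg α hy,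
    (chartAt ℂ c).left_inv hx]

variable [T2Space X] [CompactSpace X]

/-- In the chart, the form extended by zero is smooth with compact support, and each partial
derivative of its coefficients integrates to zero. -/
theorem integral_curl_of_support (hg : g ∈ kahlerMetrics X) {α : OneForm ℂ X} {c : X} {K : Set X}
    (hK : IsCompact K) (hKc : K ⊆ (chartAt ℂ c).source)
    (h0 : ∀ x ∉ K, ∀ v : ℂ, α x v = (0 : ℝ)) : integral ℂ g (curl g α) = 0 := by
  set T := (chartAt ℂ c).target with hT
  have hT0 : IsOpen T := (chartAt ℂ c).open_target
  have hcurl0 : ∀ x ∉ K, curl g α x = 0 := by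
    intro x hx
    have hx' := mem_chart_target ℂ x
    have h1 : coordForm ℂ α x =ᶠ[nhds (chartAt ℂ x x)] fun _ ↦ 0 := by
      have h2 : ContinuousAt (chartAt ℂ x).symm (chartAt ℂ x x) :=
        (chartAt ℂ x).continuousAt_symm hx'
      have h3 : Kᶜ ∈ nhds ((chartAt ℂ x).symm (chartAt ℂ x x)) := by
        rw [(chartAt ℂ x).left_inv (mem_chart_source ℂ x)]
        exact hK.isClosed.isOpen_compl.mem_nhds hx
      filter_upwards [h2 h3] with y hy
      ext v
      rw [coordForm_apply]
      exact h0 _ hy _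
    rw [curl, extDer_congr h1]
    simp [extDer]
  set L := chartAt ℂ c '' K with hL
  have hLc : IsCompact L := hK.image_of_continuousOn ((chartAt ℂ c).continuousOn.mono hKc)
  have hLT : L ⊆ T := image_subset_iff.2 fun x hx ↦ (chartAt ℂ c).map_source (hKc hx)
  set B : ℂ → ℂ →L[ℝ] ℝ := T.indicator (coordForm ℂ α c) with hB
  have hA0 : ∀ y ∈ T, y ∉ L → coordForm ℂ α c y = 0 := by
    intro y hy hyL
    ext v
    rw [coordForm_apply]
    exact h0 _ (fun h ↦ hyL ⟨_, h, (chartAt ℂ c).right_inv hy⟩) _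
  have hB0 : ∀ y ∉ L, B y = 0 := by
    intro y hyL
    by_cases hy : y ∈ T
    · rw [hB, indicator_of_mem hy, hA0 y hy hyL]
    · exact indicator_of_notMem hy _
  have hB0' : ∀ z ∉ L, B =ᶠ[nhds z] fun _ ↦ 0 := fun z hz ↦ by
    filter_upwards [hLc.isClosed.isOpen_compl.mem_nhds hz] with y hy using hB0 y hy
  have hBs : ContDiff ℝ ∞ B :=
    contDiff_indicator hT0 (contDiffOn_coordForm α c) hLc.isClosed hLT hA0
  have hBd : ∀ v w : ℂ, ∫ z, fderiv ℝ B z v w ∂coordMeasure ℂ = 0 := by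
    intro v w
    have h1 : ∀ z, fderiv ℝ B z v w = fderiv ℝ (fun z ↦ B z w) z v := by
      intro z
      have h2 := ((hBs.differentiable (by simp) z).hasFDerivAt.clm_apply
        (hasFDerivAt_const w z)).fderiv
      rw [h2]
      simp
    simp_rw [h1]
    refine integral_fderiv_eq_zero _ (hBs.clm_apply contDiff_const)
      (HasCompactSupport.intro hLc fun z hz ↦ ?_) v
    rw [hB0 z hz]
    rfl
  have hBi : ∀ v w : ℂ, MeasureTheory.Integrable (fun z ↦ fderiv ℝ B z v w) (coordMeasure ℂ) := by
    intro v w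
    refine Continuous.integrable_of_hasCompactSupport
      (((hBs.continuous_fderiv (by simp)).clm_apply continuous_const).clm_apply continuous_const)
      ?_
    refine HasCompactSupport.intro hLc fun z hz ↦ ?_
    rw [(hB0' z hz).fderiv_eq]
    simp
  rw [integral_eq_chart g (continuous_curl hg α) hK hKc hcurl0]
  have h2 : ∫ z in T, curl g α ((chartAt ℂ c).symm z) * dens g c z ∂coordMeasure ℂ =
      Real.sqrt planeGram.det * ∫ z, extDer B z 1 Complex.I ∂coordMeasure ℂ := by
    rw [← MeasureTheory.setIntegral_eq_integral_of_forall_compl_eq_zero (s := T)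
      (f := fun z ↦ extDer B z 1 Complex.I),
      ← MeasureTheory.integral_const_mul]
    · refine MeasureTheory.setIntegral_congr_fun hT0.measurableSet fun z hz ↦ ?_
      have h3 : extDer B z 1 Complex.I = extDer (coordForm ℂ α c) z 1 Complex.I := by
        refine extDer_congr ?_ _ _
        filter_upwards [hT0.mem_nhds hz] with y hy using indicator_of_mem hy _
      rw [dens_eq_kahlerDens hg hz, h3, ← curl_mul_kahlerDens hg α hz]
      ring
    · intro z hz
      rw [extDer_congr (hB0' z fun h ↦ hz (hLT h))]
      simp [extDer]
  rw [h2]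
  unfold extDer
  rw [MeasureTheory.integral_sub (hBi _ _) (hBi _ _), hBd, hBd, sub_zero, mul_zero]

/-- The product of a function and a `1`-form. -/
def fnSmul (u : Fn ℂ X) (α : OneForm ℂ X) : OneForm ℂ X :=
  ⟨fun x ↦ u x • α x, u.contMDiff.smul_section α.contMDiff⟩

/-- Evaluation of `1`-forms at a point. -/
def evalForm (x : X) : OneForm ℂ X →+ (ℂ →L[ℝ] ℝ) where
  toFun α := α x
  map_zero' := rfl
  map_add' _ _ := rfl

/-- The integral of the exterior derivative of a `1`-form. -/
def integralCurl (hg : g ∈ kahlerMetrics X) : OneForm ℂ X →+ ℝ :=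
  AddMonoidHom.mk' (fun α ↦ integral ℂ g (curl g α)) fun α β ↦ by
    rw [← integral_add g (continuous_curl hg α) (continuous_curl hg β)]
    congr 1
    funext x
    exact curl_add α β x

/-- Stokes' theorem. -/
theorem integral_curl (hg : g ∈ kahlerMetrics X) (α : OneForm ℂ X) :
    integral ℂ g (curl g α) = 0 := by
  set S := (finite_chartPartition (E := ℂ) (M := X)).toFinset with hS
  let u : X → Fn ℂ X := fun c ↦ chartPartition ℂ X c
  -- The partition of unity splits the form into pieces supported in charts. Evaluation and the
  -- integral are packaged as additive homomorphisms so that `map_sum` applies.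
  have h1 : α = ∑ c ∈ S, fnSmul (u c) α := by
    refine ContMDiffSection.ext fun x ↦ ?_
    have h2 : ∑ c ∈ S, u c x = 1 := by
      rw [← (chartPartition ℂ X).sum_eq_one (mem_univ x), finsum_eq_sum_of_support_subset (s := S)]
      intro c hc
      simp only [hS, Finite.coe_toFinset]
      exact ⟨x, hc⟩
    change evalForm x α = evalForm x (∑ c ∈ S, fnSmul (u c) α)
    rw [map_sum]
    have h3 : ∀ c ∈ S, evalForm x (fnSmul (u c) α) = u c x • evalForm x α := fun _ _ ↦ rfl
    rw [Finset.sum_congr rfl h3, ← Finset.sum_smul, h2, one_smul]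
  change integralCurl hg α = 0
  rw [h1, map_sum]
  refine Finset.sum_eq_zero fun c _ ↦ ?_
  refine integral_curl_of_support hg (isClosed_tsupport (chartPartition ℂ X c)).isCompact
    (chartPartition_isSubordinate ℂ X c) fun x hx v ↦ ?_
  have h4 : u c x = 0 := image_eq_zero_of_notMem_tsupport hx
  change u c x * (evalForm x α v) = 0
  rw [h4, zero_mul]

theorem integral_eq_zero_of_isExact (hg : g ∈ kahlerMetrics X) {f : X → ℝ}
    (h : IsExact fun x v w ↦ f x * kahlerForm g x v w) : integral ℂ g f = 0 := by
  obtain ⟨α, hα⟩ := h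
  rw [funext (eq_curl hg hα), integral_curl hg]

end Stokes

theorem exists_box_subset {U : Set ℂ} (hU : IsOpen U) {z : ℂ} (hz : z ∈ U) :
    ∃ a b c d : ℝ, a < b ∧ box a b c d ⊆ U ∧ box a b c d ∈ nhds z := by
  obtain ⟨ε, hε, h⟩ := Metric.isOpen_iff.1 hU z hz
  refine ⟨z.re - ε / 3, z.re + ε / 3, z.im - ε / 3, z.im + ε / 3, by linarith, fun w hw ↦ h ?_, ?_⟩
  · obtain ⟨⟨h1, h2⟩, h3, h4⟩ := hw
    rw [Metric.mem_ball, dist_eq_norm]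
    refine (Complex.norm_le_abs_re_add_abs_im (w - z)).trans_lt ?_
    have h5 : |(w - z).re| ≤ ε / 3 := by
      rw [Complex.sub_re, abs_le]; constructor <;> linarith
    have h6 : |(w - z).im| ≤ ε / 3 := by
      rw [Complex.sub_im, abs_le]; constructor <;> linarith
    linarith
  · refine Filter.inter_mem ?_ ?_
    · exact Complex.continuous_re.continuousAt (Icc_mem_nhds (by linarith) (by linarith))
    · exact Complex.continuous_im.continuousAt (Icc_mem_nhds (by linarith) (by linarith))

theorem IsExact.congr {E : Type*} [NormedAddCommGroup E] [NormedSpace ℝ E] {M : Type*}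
    [TopologicalSpace M] [ChartedSpace E M] [IsManifold 𝓘(ℝ, E) ∞ M] {β γ : M → E → E → ℝ}
    (h : IsExact β) (e : ∀ x v w, β x v w = γ x v w) : IsExact γ := by
  have : β = γ := by funext x v w; exact e x v w
  rwa [← this]

/-! ### Exactness by vanishing integral, and Kähler classes -/

section Kahler

variable {X : Type*} [TopologicalSpace X] [ChartedSpace ℂ X] [IsManifold 𝓘(ℂ) ω X]
  {g : symTensors ℂ X}

/-- The `2`-form `f ω_g` is exact. -/
def IsExactMul (g : symTensors ℂ X) (f : X → ℝ) : Prop :=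
  IsExact fun x v w ↦ f x * kahlerForm g x v w

theorem IsExactMul.add {f k : X → ℝ} (hf : IsExactMul g f) (hk : IsExactMul g k) :
    IsExactMul g fun x ↦ f x + k x :=
  (IsExact.add hf hk).congr fun _ _ _ ↦ (add_mul _ _ _).symm

theorem IsExactMul.const_mul {f : X → ℝ} (hf : IsExactMul g f) (r : ℝ) :
    IsExactMul g fun x ↦ r * f x :=
  (IsExact.const_mul hf r).congr fun _ _ _ ↦ (mul_assoc _ _ _).symm

variable [T2Space X] [CompactSpace X]

/-- An open set on which compactly supported `2`-forms of integral zero are exact. -/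
def IsExactOn (g : symTensors ℂ X) (B : Set X) : Prop :=
  ∀ F : X → ℝ, ContMDiff 𝓘(ℝ, ℂ) 𝓘(ℝ) ∞ F → (∀ x ∉ B, F x = 0) → integral ℂ g F = 0 →
    IsExactMul g F

theorem exists_isExactOn (hg : g ∈ kahlerMetrics X) (p : X) :
    ∃ B : Set X, IsOpen B ∧ p ∈ B ∧ IsExactOn g B := by
  obtain ⟨a, b, c, d, hab, h1, h2⟩ :=
    exists_box_subset (chartAt ℂ p).open_target (mem_chart_target ℂ p)
  refine ⟨(chartAt ℂ p).source ∩ chartAt ℂ p ⁻¹' interior (box a b c d),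
    (chartAt ℂ p).isOpen_inter_preimage isOpen_interior,
    ⟨mem_chart_source ℂ p, mem_interior_iff_mem_nhds.2 h2⟩, fun F hF h0 hI ↦ ?_⟩
  refine isExact_of_box hg hab h1 hF (fun x hx ↦ h0 x fun h ↦ hx ?_) hI
  exact ⟨_, interior_subset h.2, (chartAt ℂ p).left_inv h.1⟩

theorem exists_bump_integral_eq_one (hg : g ∈ metrics ℂ X) {U : Set X} (hU : IsOpen U)
    (hne : U.Nonempty) : ∃ ψ : X → ℝ, ContMDiff 𝓘(ℝ, ℂ) 𝓘(ℝ) ∞ ψ ∧ (∀ x ∉ U, ψ x = 0) ∧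
      integral ℂ g ψ = 1 := by
  obtain ⟨f, hf, hs, h0⟩ := hU.exists_contMDiff_support_eq (n := ⊤) 𝓘(ℝ, ℂ)
  have hne' : integral ℂ g f ≠ 0 := fun h ↦ by
    obtain ⟨x, hx⟩ := hne
    rw [← hf] at hx
    exact hx (eq_zero_of_integral_eq_zero hg hs.continuous h0 h x)
  refine ⟨fun x ↦ (integral ℂ g f)⁻¹ * f x, contMDiff_const.mul hs, fun x hx ↦ ?_, ?_⟩
  · rw [← hf] at hx
    beta_reduce
    rw [Function.notMem_support.1 hx, mul_zero]
  · rw [integral_const_mul, inv_mul_cancel₀ hne']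

/-- On a connected compact surface a `2`-form is exact as soon as its integral vanishes. -/
theorem isExactMul_of_integral_eq_zero [ConnectedSpace X] (hg : g ∈ kahlerMetrics X) {f : X → ℝ}
    (hf : ContMDiff 𝓘(ℝ, ℂ) 𝓘(ℝ) ∞ f) (hI : integral ℂ g f = 0) : IsExactMul g f := by
  choose B hBo hB hBe using exists_isExactOn hg
  obtain ⟨p₀⟩ : Nonempty X := inferInstance
  obtain ⟨φ, hφ, hφ0, hφ1⟩ := exists_bump_integral_eq_one hg.1 (hBo p₀) ⟨p₀, hB p₀⟩
  -- Modulo exact forms, F should equal its integral times the fixed bump φ near p₀. S collects the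
  -- points whose neighbourhood `B p` has this property for all functions supported in it.
  let Good (F : X → ℝ) : Prop := IsExactMul g fun x ↦ F x - integral ℂ g F * φ x
  let S : Set X := {p | ∀ F : X → ℝ, ContMDiff 𝓘(ℝ, ℂ) 𝓘(ℝ) ∞ F → (∀ x ∉ B p, F x = 0) → Good F}
  have hsub : ∀ {F ψ : X → ℝ}, ContMDiff 𝓘(ℝ, ℂ) 𝓘(ℝ) ∞ F → ContMDiff 𝓘(ℝ, ℂ) 𝓘(ℝ) ∞ ψ →
      integral ℂ g ψ = 1 → ∀ p, (∀ x ∉ B p, F x = 0) → (∀ x ∉ B p, ψ x = 0) →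
      IsExactMul g fun x ↦ F x - integral ℂ g F * ψ x := by
    intro F ψ hF hψ h1 p hF0 hψ0
    refine hBe p _ (hF.sub (contMDiff_const.mul hψ)) (fun x hx ↦ ?_) ?_
    · rw [hF0 x hx, hψ0 x hx, mul_zero, sub_zero]
    · rw [integral_sub g hF.continuous (k := fun x ↦ integral ℂ g F * ψ x)
        (continuous_const.mul hψ.continuous), integral_const_mul, h1,
        mul_one, sub_self]
  have hS₀ : p₀ ∈ S := fun F hF hF0 ↦ hsub hF hφ hφ1 p₀ hF0 hφ0
  -- A bump ψ of integral 1 in the overlap links the two sets: F is equivalent to (∫F)ψ inside `B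
  -- q`, and ψ is equivalent to φ since its support lies in `B p`.
  have hstep : ∀ p q, p ∈ S → (B p ∩ B q).Nonempty → q ∈ S := by
    intro p q hp hne F hF hF0
    obtain ⟨ψ, hψ, hψ0, hψ1⟩ := exists_bump_integral_eq_one hg.1 ((hBo p).inter (hBo q)) hne
    have h1 := hsub hF hψ hψ1 q hF0 fun x hx ↦ hψ0 x fun h ↦ hx h.2
    have h2 := (hp ψ hψ fun x hx ↦ hψ0 x fun h ↦ hx h.1).const_mul (integral ℂ g F)
    refine cast (congrArg (IsExactMul g) (funext fun x ↦ ?_)) (h1.add h2)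
    rw [hψ1]
    ring
  -- By the linking step S and its complement are both open, and S contains p₀.
  have hS : S = univ := by
    refine IsClopen.eq_univ ⟨⟨isOpen_iff_mem_nhds.2 fun q hq ↦ ?_⟩,
      isOpen_iff_mem_nhds.2 fun q hq ↦ ?_⟩ ⟨p₀, hS₀⟩
    · filter_upwards [(hBo q).mem_nhds (hB q)] with r hr hrS
      exact hq (hstep r q hrS ⟨r, hB r, hr⟩)
    · filter_upwards [(hBo q).mem_nhds (hB q)] with r hr
      exact hstep q r hq ⟨r, hr, hB r⟩
  obtain ⟨χ, hχ⟩ := SmoothPartitionOfUnity.exists_isSubordinate 𝓘(ℝ, ℂ) isClosed_univ B hBo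
    fun x _ ↦ mem_iUnion.2 ⟨x, hB x⟩
  have hχf : ∀ i, ContMDiff 𝓘(ℝ, ℂ) 𝓘(ℝ) ∞ fun x ↦ χ i x * f x := fun i ↦ (χ i).contMDiff.mul hf
  have hsum : ∀ s : Finset X, (ContMDiff 𝓘(ℝ, ℂ) 𝓘(ℝ) ∞ fun x ↦ ∑ i ∈ s, χ i x * f x) ∧
      Good fun x ↦ ∑ i ∈ s, χ i x * f x := by
    intro s
    induction s using Finset.cons_induction with
    | empty =>
      simp only [Finset.sum_empty]
      refine ⟨contMDiff_const, (hS₀ _ contMDiff_const fun _ _ ↦ rfl)⟩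
    | cons i s hi ih =>
      simp only [Finset.sum_cons]
      refine ⟨(hχf i).add ih.1, ?_⟩
      have h1 : Good fun x ↦ χ i x * f x := by
        have hi : i ∈ S := hS ▸ mem_univ i
        refine hi _ (hχf i) fun x hx ↦ ?_
        rw [image_eq_zero_of_notMem_tsupport fun h ↦ hx (hχ i h), zero_mul]
      refine cast (congrArg (IsExactMul g) (funext fun x ↦ ?_)) (h1.add ih.2)
      rw [integral_add g (hχf i).continuous ih.1.continuous]
      ring
  have hfin := χ.locallyFinite.finite_nonempty_of_compact
  have hf' : (fun x ↦ ∑ i ∈ hfin.toFinset, χ i x * f x) = f := by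
    funext x
    have h2 : ∑ i ∈ hfin.toFinset, χ i x = 1 := by
      rw [← χ.sum_eq_one (mem_univ x), finsum_eq_sum_of_support_subset (s := hfin.toFinset)]
      intro i hi
      simp only [Finite.coe_toFinset]
      exact ⟨x, hi⟩
    rw [← Finset.sum_mul, h2, one_mul]
  have h := (hsum hfin.toFinset).2
  rw [hf'] at h
  refine cast (congrArg (IsExactMul g) (funext fun x ↦ ?_)) h
  rw [hI, zero_mul, sub_zero]

/-- The Kähler forms of ρg₀ and g₀ differ by (ρ - 1)ω, and since n = 2 the volume of ρg₀ is ∫ ρ. So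
both conditions say that ρ - 1 has integral zero. -/
theorem kahlerClass_eq [ConnectedSpace X] {g₀ : symTensors ℂ X} (hg₀ : g₀ ∈ kahlerMetrics X) :
    kahlerClass g₀ = confVol g₀ (vol ℂ g₀) := by
  have key : ∀ ρ : Fn ℂ X, (∃ α : OneForm ℂ X, IsExteriorDerivative ℂ α fun x v w ↦
      kahlerForm (fmul ρ g₀) x v w - kahlerForm g₀ x v w) ↔ IsExactMul g₀ fun x ↦ ρ x - 1 := by
    intro ρ
    refine exists_congr fun α ↦ ?_
    have h : (fun (x : X) (v w : TangentSpace 𝓘(ℝ, ℂ) x) ↦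
        kahlerForm (fmul ρ g₀) x v w - kahlerForm g₀ x v w) =
        fun x v w ↦ (ρ x - 1) * kahlerForm g₀ x v w := by
      funext x v w
      rw [sub_mul, one_mul, kahlerForm, val_fmul]
      rfl
    rw [h]
    rfl
  have hint : ∀ ρ : Fn ℂ X, integral ℂ g₀ (fun x ↦ ρ x ^ (dim ℂ / 2)) = vol ℂ g₀ ↔
      integral ℂ g₀ (fun x ↦ ρ x - 1) = 0 := by
    intro ρ
    have hd : dim ℂ / 2 = 1 := by
      rw [dim, Complex.finrank_real_complex]; norm_num
    simp only [hd, Real.rpow_one]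
    rw [integral_sub g₀ ρ.contMDiff.continuous continuous_const, sub_eq_zero]
    rfl
  ext g
  rw [mem_confVol_iff hg₀.1]
  constructor
  · rintro ⟨h1, h2⟩
    rw [kahlerMetrics_eq hg₀] at h1
    obtain ⟨ρ, h0, rfl⟩ := mem_conformalClass_iff.1 h1
    exact ⟨ρ, h0, rfl, (hint ρ).2 (integral_eq_zero_of_isExact hg₀ ((key ρ).1 h2))⟩
  · rintro ⟨ρ, h0, rfl, h2⟩
    refine ⟨?_, (key ρ).2 (isExactMul_of_integral_eq_zero hg₀
      (ρ.contMDiff.sub contMDiff_const) ((hint ρ).1 h2))⟩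
    rw [kahlerMetrics_eq hg₀]
    exact mem_conformalClass_iff.2 ⟨ρ, h0, rfl⟩

end Kahler

end RiemMetrics

end

theorem corollary4p3 :
    -- metrics of fixed volume in a conformal class
    (∀ (E : Type*) [NormedAddCommGroup E] [NormedSpace ℝ E] [FiniteDimensional ℝ E]
        (M : Type*) [TopologicalSpace M] [T2Space M] [CompactSpace M] [ChartedSpace E M]
        [IsManifold 𝓘(ℝ, E) ∞ M] (n : ℕ), Module.finrank ℝ E = n → 1 ≤ n →
      (∃ Γ, RiemMetrics.IsLeviCivita E (M := M) (RiemMetrics.gN E) Γ) ∧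
      ∀ Γ, RiemMetrics.IsLeviCivita E (M := M) (RiemMetrics.gN E) Γ →
      ∀ g ∈ RiemMetrics.metrics E M, ∀ v : ℝ, 0 < v →
        RiemMetrics.IsTotallyGeodesic E Γ
          (RiemMetrics.conformalClass E g ∩ RiemMetrics.metricsOfVol E M v) ∧
        RiemMetrics.HasConstantCurvature E (RiemMetrics.gN E) Γ
          (RiemMetrics.conformalClass E g ∩ RiemMetrics.metricsOfVol E M v) (n / 16) ∧
        RiemMetrics.IsPortionOfSphere E (RiemMetrics.gN E)
          (RiemMetrics.conformalClass E g ∩ RiemMetrics.metricsOfVol E M v) (16 / n)) ∧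
    -- Kähler metrics in a Kähler class on a compact Riemann surface
    (∀ (X : Type*) [TopologicalSpace X] [T2Space X] [CompactSpace X] [ConnectedSpace X]
        [ChartedSpace ℂ X] [IsManifold 𝓘(ℂ) ω X],
      (∃ Γ, RiemMetrics.IsLeviCivita ℂ (M := X) (RiemMetrics.gN ℂ) Γ) ∧
      ∀ Γ, RiemMetrics.IsLeviCivita ℂ (M := X) (RiemMetrics.gN ℂ) Γ →
      ∀ g₀ ∈ RiemMetrics.kahlerMetrics X,
        RiemMetrics.IsTotallyGeodesic ℂ Γ (RiemMetrics.kahlerClass g₀) ∧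
        RiemMetrics.HasConstantCurvature ℂ (RiemMetrics.gN ℂ) Γ
          (RiemMetrics.kahlerClass g₀) (1 / 8) ∧
        RiemMetrics.IsPortionOfSphere ℂ (RiemMetrics.gN ℂ) (RiemMetrics.kahlerClass g₀) 8) := by
  refine ⟨?_, ?_⟩
  · intro E _ _ _ M _ _ _ _ _ n hn h1
    have hd : RiemMetrics.dim E = n := by rw [RiemMetrics.dim, hn]
    have hn0 : 0 < RiemMetrics.dim E := by rw [hd]; exact_mod_cast h1
    refine ⟨⟨_, RiemMetrics.calabiConnection_isLeviCivita⟩, fun Γ hΓ g hg v hv ↦ ?_⟩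
    rw [← hd]
    exact ⟨RiemMetrics.isTotallyGeodesic_confVol hΓ hg hn0 hv,
      RiemMetrics.hasConstantCurvature_confVol hΓ g hn0 hv,
      RiemMetrics.isPortionOfSphere_confVol hg hn0 hv⟩
  · intro X _ _ _ _ _ _
    refine ⟨⟨_, RiemMetrics.calabiConnection_isLeviCivita⟩, fun Γ hΓ g₀ hg₀ ↦ ?_⟩
    have hd : RiemMetrics.dim ℂ = 2 := by
      rw [RiemMetrics.dim, Complex.finrank_real_complex, Nat.cast_ofNat]
    have hn0 : 0 < RiemMetrics.dim ℂ := by rw [hd]; exact two_pos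
    have hv := RiemMetrics.vol_pos hg₀.1
    have e1 : (1 / 8 : ℝ) = RiemMetrics.dim ℂ / 16 := by rw [hd]; norm_num
    have e2 : (8 : ℝ) = 16 / RiemMetrics.dim ℂ := by rw [hd]; norm_num
    rw [RiemMetrics.kahlerClass_eq hg₀, e1, e2]
    exact ⟨RiemMetrics.isTotallyGeodesic_confVol hΓ hg₀.1 hn0 hv,
      RiemMetrics.hasConstantCurvature_confVol hΓ g₀ hn0 hv,
      RiemMetrics.isPortionOfSphere_confVol hg₀.1 hn0 hv⟩
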